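/- All graphs are finite, simple and undirected. A graph $G$ is $B_0$-VPG if to each vertex $v$ one can assign a horizontal or vertical path $P_v$ of the grid $\mathbb Z^2$ (a single grid point being allowed as a path) such that two distinct vertices $u,v$ are adjacent if and only if $P_u$ and $P_v$ share at least one grid point. A cutpoint of $G$ is a vertex whose removal increases the number of connected components, and a block of $G$ is a maximal connected subgraph that has no cutpoint of its own. A block graph is a connected graph all of whose blocks are complete. An endblock is a block containing exactly one cutpoint of the graph, and a $2$-cutpoint is a cutpoint that belongs to exactly two blocks, one of which is an endblock. The thin spider $N_n$ has $2n$ vertices $c_1,\dots,c_n,s_1,\dots,s_n$, where the $c_i$ are pairwise adjacent, the $s_i$ are pairwise nonadjacent, and $s_i$ is adjacent to $c_j$ if and only if $i=j$. Let $\mathcal F$ be the family of all graphs that are obtained, up to isomorphism, from $N_5$ by a finite sequence (possibly empty) of applications of the following procedure: in the current graph take a complete subgraph $H$ of size $4$ having two distinct $2$-cutpoints $v_1,v_2$, with endblocks $B_1\ni v_1$ and $B_2\ni v_2$; contract $v_1$ and $v_2$ into a single vertex $x$; then replace $B_1-\{x\}$ and $B_2-\{x\}$ by two disjoint thin spiders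 $N_3$, making $x$ adjacent to the three clique vertices $c_1,c_2,c_3$ of each of the two spiders (and to no other spider vertex). Theorem. Let $G$ be a block graph. Then $G$ is $B_0$-VPG if and only if no induced subgraph of $G$ is isomorphic to a member of $\mathcal F$. Moreover, every graph in $\mathcal F$ is minimal non-$B_0$-VPG: it is not $B_0$-VPG, but each of its proper induced subgraphs is. The family $\mathcal F$ is infinite; indeed it has members with arbitrarily many vertices. -/

import Mathlib

/-! ### Graphs of horizontal and vertical grid paths -/

/-- The set of grid points `P` is the vertex set of a horizontal path of the grid `ℤ × ℤ`
(a single grid point is allowed). -/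
def IsHorizontalGridPath (P : Set (ℤ × ℤ)) : Prop :=
  ∃ a b y : ℤ, a ≤ b ∧ P = {p | a ≤ p.1 ∧ p.1 ≤ b ∧ p.2 = y}

/-- The set of grid points `P` is the vertex set of a vertical path of the grid `ℤ × ℤ`
(a single grid point is allowed). -/
def IsVerticalGridPath (P : Set (ℤ × ℤ)) : Prop :=
  ∃ x a b : ℤ, a ≤ b ∧ P = {p | p.1 = x ∧ a ≤ p.2 ∧ p.2 ≤ b}

/-- `G` has a representation by horizontal and vertical grid paths: distinct vertices are adjacent
if and only if their paths share at least one grid point. -/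
def IsB0VPG {V : Type*} (G : SimpleGraph V) : Prop :=
  ∃ P : V → Set (ℤ × ℤ),
    (∀ v, IsHorizontalGridPath (P v) ∨ IsVerticalGridPath (P v)) ∧
    ∀ u v, u ≠ v → (G.Adj u v ↔ (P u ∩ P v).Nonempty)

/-- `G` is not `B₀`-VPG, but each of its proper induced subgraphs is. -/
def IsMinimalNonB0VPG {V : Type*} (G : SimpleGraph V) : Prop :=
  ¬ IsB0VPG G ∧ ∀ S : Set V, S ≠ Set.univ → IsB0VPG (G.induce S)

/-! ### Blocks of finite graphs -/

/-- A cutpoint: a vertex whose removal increases the number of connected components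
(used for finite graphs). -/
def IsCutpoint {V : Type*} (G : SimpleGraph V) (v : V) : Prop :=
  Nat.card G.ConnectedComponent < Nat.card (G.induce {v}ᶜ).ConnectedComponent

/-- A block, given by its vertex set: a maximal connected subgraph without cutpoints of its own. -/
def IsBlock {V : Type*} (G : SimpleGraph V) (B : Set V) : Prop :=
  Maximal (fun S : Set V => (G.induce S).Connected ∧ ∀ v, ¬ IsCutpoint (G.induce S) v) B

/-- A block graph: a connected graph each of whose blocks is complete. -/
def IsBlockGraph {V : Type*} (G : SimpleGraph V) : Prop :=
  G.Connected ∧ ∀ B, IsBlock G B → G.IsClique B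

/-- An endblock: a block that has exactly one cutpoint of the graph. -/
def IsEndblock {V : Type*} (G : SimpleGraph V) (B : Set V) : Prop :=
  IsBlock G B ∧ {v | v ∈ B ∧ IsCutpoint G v}.ncard = 1

/-- A 2-cutpoint: a cutpoint that belongs to exactly two blocks, one of which is an endblock. -/
def IsTwoCutpoint {V : Type*} (G : SimpleGraph V) (v : V) : Prop :=
  IsCutpoint G v ∧ {B | IsBlock G B ∧ v ∈ B}.ncard = 2 ∧ ∃ B, IsEndblock G B ∧ v ∈ B

/-! ### The family of forbidden graphs -/

/-- The thin spider of size `n`: `Sum.inl i` is the clique vertex `cᵢ` and `Sum.inr i` is the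
vertex `sᵢ`, whose only neighbour is `cᵢ`. -/
def thinSpider (n : ℕ) : SimpleGraph (Fin n ⊕ Fin n) where
  Adj a b := match a, b with
    | .inl i, .inl j => i ≠ j
    | .inl i, .inr j => i = j
    | .inr i, .inl j => i = j
    | .inr _, .inr _ => False
  symm := ⟨by rintro (i | i) (j | j) h <;> simp_all [eq_comm]⟩
  loopless := ⟨by rintro (i | i) h <;> simp_all⟩

/-- The vertices after the replacement in a graph on `V`, where `B` is the set of vertices that
disappear: the vertices outside `B`, the new vertex `x`, and two thin spiders of size 3. -/
inductive ReplaceVertex {V : Type*} (B : Set V) where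
  | old (u : V) (hu : u ∉ B)
  | x
  | spider (i : Fin 2) (a : Fin 3 ⊕ Fin 3)

/-- `v₁` and `v₂` are contracted into `x`, and the rests of `B₁` and `B₂` are replaced by two thin
spiders of size 3, where `x` is adjacent to the clique vertices of both spiders. -/
def spiderReplace {V : Type*} (G : SimpleGraph V) (v₁ v₂ : V) (B₁ B₂ : Set V) :
    SimpleGraph (ReplaceVertex (B₁ ∪ B₂)) where
  Adj a b := match a, b with
    | .old u _, .old w _ => G.Adj u w
    | .old u _, .x => G.Adj v₁ u ∨ G.Adj v₂ u
    | .x, .old u _ => G.Adj v₁ u ∨ G.Adj v₂ u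
    | .x, .spider _ a => a.isLeft
    | .spider _ a, .x => a.isLeft
    | .spider i a, .spider j b => i = j ∧ (thinSpider 3).Adj a b
    | .x, .x => False
    | .old _ _, .spider _ _ => False
    | .spider _ _, .old _ _ => False
  symm := ⟨by
    rintro (⟨u, hu⟩ | _ | ⟨i, a⟩) (⟨w, hw⟩ | _ | ⟨j, b⟩) h
    all_goals first
      | exact h
      | exact SimpleGraph.Adj.symm (G := G) h
      | exact ⟨h.1.symm, SimpleGraph.Adj.symm (G := thinSpider 3) h.2⟩⟩
  loopless := ⟨by
    rintro (⟨u, hu⟩ | _ | ⟨i, a⟩) h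
    · exact G.irrefl h
    · exact h
    · exact (thinSpider 3).irrefl h.2⟩

/-- `G'` arises (up to isomorphism) from `G` by one application of the procedure: a complete
subgraph `H` of size 4 has two 2-cutpoints `v₁` and `v₂`, with endblocks `B₁` and `B₂`. -/
def IsSpiderReplacement {V W : Type*} (G : SimpleGraph V) (G' : SimpleGraph W) : Prop :=
  ∃ (H : Set V) (v₁ v₂ : V) (B₁ B₂ : Set V),
    G.IsClique H ∧ H.ncard = 4 ∧ v₁ ∈ H ∧ v₂ ∈ H ∧ v₁ ≠ v₂ ∧
    IsTwoCutpoint G v₁ ∧ IsTwoCutpoint G v₂ ∧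
    IsEndblock G B₁ ∧ v₁ ∈ B₁ ∧ IsEndblock G B₂ ∧ v₂ ∈ B₂ ∧
    Nonempty (G' ≃g spiderReplace G v₁ v₂ B₁ B₂)

/-- The family `𝓕`: the graphs obtained, up to isomorphism, from the thin spider of size 5 by
finitely many applications of the procedure. -/
inductive FamilyF : {W : Type} → SimpleGraph W → Prop
  | base {W : Type} {G : SimpleGraph W} (h : Nonempty (G ≃g thinSpider 5)) : FamilyF G
  | step {V W : Type} {G : SimpleGraph V} {G' : SimpleGraph W}
      (hG : FamilyF G) (h : IsSpiderReplacement G G') : FamilyF G'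

/-- `G` contains no induced subgraph isomorphic to a member of `𝓕`. -/
def IsFamilyFFree {V : Type*} (G : SimpleGraph V) : Prop :=
  ∀ (W : Type) (F : SimpleGraph W), FamilyF F → ¬ F.IsIndContained G

/-!
A finite connected graph is a block graph exactly if any two nonadjacent neighbours of a vertex are
separated by this vertex (`TreeLike`). In this form the property passes to induced subgraphs and to
the graphs produced by the replacement procedure, the cutpoints are the vertices with two
nonadjacent neighbours (`Branching`), and the blocks are the maximal cliques.

The paths of a block share a grid point, at which four directions are available. A branching vertex
of the block uses one of them if the block lies at an end of its path and two otherwise, and a path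
has only two ends. So a representation assigns ends to blocks, subject to the conditions collected
in `Admissible`: among three branching vertices of a block at most one is not at an end, among four
none, and five are impossible. Conversely, admissible ends give a representation
(`TreeLike.isB0VPG`): the blocks are attached one by one, with short segments in the real plane that
leave room for the blocks still to come, and in the end the coordinates are replaced by their ranks.

*Members of the family are not representable* (`FamilyF.not_isB0VPG`). The thin spider of size 5
needs five directions. In a representation of the graph after a replacement, both spiders need an
end of the path of `x`, so the common point of the old clique lies between them. Cutting the path
there gives the paths of `v₁` and `v₂` in a representation of the graph before the replacement.

*Members are minimal* (`FamilyF.isMinimalNonB0VPG`). After the deletion of any vertex there are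
admissible ends, by induction along the procedure (`FamilyF.exists_admissible`).

*A block graph without members of the family is representable*
(`IsFamilyFFree.exists_admissible`). Certain induced subgraphs on one side of a vertex force the
block on this side to lie at an end of its path (`Hangs`): three further branching vertices in the
block, or a triangle one of whose other vertices has two other ends forced already. Unfolding
this recursion gives a binary tree of thin spiders of size 3 (`SpiderTree`), each inner node of
which is the effect of one replacement. Three such trees at one vertex form a member of the family
(`familyF_tripod`), so at most two ends are forced at each vertex. The forced ends, together with
the block towards a fixed root wherever this leaves a path with at most two ends, are admissible: if
the block of a triangle of branching vertices is an end for neither of two of them, then neither has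
two ends forced elsewhere, as this would force the block for the other one; but from one of the two
the block lies towards the root, and so it was chosen there.

The graphs of the binary trees also show that the family is infinite (`exists_familyF_card`).
-/

/-! ### Block graphs without blocks -/

/-- A vertex with two nonadjacent neighbours. In a block graph these are the cutpoints. -/
def Branching {V : Type*} (G : SimpleGraph V) (v : V) : Prop :=
  ∃ a b, G.Adj v a ∧ G.Adj v b ∧ a ≠ b ∧ ¬ G.Adj a b

/-- Any two nonadjacent neighbours of a vertex `v` are separated by `v`; the separation is
witnessed by a set `X` of vertices whose only exit is `v`. A connected finite graph is a block
graph if and only if it has this property. -/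
def TreeLike {V : Type*} (G : SimpleGraph V) : Prop :=
  ∀ v a b, G.Adj v a → G.Adj v b → a ≠ b → ¬ G.Adj a b →
    ∃ X : Set V, a ∈ X ∧ b ∉ X ∧ v ∉ X ∧ ∀ p ∈ X, ∀ q, G.Adj p q → q ∈ X ∨ q = v

/-- The vertices that can be reached from `a` by a walk that avoids `v`. -/
def side {V : Type*} (G : SimpleGraph V) (v a : V) : Set V :=
  {b | ∃ p : G.Walk a b, v ∉ p.support}

section Side

variable {V : Type*} {G : SimpleGraph V} {v a b c : V}

lemma mem_side_self (h : v ≠ a) : a ∈ side G v a := ⟨.nil, by simpa using h⟩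

lemma not_mem_side : v ∉ side G v a := fun ⟨p, hp⟩ => hp p.end_mem_support

lemma side_symm (h : b ∈ side G v a) : a ∈ side G v b := by
  obtain ⟨p, hp⟩ := h
  exact ⟨p.reverse, by simpa using hp⟩

lemma side_trans (h : b ∈ side G v a) (h' : c ∈ side G v b) : c ∈ side G v a := by
  obtain ⟨p, hp⟩ := h
  obtain ⟨q, hq⟩ := h'
  refine ⟨p.append q, ?_⟩
  rw [SimpleGraph.Walk.mem_support_append_iff]
  tauto

lemma mem_side_of_adj (h : G.Adj a b) (ha : v ≠ a) (hb : v ≠ b) : b ∈ side G v a :=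
  ⟨.cons h .nil, by simp [ha, hb]⟩

lemma side_closed (h : b ∈ side G v a) (hbc : G.Adj b c) : c ∈ side G v a ∨ c = v := by
  by_cases hc : c = v
  · exact .inr hc
  · refine .inl (side_trans h (mem_side_of_adj hbc ?_ (Ne.symm hc)))
    rintro rfl
    exact not_mem_side h

lemma side_subset {X : Set V} (ha : a ∈ X) (hX : ∀ p ∈ X, ∀ q, G.Adj p q → q ∈ X ∨ q = v) :
    side G v a ⊆ X := by
  rintro b ⟨p, hp⟩
  induction p with
  | nil => exact ha
  | cons h p ih =>
    simp only [SimpleGraph.Walk.support_cons, List.mem_cons, not_or] at hp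
    rcases hX _ ha _ h with h' | h'
    · exact ih h' hp.2
    · exact absurd (h' ▸ p.start_mem_support) hp.2

/-- In a tree-like graph two neighbours of `v` on the same side of `v` are adjacent. -/
lemma TreeLike.adj_of_mem_side (hG : TreeLike G) (ha : G.Adj v a) (hb : G.Adj v b) (hab : a ≠ b)
    (h : b ∈ side G v a) : G.Adj a b := by
  by_contra hn
  obtain ⟨X, haX, hbX, -, hX⟩ := hG v a b ha hb hab hn
  exact hbX (side_subset haX hX h)

/-- Two vertices that are adjacent to both ends of an edge are adjacent. -/
lemma TreeLike.adj_of_adj_edge (hG : TreeLike G) (hab : a ≠ b) (hva : G.Adj v a) (hvb : G.Adj v b)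
    (hca : G.Adj c a) (hcb : G.Adj c b) (hvc : v ≠ c) : G.Adj a b :=
  hG.adj_of_mem_side hva hvb hab
    (side_trans (mem_side_of_adj hca.symm hva.ne hvc) (mem_side_of_adj hcb hvc hvb.ne))

lemma side_disjoint {x : V} (h : b ∉ side G v a) (hx : x ∈ side G v a) : x ∉ side G v b :=
  fun h' => h (side_trans hx (side_symm h'))

lemma TreeLike.not_mem_side (hG : TreeLike G) (ha : G.Adj v a) (hb : G.Adj v b) (hab : a ≠ b)
    (h : ¬ G.Adj a b) : b ∉ side G v a := fun h' => h (hG.adj_of_mem_side ha hb hab h')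

/-- A side of a neighbour `a` of `v` that does not contain `v` is part of the side of `a` at `v`. -/
lemma side_subset_side (h : v ∉ side G a b) (hva : G.Adj v a) (hab : G.Adj a b) (hvb : v ≠ b) :
    side G a b ⊆ side G v a := by
  classical
  have hb : b ∈ side G v a := mem_side_of_adj hab hva.ne hvb
  rintro x ⟨p, hp⟩
  refine side_trans hb ⟨p, fun hv => h ?_⟩
  exact ⟨p.takeUntil v hv, fun h' => hp (p.support_takeUntil_subset_support hv h')⟩

lemma preconnected_induce_induce {S : Set V} (z : S)
    (h : ∀ a ∈ S, ∀ b ∈ S, a ≠ z → b ≠ z → ∃ p : G.Walk a b, ∀ u ∈ p.support, u ∈ S ∧ u ≠ z) :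
    ((G.induce S).induce {z}ᶜ).Preconnected := by
  rintro ⟨⟨a, ha⟩, haz⟩ ⟨⟨b, hb⟩, hbz⟩
  have haz' : a ≠ z := fun h => haz (Subtype.ext h)
  have hbz' : b ≠ z := fun h => hbz (Subtype.ext h)
  obtain ⟨p, hp⟩ := h a ha b hb haz' hbz'
  refine ⟨(p.induce S fun u hu => (hp u hu).1).induce {z}ᶜ ?_⟩
  intro u hu huz
  rw [SimpleGraph.Walk.support_induce] at hu
  simp only [List.mem_attachWith] at hu
  exact (hp _ hu).2 (congrArg Subtype.val huz)

lemma exists_induced_path_of_not_isClique {S : Set V} (hS : (G.induce S).Connected)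
    (h : ¬ G.IsClique S) : ∃ v ∈ S, ∃ a ∈ S, ∃ b ∈ S, G.Adj v a ∧ G.Adj v b ∧ a ≠ b ∧
      ¬ G.Adj a b := by
  by_contra! hcon
  apply h
  intro a ha b hb
  obtain ⟨p⟩ := hS.preconnected ⟨a, ha⟩ ⟨b, hb⟩
  have : ∀ (x y : S) (p : (G.induce S).Walk x y), (x : V) ≠ y → G.Adj x y := by
    intro x y p
    induction p with
    | nil => simp
    | @cons x z y hxz p ih =>
      intro hxy
      by_cases hzy : (z : V) = y
      · rw [← hzy]; exact hxz
      · exact hcon z z.2 x x.2 y y.2 (SimpleGraph.Adj.symm hxz) (ih hzy) hxy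
  exact this _ _ p

end Side

section Blocks

variable {V : Type*} [Finite V] {G : SimpleGraph V}

lemma not_isCutpoint_of_preconnected {z : V} (h : (G.induce {z}ᶜ).Preconnected) :
    ¬ IsCutpoint G z := by
  have h1 : Nat.card (G.induce {z}ᶜ).ConnectedComponent ≤ 1 := by
    have := h.subsingleton_connectedComponent
    exact Finite.card_le_one_iff_subsingleton.2 this
  have h2 : 0 < Nat.card G.ConnectedComponent := by
    have : Nonempty G.ConnectedComponent := ⟨G.connectedComponentMk z⟩
    exact Nat.card_pos
  unfold IsCutpoint
  omega

/-- In a block graph, a vertex set that stays connected when any of its vertices is removed is a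
clique. -/
lemma IsBlockGraph.isClique (hG : IsBlockGraph G) {S : Set V} (hS : (G.induce S).Connected)
    (h : ∀ z ∈ S, ∀ a ∈ S, ∀ b ∈ S, a ≠ z → b ≠ z →
      ∃ p : G.Walk a b, ∀ u ∈ p.support, u ∈ S ∧ u ≠ z) : G.IsClique S := by
  have hP : (G.induce S).Connected ∧ ∀ v, ¬ IsCutpoint (G.induce S) v :=
    ⟨hS, fun z => not_isCutpoint_of_preconnected (preconnected_induce_induce z (h z z.2))⟩
  obtain ⟨B, hSB, hB⟩ := (Set.toFinite {S : Set V | (G.induce S).Connected ∧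
    ∀ v, ¬ IsCutpoint (G.induce S) v}).exists_le_maximal hP
  exact (hG.2 B hB).subset hSB

/-- Two neighbours of `v` that are joined by a path avoiding `v` lie on a cycle, whose vertices
form a clique. -/
lemma IsBlockGraph.treeLike (hG : IsBlockGraph G) : TreeLike G := by
  classical
  intro v a b ha hb hab hn
  refine ⟨side G v a, mem_side_self ha.ne, fun hbs => hn ?_, not_mem_side,
    fun p hp q hpq => side_closed hp hpq⟩
  obtain ⟨p₀, hp₀⟩ := hbs
  obtain ⟨p, hp, hvp⟩ : ∃ p : G.Walk a b, p.IsPath ∧ v ∉ p.support :=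
    ⟨p₀.bypass, p₀.bypass_isPath, fun h => hp₀ (p₀.support_bypass_subset_support h)⟩
  have key : ∀ z ∈ insert v {u | u ∈ p.support}, z ≠ v → ∀ y ∈ insert v {u | u ∈ p.support},
      y ≠ z → ∃ q : G.Walk y v, ∀ u ∈ q.support, u ∈ insert v {u | u ∈ p.support} ∧ u ≠ z := by
    intro z hz hzv y hy hyz
    rcases hy with rfl | hy
    · exact ⟨.nil, by simpa using hyz⟩
    have hz : z ∈ p.support := hz.resolve_left hzv
    by_cases h1 : z ∈ (p.takeUntil y hy).support
    · have h2 : z ∉ (p.dropUntil y hy).support := by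
        intro h2
        have hnd := hp.support_nodup
        rw [← p.take_spec hy, SimpleGraph.Walk.support_append, List.nodup_append] at hnd
        rw [SimpleGraph.Walk.mem_support_iff] at h2
        exact hnd.2.2 z h1 z (h2.resolve_left hyz.symm) rfl
      refine ⟨(p.dropUntil y hy).concat hb.symm, fun u hu => ?_⟩
      rw [SimpleGraph.Walk.support_concat, List.mem_append,
        List.mem_singleton] at hu
      rcases hu with hu | rfl
      · exact ⟨.inr (p.support_dropUntil_subset_support hy hu), fun h => h2 (h ▸ hu)⟩
      · exact ⟨.inl rfl, hzv.symm⟩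
    · refine ⟨(p.takeUntil y hy).reverse.concat ha.symm, fun u hu => ?_⟩
      rw [SimpleGraph.Walk.support_concat, List.mem_append,
        List.mem_singleton, SimpleGraph.Walk.support_reverse, List.mem_reverse] at hu
      rcases hu with hu | rfl
      · exact ⟨.inr (p.support_takeUntil_subset_support hy hu), fun h => h1 (h ▸ hu)⟩
      · exact ⟨.inl rfl, hzv.symm⟩
  refine hG.isClique (S := insert v {u | u ∈ p.support}) ?_ ?_ (.inr p.start_mem_support)
    (.inr p.end_mem_support) hab
  · have : insert v {u | u ∈ p.support} = {u | u ∈ (SimpleGraph.Walk.cons ha p).support} := by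
      ext u; simp
    rw [this]
    exact SimpleGraph.Walk.connected_induce_support _
  · intro z hz x hx y hy hxz hyz
    by_cases hzv : z = v
    · subst hzv
      have hx := hx.resolve_left hxz
      have hy := hy.resolve_left hyz
      refine ⟨(p.takeUntil x hx).reverse.append (p.takeUntil y hy), fun u hu => ?_⟩
      have hu : u ∈ p.support := by
        rw [SimpleGraph.Walk.mem_support_append_iff, SimpleGraph.Walk.support_reverse,
          List.mem_reverse] at hu
        exact hu.elim (fun h => p.support_takeUntil_subset_support _ h)
          (fun h => p.support_takeUntil_subset_support _ h)
      exact ⟨.inr hu, fun h => hvp (h ▸ hu)⟩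
    · obtain ⟨q, hq⟩ := key z hz hzv x hx hxz
      obtain ⟨q', hq'⟩ := key z hz hzv y hy hyz
      refine ⟨q.append q'.reverse, fun u hu => ?_⟩
      rw [SimpleGraph.Walk.mem_support_append_iff, SimpleGraph.Walk.support_reverse,
          List.mem_reverse] at hu
      exact hu.elim (hq u) (hq' u)

lemma TreeLike.isBlockGraph (hT : TreeLike G) (hG : G.Connected) : IsBlockGraph G := by
  refine ⟨hG, fun B hB => ?_⟩
  by_contra hcl
  obtain ⟨hBc, hBv⟩ := hB.prop
  obtain ⟨v, hv, a, ha, b, hb, hva, hvb, hab, hn⟩ := exists_induced_path_of_not_isClique hBc hcl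
  have hcard := hBv ⟨v, hv⟩
  unfold IsCutpoint at hcard
  have h1 : Nat.card (G.induce B).ConnectedComponent ≤ 1 :=
    Finite.card_le_one_iff_subsingleton.2 hBc.preconnected.subsingleton_connectedComponent
  have h2 : Subsingleton ((G.induce B).induce {⟨v, hv⟩}ᶜ).ConnectedComponent :=
    Finite.card_le_one_iff_subsingleton.1 ((not_lt.1 hcard).trans h1)
  have hav : (⟨a, ha⟩ : B) ∈ ({⟨v, hv⟩}ᶜ : Set B) := fun h => hva.ne (congrArg Subtype.val h).symm
  have hbv : (⟨b, hb⟩ : B) ∈ ({⟨v, hv⟩}ᶜ : Set B) := fun h => hvb.ne (congrArg Subtype.val h).symm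
  have hr : ((G.induce B).induce {⟨v, hv⟩}ᶜ).Reachable ⟨⟨a, ha⟩, hav⟩ ⟨⟨b, hb⟩, hbv⟩ :=
    SimpleGraph.ConnectedComponent.exact (Subsingleton.elim _ _)
  obtain ⟨p⟩ := hr
  obtain ⟨X, haX, hbX, -, hX⟩ := hT v a b hva hvb hab hn
  have : ∀ (x y : ({⟨v, hv⟩}ᶜ : Set B)) (p : ((G.induce B).induce {⟨v, hv⟩}ᶜ).Walk x y),
      (x : V) ∈ X → (y : V) ∈ X := by
    intro x y p
    induction p with
    | nil => exact id
    | @cons x z y hxz p ih =>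
      intro hx
      refine ih ((hX x hx z hxz).resolve_right fun h => z.2 (Subtype.ext h))
  exact hbX (this _ _ p haX)

lemma isCutpoint_iff_branching (hT : TreeLike G) (hG : G.Connected) {v : V} :
    IsCutpoint G v ↔ Branching G v := by
  constructor
  · intro hv
    by_contra hn
    refine not_isCutpoint_of_preconnected ?_ hv
    have key : ∀ (x w : V) (p : G.Walk x w) (hw : w ≠ v),
        (∀ hx : x ≠ v, (G.induce {v}ᶜ).Reachable ⟨x, hx⟩ ⟨w, hw⟩) ∧
        (x = v → ∀ y (hy : G.Adj v y), (G.induce {v}ᶜ).Reachable ⟨y, hy.ne'⟩ ⟨w, hw⟩) := by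
      intro x w p hw
      induction p with
      | nil => exact ⟨fun _ => .refl _, fun h => absurd h hw⟩
      | @cons x z w hxz p ih =>
        constructor
        · intro hx
          by_cases hz : z = v
          · subst hz
            exact (ih hw).2 rfl x hxz.symm
          · refine SimpleGraph.Reachable.trans ?_ ((ih hw).1 hz)
            exact SimpleGraph.Adj.reachable (G := G.induce {v}ᶜ) (u := ⟨x, hx⟩) (v := ⟨z, hz⟩) hxz
        · rintro rfl y hy
          refine SimpleGraph.Reachable.trans ?_ ((ih hw).1 hxz.ne')
          by_cases hyz : y = z
          · subst hyz; exact .refl _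
          · have : G.Adj y z := by
              by_contra h
              exact hn ⟨y, z, hy, hxz, hyz, h⟩
            exact SimpleGraph.Adj.reachable (G := G.induce {x}ᶜ) (u := ⟨y, hy.ne'⟩)
              (v := ⟨z, hxz.ne'⟩) this
    rintro ⟨x, hx⟩ ⟨w, hw⟩
    obtain ⟨p⟩ := hG.preconnected x w
    exact (key x w p hw).1 hx
  · rintro ⟨a, b, ha, hb, hab, hn⟩
    have h1 : Nat.card G.ConnectedComponent ≤ 1 :=
      Finite.card_le_one_iff_subsingleton.2 hG.preconnected.subsingleton_connectedComponent
    refine lt_of_le_of_lt h1 ?_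
    by_contra h2
    have h2 : Subsingleton (G.induce {v}ᶜ).ConnectedComponent :=
      Finite.card_le_one_iff_subsingleton.1 (not_lt.1 h2)
    have hr : (G.induce {v}ᶜ).Reachable ⟨a, ha.ne'⟩ ⟨b, hb.ne'⟩ :=
      SimpleGraph.ConnectedComponent.exact (Subsingleton.elim _ _)
    obtain ⟨p⟩ := hr
    obtain ⟨X, haX, hbX, -, hX⟩ := hT v a b ha hb hab hn
    have : ∀ (x y : ({v}ᶜ : Set V)) (p : (G.induce {v}ᶜ).Walk x y), (x : V) ∈ X → (y : V) ∈ X := by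
      intro x y p
      induction p with
      | nil => exact id
      | @cons x z y hxz p ih =>
        intro hx
        exact ih ((hX x hx z hxz).resolve_right z.2)
    exact hbX (this _ _ p haX)

lemma isBlock_iff_maximal_isClique (hT : TreeLike G) (hG : G.Connected) {B : Set V} :
    IsBlock G B ↔ Maximal (fun S => G.IsClique S) B := by
  have hBG := hT.isBlockGraph hG
  have hne : ∀ S : Set V, Maximal (fun S => G.IsClique S) S → S.Nonempty := by
    intro S hS
    by_contra h
    rw [Set.not_nonempty_iff_eq_empty] at h
    obtain ⟨x⟩ := hG.nonempty
    have := hS.le_of_ge (y := {x}) (by simp) (by simp [h]) (Set.mem_singleton x)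
    simp [h] at this
  have hcl : ∀ S : Set V, S.Nonempty → G.IsClique S →
      (G.induce S).Connected ∧ ∀ v, ¬ IsCutpoint (G.induce S) v := by
    intro S hS hSc
    have hw : ∀ a ∈ S, ∀ b ∈ S, ∃ p : G.Walk a b, ∀ u ∈ p.support, u = a ∨ u = b := by
      intro a ha b hb
      by_cases hab : a = b
      · subst hab; exact ⟨.nil, by simp⟩
      · exact ⟨.cons (hSc ha hb hab) .nil, by simp⟩
    refine ⟨?_, fun z => not_isCutpoint_of_preconnected (preconnected_induce_induce z ?_)⟩
    · have := hS.to_subtype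
      refine ⟨?_⟩
      rintro ⟨a, ha⟩ ⟨b, hb⟩
      obtain ⟨p, hp⟩ := hw a ha b hb
      refine ⟨p.induce S fun u hu => ?_⟩
      rcases hp u hu with rfl | rfl <;> assumption
    · intro a ha b hb haz hbz
      obtain ⟨p, hp⟩ := hw a ha b hb
      refine ⟨p, fun u hu => ?_⟩
      rcases hp u hu with rfl | rfl
      exacts [⟨ha, haz⟩, ⟨hb, hbz⟩]
  constructor
  · intro hB
    refine ⟨hBG.2 B hB, fun S hS hBS => ?_⟩
    have hBne : B.Nonempty := by
      obtain ⟨x⟩ := hB.prop.1.nonempty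
      exact ⟨x, x.2⟩
    exact hB.le_of_ge (hcl S (hBne.mono hBS) hS) hBS
  · intro hB
    obtain ⟨C, hBC, hC⟩ := (Set.toFinite {S : Set V | (G.induce S).Connected ∧
      ∀ v, ¬ IsCutpoint (G.induce S) v}).exists_le_maximal (hcl B (hne B hB) hB.prop)
    have : B = C := hBC.antisymm (hB.le_of_ge (hBG.2 C hC) hBC)
    rw [this]
    exact hC

end Blocks

/-! ### The replacement procedure in block graphs -/

/-- The local structure of a block graph at two adjacent 2-cutpoints `v₁`, `v₂` with endblocks
`B₁`, `B₂`: the endblocks are disjoint cliques attached only at `v₁` and `v₂`, and the other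
neighbours of `v₁` and `v₂` form one nonempty clique. -/
structure SpiderSite {V : Type*} (G : SimpleGraph V) (v₁ v₂ : V) (B₁ B₂ : Set V) : Prop where
  adj : G.Adj v₁ v₂
  mem₁ : v₁ ∈ B₁
  mem₂ : v₂ ∈ B₂
  disj : Disjoint B₁ B₂
  clique₁ : G.IsClique B₁
  clique₂ : G.IsClique B₂
  closed₁ : ∀ t ∈ B₁, t ≠ v₁ → ∀ z, G.Adj t z → z ∈ B₁
  closed₂ : ∀ t ∈ B₂, t ≠ v₂ → ∀ z, G.Adj t z → z ∈ B₂
  twin : ∀ u ∉ B₁ ∪ B₂, G.Adj v₁ u ↔ G.Adj v₂ u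
  old_clique : ∀ u ∉ B₁ ∪ B₂, ∀ w ∉ B₁ ∪ B₂, G.Adj v₁ u → G.Adj v₁ w → u ≠ w → G.Adj u w
  exists_old : ∃ u ∉ B₁ ∪ B₂, G.Adj v₁ u
  exists₁ : ∃ s ∈ B₁, s ≠ v₁
  exists₂ : ∃ s ∈ B₂, s ≠ v₂

section Site

variable {V : Type*} {G : SimpleGraph V} {v₁ v₂ : V} {B₁ B₂ : Set V}

lemma exists_maximal_isClique [Finite V] {H : Set V} (hH : G.IsClique H) :
    ∃ Q, H ⊆ Q ∧ Maximal (fun S => G.IsClique S) Q :=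
  (Set.toFinite {S : Set V | G.IsClique S}).exists_le_maximal hH

lemma IsEndblock.eq_of_isCutpoint {B : Set V} (hB : IsEndblock G B) {v w : V} (hv : v ∈ B)
    (hw : w ∈ B) (hcv : IsCutpoint G v) (hcw : IsCutpoint G w) : v = w := by
  obtain ⟨x, hx⟩ := Set.ncard_eq_one.1 hB.2
  have h1 : v ∈ ({x} : Set V) := hx ▸ ⟨hv, hcv⟩
  have h2 : w ∈ ({x} : Set V) := hx ▸ ⟨hw, hcw⟩
  rw [h1, h2]

/-- A vertex that is no cutpoint has all its neighbours in one block. -/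
lemma mem_block_of_adj [Finite V] (hT : TreeLike G) (hG : G.Connected) {B : Set V}
    (hB : IsBlock G B) {t z : V} (ht : t ∈ B) (hct : ¬ IsCutpoint G t) (h : G.Adj t z) :
    z ∈ B := by
  rw [isCutpoint_iff_branching hT hG] at hct
  rw [isBlock_iff_maximal_isClique hT hG] at hB
  refine hB.le_of_ge (y := insert z B) ?_ (Set.subset_insert _ _) (Set.mem_insert _ _)
  refine hB.prop.insert fun b hb hzb => ?_
  by_cases htb : t = b
  · exact htb ▸ h.symm
  · by_contra hn
    exact hct ⟨z, b, h, hB.prop ht hb htb, hzb, hn⟩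

lemma spiderSite_of_isTwoCutpoint [Finite V] (hT : TreeLike G) (hG : G.Connected) {H : Set V}
    (hH : G.IsClique H) (hcard : H.ncard = 4) (h1 : v₁ ∈ H) (h2 : v₂ ∈ H) (h12 : v₁ ≠ v₂)
    (ht1 : IsTwoCutpoint G v₁) (ht2 : IsTwoCutpoint G v₂) (hB1 : IsEndblock G B₁) (hm1 : v₁ ∈ B₁)
    (hB2 : IsEndblock G B₂) (hm2 : v₂ ∈ B₂) : SpiderSite G v₁ v₂ B₁ B₂ := by
  have hbl : ∀ B, IsBlock G B ↔ Maximal (fun S => G.IsClique S) B :=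
    fun B => isBlock_iff_maximal_isClique hT hG
  have hM1 := (hbl _).1 hB1.1
  have hM2 := (hbl _).1 hB2.1
  have hcl : ∀ (v w : V) (B : Set V), IsEndblock G B → v ∈ B → IsCutpoint G v → ∀ t ∈ B, t ≠ v →
      ∀ z, G.Adj t z → z ∈ B := by
    intro v _ B hB hv hc t ht htv z hz
    exact mem_block_of_adj hT hG hB.1 ht (fun h => htv (hB.eq_of_isCutpoint ht hv h hc)) hz
  have hcl1 := hcl v₁ v₁ B₁ hB1 hm1 ht1.1
  have hcl2 := hcl v₂ v₂ B₂ hB2 hm2 ht2.1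
  have hv2 : v₂ ∉ B₁ := fun h => h12 (hB1.eq_of_isCutpoint hm1 h ht1.1 ht2.1)
  have hv1 : v₁ ∉ B₂ := fun h => h12 (hB2.eq_of_isCutpoint h hm2 ht1.1 ht2.1)
  obtain ⟨Q, hHQ, hQ⟩ := exists_maximal_isClique hH
  -- a 2-cutpoint of `Q` lies in no further block than its endblock and `Q`
  have hnb : ∀ (v w : V) (B : Set V), IsTwoCutpoint G v → IsEndblock G B → v ∈ B → w ∉ B →
      v ∈ Q → w ∈ Q → ∀ u, G.Adj v u → u ∈ B ∨ u ∈ Q := by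
    intro v w B ht hB hvB hwB hvQ hwQ u hvu
    obtain ⟨R, hR, hRM⟩ := exists_maximal_isClique (G := G) (H := {v, u})
      (by rw [SimpleGraph.isClique_pair]; exact fun _ => hvu)
    have hBQ : B ≠ Q := fun h => hwB (h ▸ hwQ)
    have hsub : ({B, Q} : Set (Set V)) = {B | IsBlock G B ∧ v ∈ B} := by
      refine Set.eq_of_subset_of_ncard_le ?_ ?_ (Set.toFinite _)
      · rintro S (rfl | rfl)
        · exact ⟨hB.1, hvB⟩
        · exact ⟨(hbl _).2 hQ, hvQ⟩
      · rw [ht.2.1, Set.ncard_pair hBQ]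
    have hRm : R ∈ ({B, Q} : Set (Set V)) := by
      rw [hsub]; exact ⟨(hbl _).2 hRM, hR (by simp)⟩
    have huR : u ∈ R := hR (by simp)
    rcases hRm with rfl | rfl
    exacts [.inl huR, .inr huR]
  have hnb1 := hnb v₁ v₂ B₁ ht1 hB1 hm1 hv2 (hHQ h1) (hHQ h2)
  have hnb2 := hnb v₂ v₁ B₂ ht2 hB2 hm2 hv1 (hHQ h2) (hHQ h1)
  have hd : Disjoint B₁ B₂ := by
    rw [Set.disjoint_left]
    intro t ht1' ht2'
    have htv : t ≠ v₁ := fun h => hv1 (h ▸ ht2')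
    have htv' : t ≠ v₂ := fun h => hv2 (h ▸ ht1')
    exact hv1 (hcl2 t ht2' htv' v₁ (hM1.prop ht1' hm1 htv))
  have hQu : ∀ u ∉ B₁ ∪ B₂, (G.Adj v₁ u ↔ u ∈ Q) ∧ (G.Adj v₂ u ↔ u ∈ Q) := by
    intro u hu
    rw [Set.mem_union, not_or] at hu
    refine ⟨⟨fun h => (hnb1 u h).resolve_left hu.1, fun h => hQ.prop (hHQ h1) h ?_⟩,
      ⟨fun h => (hnb2 u h).resolve_left hu.2, fun h => hQ.prop (hHQ h2) h ?_⟩⟩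
    · rintro rfl; exact hu.1 hm1
    · rintro rfl; exact hu.2 hm2
  have hex : ∀ (v : V) (B : Set V), IsCutpoint G v → Maximal (fun S => G.IsClique S) B → v ∈ B →
      ∃ s ∈ B, s ≠ v := by
    intro v B hc hM hv
    obtain ⟨a, b, ha, -⟩ := (isCutpoint_iff_branching hT hG).1 hc
    by_contra! hn
    have : a ∈ B := hM.le_of_ge (y := {v, a})
      (by rw [SimpleGraph.isClique_pair]; exact fun _ => ha)
      (fun s hs => by rw [hn s hs]; simp) (by simp)
    exact ha.ne (hn a this).symm
  refine ⟨hH h1 h2 h12, hm1, hm2, hd, hM1.prop, hM2.prop, hcl1, hcl2,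
    fun u hu => (hQu u hu).1.trans (hQu u hu).2.symm, ?_, ?_, hex _ _ ht1.1 hM1 hm1,
    hex _ _ ht2.1 hM2 hm2⟩
  · intro u hu w hw hau haw huw
    exact hQ.prop ((hQu u hu).1.1 hau) ((hQu w hw).1.1 haw) huw
  · obtain ⟨q, hq, hq1, hq2⟩ : ∃ q ∈ H, q ≠ v₁ ∧ q ≠ v₂ := by
      by_contra! hn
      have : H ⊆ {v₁, v₂} := fun q hq => by
        by_cases h : q = v₁
        · simp [h]
        · simp [hn q hq h]
      have := Set.ncard_le_ncard this (Set.toFinite _)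
      rw [Set.ncard_pair h12] at this
      omega
    refine ⟨q, ?_, hH h1 hq hq1.symm⟩
    rintro (h | h)
    · exact hv2 (hcl1 q h hq1 _ (hH hq h2 hq2))
    · exact hv1 (hcl2 q h hq2 _ (hH hq h1 hq1))

end Site

section Replace

variable {V : Type*} {G : SimpleGraph V} {v₁ v₂ : V} {B₁ B₂ : Set V}

lemma SpiderSite.old_ne₁ (h : SpiderSite G v₁ v₂ B₁ B₂) {u : V} (hu : u ∉ B₁ ∪ B₂) : u ≠ v₁ :=
  fun h' => hu (.inl (h' ▸ h.mem₁))

lemma SpiderSite.old_ne₂ (h : SpiderSite G v₁ v₂ B₁ B₂) {u : V} (hu : u ∉ B₁ ∪ B₂) : u ≠ v₂ :=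
  fun h' => hu (.inr (h' ▸ h.mem₂))

lemma SpiderSite.adj_old_x (h : SpiderSite G v₁ v₂ B₁ B₂) {u : V} (hu : u ∉ B₁ ∪ B₂) :
    (spiderReplace G v₁ v₂ B₁ B₂).Adj (.old u hu) .x ↔ G.Adj v₁ u := by
  have := h.twin u hu
  simp only [spiderReplace]
  tauto

lemma SpiderSite.adj_x_old (h : SpiderSite G v₁ v₂ B₁ B₂) {u : V} (hu : u ∉ B₁ ∪ B₂) :
    (spiderReplace G v₁ v₂ B₁ B₂).Adj .x (.old u hu) ↔ G.Adj v₁ u := by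
  rw [SimpleGraph.adj_comm, h.adj_old_x hu]

instance ReplaceVertex.finite [Finite V] (B : Set V) : Finite (ReplaceVertex B) := by
  refine Finite.of_surjective
    (fun a : {u // u ∉ B} ⊕ (Unit ⊕ Fin 2 × (Fin 3 ⊕ Fin 3)) => match a with
      | .inl u => ReplaceVertex.old u.1 u.2
      | .inr (.inl _) => .x
      | .inr (.inr p) => .spider p.1 p.2) ?_
  rintro (⟨u, hu⟩ | _ | ⟨i, a⟩)
  · exact ⟨.inl ⟨u, hu⟩, rfl⟩
  · exact ⟨.inr (.inl ()), rfl⟩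
  · exact ⟨.inr (.inr (i, a)), rfl⟩

lemma SpiderSite.connected (h : SpiderSite G v₁ v₂ B₁ B₂) (hG : G.Connected) :
    (spiderReplace G v₁ v₂ B₁ B₂).Connected := by
  classical
  set G' := spiderReplace G v₁ v₂ B₁ B₂ with hG'
  let π : V → ReplaceVertex (B₁ ∪ B₂) := fun u => if hu : u ∈ B₁ ∪ B₂ then .x else .old u hu
  have hx : ∀ u ∉ B₁ ∪ B₂, ∀ w ∈ B₁ ∪ B₂, G.Adj u w → G.Adj v₁ u := by
    intro u hu w hw huw
    rcases hw with hw | hw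
    · by_cases hwv : w = v₁
      · exact hwv ▸ huw.symm
      · exact absurd (.inl (h.closed₁ w hw hwv u huw.symm)) hu
    · by_cases hwv : w = v₂
      · exact (h.twin u hu).2 (hwv ▸ huw.symm)
      · exact absurd (.inr (h.closed₂ w hw hwv u huw.symm)) hu
  have hπ : ∀ u w, G.Adj u w → G'.Reachable (π u) (π w) := by
    intro u w huw
    by_cases hu : u ∈ B₁ ∪ B₂ <;> by_cases hw : w ∈ B₁ ∪ B₂
    · rw [show π u = .x from dif_pos hu, show π w = .x from dif_pos hw]
    · simp only [π, hu, hw, dif_pos, dif_neg, not_false_iff]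
      exact ((h.adj_x_old hw).2 (hx w hw u hu huw.symm)).reachable
    · simp only [π, hu, hw, dif_pos, dif_neg, not_false_iff]
      exact ((h.adj_old_x hu).2 (hx u hu w hw huw)).reachable
    · simp only [π, hu, hw, dif_neg, not_false_iff]
      exact SimpleGraph.Adj.reachable (G := G') (u := .old u hu) (v := .old w hw) huw
  have hπr : ∀ u w, G'.Reachable (π u) (π w) := by
    intro u w
    obtain ⟨p⟩ := hG.preconnected u w
    induction p with
    | nil => exact .refl _
    | cons h p ih => exact (hπ _ _ h).trans ih
  have hπ1 : π v₁ = .x := by simp [π, h.mem₁]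
  have hr : ∀ a, G'.Reachable a .x := by
    rintro (⟨u, hu⟩ | _ | ⟨i, a | a⟩)
    · have := hπr u v₁
      rwa [hπ1, show π u = .old u hu from dif_neg hu] at this
    · exact .refl _
    · exact SimpleGraph.Adj.reachable (G := G') (u := .spider i (.inl a)) (v := .x) rfl
    · exact (SimpleGraph.Adj.reachable (G := G') (u := .spider i (.inr a))
        (v := .spider i (.inl a)) ⟨rfl, rfl⟩).trans
        (SimpleGraph.Adj.reachable (G := G') (u := .spider i (.inl a)) (v := .x) rfl)
  have : Nonempty (ReplaceVertex (B₁ ∪ B₂)) := ⟨.x⟩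
  exact ⟨fun a b => (hr a).trans (hr b).symm⟩

/-- To check that a graph is tree-like, one of the two orders of each pair is enough. -/
lemma treeLike_of_separation_or {V : Type*} {G : SimpleGraph V}
    (h : ∀ v a b, G.Adj v a → G.Adj v b → a ≠ b → ¬ G.Adj a b →
      ∃ X : Set V, (a ∈ X ∧ b ∉ X ∨ b ∈ X ∧ a ∉ X) ∧ v ∉ X ∧
        ∀ p ∈ X, ∀ q, G.Adj p q → q ∈ X ∨ q = v) : TreeLike G := by
  intro v a b ha hb hab hn
  obtain ⟨X, hX, hv, hcl⟩ := h v a b ha hb hab hn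
  rcases hX with hX | hX
  · exact ⟨X, hX.1, hX.2, hv, hcl⟩
  · refine ⟨{u | u ∉ X ∧ u ≠ v}, ⟨hX.2, ha.ne'⟩, fun h => h.1 hX.1, fun h => h.2 rfl, ?_⟩
    rintro p ⟨hpX, hpv⟩ q hpq
    by_cases hqv : q = v
    · exact .inr hqv
    · exact .inl ⟨fun hq => (hcl q hq p hpq.symm).elim hpX hpv, hqv⟩

lemma SpiderSite.treeLike (h : SpiderSite G v₁ v₂ B₁ B₂) (hT : TreeLike G) :
    TreeLike (spiderReplace G v₁ v₂ B₁ B₂) := by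
  apply treeLike_of_separation_or
  -- separations at an old vertex come from `G`, where `v₁` stands for `x`
  have old : ∀ (v : V) (hv : v ∉ B₁ ∪ B₂) (X : Set V),
      (∀ p ∈ X, ∀ q, G.Adj p q → q ∈ X ∨ q = v) →
      ∀ p ∈ {a : ReplaceVertex (B₁ ∪ B₂) | match a with
        | .old u _ => u ∈ X
        | _ => v₁ ∈ X}, ∀ q, (spiderReplace G v₁ v₂ B₁ B₂).Adj p q → q ∈ {a | match a with
        | .old u _ => u ∈ X
        | _ => v₁ ∈ X} ∨ q = .old v hv := by
    rintro v hv X hX (⟨p, hp⟩ | _ | ⟨i, p⟩) hpX (⟨q, hq⟩ | _ | ⟨j, q⟩) hpq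
    · rcases hX p hpX q hpq with h' | rfl
      exacts [.inl h', .inr rfl]
    · rw [h.adj_old_x hp] at hpq
      exact .inl ((hX p hpX v₁ hpq.symm).resolve_right (h.old_ne₁ hv).symm)
    · exact hpq.elim
    · rw [h.adj_x_old hq] at hpq
      rcases hX _ hpX q hpq with h' | rfl
      exacts [.inl h', .inr rfl]
    · exact .inl hpX
    · exact .inl hpX
    · exact hpq.elim
    · exact .inl hpX
    · exact .inl hpX
  rintro (⟨v, hv⟩ | _ | ⟨i, v | v⟩) a b hva hvb hab hn
  · rcases a with ⟨a, ha⟩ | _ | ⟨j, a⟩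
    · rcases b with ⟨b, hb⟩ | _ | ⟨k, b⟩
      · obtain ⟨X, haX, hbX, hvX, hX⟩ := hT v a b hva hvb (by rintro rfl; exact hab rfl) hn
        exact ⟨_, .inl ⟨haX, hbX⟩, hvX, old v hv X hX⟩
      · rw [h.adj_old_x] at hvb hn
        obtain ⟨X, haX, hbX, hvX, hX⟩ := hT v a v₁ hva hvb.symm (h.old_ne₁ ha)
          fun h' => hn h'.symm
        exact ⟨_, .inl ⟨haX, hbX⟩, hvX, old v hv X hX⟩
      · exact hvb.elim
    · rcases b with ⟨b, hb⟩ | _ | ⟨k, b⟩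
      · rw [h.adj_old_x] at hva
        rw [h.adj_x_old] at hn
        obtain ⟨X, haX, hbX, hvX, hX⟩ := hT v v₁ b hva.symm hvb (h.old_ne₁ hb).symm hn
        exact ⟨_, .inl ⟨haX, hbX⟩, hvX, old v hv X hX⟩
      · exact (hab rfl).elim
      · exact hvb.elim
    · exact hva.elim
  · -- the separations at `x` are the spiders
    have spid : ∀ i : Fin 2, ∀ p ∈ {a : ReplaceVertex (B₁ ∪ B₂) | ∃ b, a = .spider i b},
        ∀ q, (spiderReplace G v₁ v₂ B₁ B₂).Adj p q → q ∈ {a | ∃ b, a = .spider i b} ∨ q = .x := by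
      rintro i _ ⟨b, rfl⟩ (⟨q, hq⟩ | _ | ⟨j, q⟩) hpq
      · exact hpq.elim
      · exact .inr rfl
      · obtain ⟨rfl, -⟩ := hpq
        exact .inl ⟨q, rfl⟩
    rcases a with ⟨a, ha⟩ | _ | ⟨j, a⟩
    · rcases b with ⟨b, hb⟩ | _ | ⟨k, b⟩
      · rw [h.adj_x_old] at hva hvb
        exact (hn (h.old_clique a ha b hb hva hvb (by rintro rfl; exact hab rfl))).elim
      · exact hvb.elim
      · exact ⟨{a | ∃ b, a = .spider k b}, .inr ⟨⟨b, rfl⟩, by rintro ⟨_, ⟨⟩⟩⟩,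
          by rintro ⟨_, ⟨⟩⟩, spid k⟩
    · exact hva.elim
    · refine ⟨{a | ∃ b, a = .spider j b}, .inl ⟨⟨a, rfl⟩, ?_⟩, by rintro ⟨_, ⟨⟩⟩, spid j⟩
      rintro ⟨b', rfl⟩
      rcases a with a | a
      · rcases b' with b | b
        · exact hn ⟨rfl, fun h => hab (by rw [h])⟩
        · exact Bool.noConfusion hvb
      · exact Bool.noConfusion hva
  · -- at a clique vertex of a spider only its pendant neighbour is separated from the rest
    refine ⟨{.spider i (.inr v)}, ?_, by simp, ?_⟩
    · by_contra hcon
      have key : ∀ c, (spiderReplace G v₁ v₂ B₁ B₂).Adj (.spider i (.inl v)) c →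
          c ≠ .spider i (.inr v) → c = .x ∨ ∃ k, c = .spider i (.inl k) := by
        rintro (⟨c, hc⟩ | _ | ⟨j, c | c⟩) hvc hc'
        · exact hvc.elim
        · exact .inl rfl
        · obtain ⟨rfl, -⟩ := hvc
          exact .inr ⟨c, rfl⟩
        · obtain ⟨rfl, h⟩ := hvc
          obtain rfl : v = c := h
          exact (hc' rfl).elim
      have ha' : a ≠ .spider i (.inr v) := by
        rintro rfl; exact hcon (.inl ⟨Set.mem_singleton _, fun h => hab h.symm⟩)
      have hb' : b ≠ .spider i (.inr v) := by
        rintro rfl; exact hcon (.inr ⟨Set.mem_singleton _, fun h => hab h⟩)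
      rcases key a hva ha' with rfl | ⟨k, rfl⟩ <;> rcases key b hvb hb' with rfl | ⟨l, rfl⟩
      · exact hab rfl
      · exact hn rfl
      · exact hn rfl
      · exact hn ⟨rfl, fun h => hab (by rw [h])⟩
    · rintro _ rfl (⟨q, hq⟩ | _ | ⟨j, q | q⟩) hpq
      · exact hpq.elim
      · exact Bool.noConfusion hpq
      · obtain ⟨rfl, h⟩ := hpq
        obtain rfl : v = q := h
        exact .inr rfl
      · exact hpq.2.elim
  · have key : ∀ c, (spiderReplace G v₁ v₂ B₁ B₂).Adj (.spider i (.inr v)) c →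
        c = .spider i (.inl v) := by
      rintro (⟨c, hc⟩ | _ | ⟨j, c | c⟩) hvc
      · exact hvc.elim
      · exact Bool.noConfusion hvc
      · obtain ⟨rfl, h⟩ := hvc
        obtain rfl : v = c := h
        rfl
      · exact hvc.2.elim
    rw [key a hva, key b hvb] at hab
    exact (hab rfl).elim

lemma thinSpider_treeLike (n : ℕ) : TreeLike (thinSpider n) := by
  apply treeLike_of_separation_or
  rintro (v | v) a b hva hvb hab hn
  · refine ⟨{.inr v}, ?_, by simp, ?_⟩
    · rcases a with a | a <;> rcases b with b | b
      · exact (hn fun h => hab (by rw [h])).elim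
      · obtain rfl : v = b := hvb
        exact .inr ⟨rfl, by simp⟩
      · obtain rfl : v = a := hva
        exact .inl ⟨rfl, by simp⟩
      · obtain rfl : v = b := hvb
        obtain rfl : v = a := hva
        exact (hab rfl).elim
    · rintro _ rfl (q | q) hpq
      · obtain rfl : v = q := hpq
        exact .inr rfl
      · exact hpq.elim
  · rcases a with a | a
    · rcases b with b | b
      · obtain rfl : v = b := hvb
        obtain rfl : v = a := hva
        exact (hab rfl).elim
      · exact hvb.elim
    · exact hva.elim

lemma thinSpider_connected : (thinSpider 5).Connected := by
  have hr : ∀ a, (thinSpider 5).Reachable a (.inl 0) := by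
    have h : ∀ i, (thinSpider 5).Reachable (.inl i) (.inl 0) := by
      intro i
      by_cases hi : i = 0
      · rw [hi]
      · exact SimpleGraph.Adj.reachable (G := thinSpider 5) (u := .inl i) (v := .inl 0) hi
    rintro (i | i)
    · exact h i
    · exact (SimpleGraph.Adj.reachable (G := thinSpider 5) (u := .inr i) (v := .inl i) rfl).trans
        (h i)
  exact ⟨fun a b => (hr a).trans (hr b).symm⟩

lemma TreeLike.of_embedding {V W : Type*} {G : SimpleGraph V} {F : SimpleGraph W} (f : F ↪g G)
    (hG : TreeLike G) : TreeLike F := by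
  intro v a b ha hb hab hn
  obtain ⟨X, haX, hbX, hvX, hX⟩ := hG (f v) (f a) (f b) (f.map_adj_iff.2 ha) (f.map_adj_iff.2 hb)
    (f.injective.ne hab) (fun h => hn (f.map_adj_iff.1 h))
  exact ⟨f ⁻¹' X, haX, hbX, hvX, fun p hp q hpq =>
    (hX (f p) hp (f q) (f.map_adj_iff.2 hpq)).imp id fun h => f.injective h⟩

/-- The members of the family are finite block graphs. -/
lemma FamilyF.finite_treeLike_connected {W : Type} {F : SimpleGraph W} (hF : FamilyF F) :
    Finite W ∧ TreeLike F ∧ F.Connected := by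
  induction hF with
  | base h =>
    obtain ⟨f⟩ := h
    exact ⟨Finite.of_equiv _ f.symm.toEquiv, (thinSpider_treeLike 5).of_embedding f.toEmbedding,
      f.connected_iff.2 thinSpider_connected⟩
  | step hG h ih =>
    obtain ⟨hfin, hT, hc⟩ := ih
    obtain ⟨H, v₁, v₂, B₁, B₂, hH, hcard, h1, h2, h12, ht1, ht2, hB1, hm1, hB2, hm2, ⟨f⟩⟩ := h
    have hs := spiderSite_of_isTwoCutpoint hT hc hH hcard h1 h2 h12 ht1 ht2 hB1 hm1 hB2 hm2
    exact ⟨Finite.of_equiv _ f.symm.toEquiv, (hs.treeLike hT).of_embedding f.toEmbedding,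
      f.connected_iff.2 (hs.connected hc)⟩

/-- Induction over the family, where the step is given by the local structure of the block graph
at the place of the replacement. -/
lemma FamilyF.site_induction {P : ∀ {W : Type}, SimpleGraph W → Prop}
    (iso : ∀ {V W : Type} {G : SimpleGraph V} {F : SimpleGraph W}, Nonempty (G ≃g F) → P F → P G)
    (base : P (thinSpider 5))
    (step : ∀ {V : Type} {G : SimpleGraph V} {v₁ v₂ : V} {B₁ B₂ : Set V},
      SpiderSite G v₁ v₂ B₁ B₂ → P G → P (spiderReplace G v₁ v₂ B₁ B₂))
    {W : Type} {F : SimpleGraph W} (hF : FamilyF F) : P F := by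
  induction hF with
  | base h => exact iso h base
  | step hG h ih =>
    obtain ⟨hfin, hT, hc⟩ := hG.finite_treeLike_connected
    obtain ⟨H, v₁, v₂, B₁, B₂, hH, hcard, h1, h2, h12, ht1, ht2, hB1, hm1, hB2, hm2, hf⟩ := h
    have hs := spiderSite_of_isTwoCutpoint hT hc hH hcard h1 h2 h12 ht1 ht2 hB1 hm1 hB2 hm2
    exact iso hf (step hs ih)

end Replace

/-! ### Exclusive points of grid paths -/

/-- A horizontal or vertical grid path, as a degenerate box of the lattice `ℤ × ℤ`. -/
def IsGridPath (P : Set (ℤ × ℤ)) : Prop :=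
  ∃ lo hi : ℤ × ℤ, lo ≤ hi ∧ (lo.1 = hi.1 ∨ lo.2 = hi.2) ∧ P = Set.Icc lo hi

lemma isGridPath_iff (P : Set (ℤ × ℤ)) :
    IsGridPath P ↔ IsHorizontalGridPath P ∨ IsVerticalGridPath P := by
  constructor
  · rintro ⟨⟨a, c⟩, ⟨b, d⟩, hle, h, rfl⟩
    simp only [Prod.mk_le_mk] at hle h
    rcases h with rfl | rfl
    · refine .inr ⟨a, c, d, hle.2, ?_⟩
      ext ⟨x, y⟩
      simp only [Set.mem_Icc, Prod.mk_le_mk, Set.mem_ofPred_eq]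
      omega
    · refine .inl ⟨a, b, c, hle.1, ?_⟩
      ext ⟨x, y⟩
      simp only [Set.mem_Icc, Prod.mk_le_mk, Set.mem_ofPred_eq]
      omega
  · rintro (⟨a, b, y, h, rfl⟩ | ⟨x, a, b, h, rfl⟩)
    · refine ⟨(a, y), (b, y), ⟨h, le_rfl⟩, .inr rfl, ?_⟩
      ext ⟨x, z⟩
      simp only [Set.mem_Icc, Prod.mk_le_mk, Set.mem_ofPred_eq]
      omega
    · refine ⟨(x, a), (x, b), ⟨le_rfl, h⟩, .inl rfl, ?_⟩
      ext ⟨y, z⟩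
      simp only [Set.mem_Icc, Prod.mk_le_mk, Set.mem_ofPred_eq]
      omega

lemma isB0VPG_iff {V : Type*} {G : SimpleGraph V} : IsB0VPG G ↔
    ∃ P : V → Set (ℤ × ℤ), (∀ v, IsGridPath (P v)) ∧
      ∀ u v, u ≠ v → (G.Adj u v ↔ (P u ∩ P v).Nonempty) := by
  simp only [IsB0VPG, isGridPath_iff]

lemma IsB0VPG.of_embedding {V W : Type*} {G : SimpleGraph V} {F : SimpleGraph W} (f : F ↪g G)
    (hG : IsB0VPG G) : IsB0VPG F := by
  obtain ⟨P, hP, hadj⟩ := hG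
  exact ⟨fun w => P (f w), fun w => hP _, fun u v huv =>
    f.map_adj_iff.symm.trans (hadj _ _ (f.injective.ne huv))⟩

/-- The direction (right, up, left or down) in which `t` lies from `q`, for two points of a grid
path; a point `t = q` counts as down. -/
def dirCode (q t : ℤ × ℤ) : ℕ :=
  if q.1 < t.1 then 0 else if q.2 < t.2 then 1 else if t.1 < q.1 then 2 else 3

lemma dirCode_lt (q t : ℤ × ℤ) : dirCode q t < 4 := by
  unfold dirCode; split_ifs <;> omega

/-- If two grid paths leave a common point in the same direction, then the shorter one is
covered by the other. -/
lemma mem_or_mem_of_dirCode_eq {P Q : Set (ℤ × ℤ)} (hP : IsGridPath P) (hQ : IsGridPath Q)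
    {q t s : ℤ × ℤ} (hqP : q ∈ P) (hqQ : q ∈ Q) (ht : t ∈ P) (hs : s ∈ Q) (htq : t ≠ q)
    (hsq : s ≠ q) (h : dirCode q t = dirCode q s) : t ∈ Q ∨ s ∈ P := by
  obtain ⟨⟨a, b⟩, ⟨c, d⟩, -, hP, rfl⟩ := hP
  obtain ⟨⟨a', b'⟩, ⟨c', d'⟩, -, hQ, rfl⟩ := hQ
  obtain ⟨q1, q2⟩ := q
  obtain ⟨t1, t2⟩ := t
  obtain ⟨s1, s2⟩ := s
  simp only [Set.mem_Icc, Prod.mk_le_mk, ne_eq, Prod.mk.injEq, dirCode] at *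
  split_ifs at h <;> omega

/-- Helly property: the paths of a clique share a point. -/
lemma exists_common_point {V : Type*} [Finite V] {P : V → Set (ℤ × ℤ)}
    (hP : ∀ v, IsGridPath (P v)) {S : Set V} (hS : S.Nonempty)
    (h : ∀ u ∈ S, ∀ v ∈ S, (P u ∩ P v).Nonempty) : ∃ q, ∀ v ∈ S, q ∈ P v := by
  choose lo hi hle _ hPe using hP
  have hlh : ∀ u ∈ S, ∀ v ∈ S, lo u ≤ hi v := by
    intro u hu v hv
    obtain ⟨p, hp, hp'⟩ := h u hu v hv
    rw [hPe] at hp hp'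
    exact hp.1.trans hp'.2
  have hfin := S.toFinite
  have hne : hfin.toFinset.Nonempty := by simpa using hS
  refine ⟨hfin.toFinset.sup' hne lo, fun v hv => ?_⟩
  rw [hPe]
  refine ⟨Finset.le_sup' lo (by simpa using hv), Finset.sup'_le _ _ fun u hu => ?_⟩
  exact hlh u (by simpa using hu) v hv

/-- If the path `X` meets three paths in `p`, each of which has a point of its own, then no point
of `X` beyond the three paths lies on the other side of `p` than another one: the directions from
`p` to the five points would be distinct. -/
lemma not_between {X : Set (ℤ × ℤ)} (hX : IsGridPath X) {C : Fin 3 → Set (ℤ × ℤ)}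
    (hC : ∀ i, IsGridPath (C i)) {p : ℤ × ℤ} (hpX : p ∈ X) (hpC : ∀ i, p ∈ C i)
    {t : Fin 3 → ℤ × ℤ} (ht : ∀ i, t i ∈ C i) (htX : ∀ i, t i ∉ X)
    (htC : ∀ i j, i ≠ j → t i ∉ C j) {q r : ℤ × ℤ} (hq : q ∈ X) (hr : r ∈ X)
    (hqC : ∀ i, q ∉ C i) (hrC : ∀ i, r ∉ C i) : p ∉ Set.Icc (q ⊓ r) (q ⊔ r) := by
  intro hp
  have htp : ∀ i, t i ≠ p := fun i h => htX i (h ▸ hpX)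
  have hqp : q ≠ p := fun h => hqC 0 (h ▸ hpC 0)
  have hrp : r ≠ p := fun h => hrC 0 (h ▸ hpC 0)
  have h1 : ∀ i j, i ≠ j → dirCode p (t i) ≠ dirCode p (t j) := by
    intro i j hij h
    rcases mem_or_mem_of_dirCode_eq (hC i) (hC j) (hpC i) (hpC j) (ht i) (ht j) (htp i) (htp j) h
      with h | h
    exacts [htC i j hij h, htC j i hij.symm h]
  have h2 : ∀ s ∈ X, (∀ i, s ∉ C i) → s ≠ p → ∀ i, dirCode p (t i) ≠ dirCode p s := by
    intro s hs hsC hsp i h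
    rcases mem_or_mem_of_dirCode_eq (hC i) hX (hpC i) hpX (ht i) hs (htp i) hsp h with h | h
    exacts [htX i h, hsC i h]
  have h3 : dirCode p q ≠ dirCode p r := by
    obtain ⟨⟨a, b⟩, ⟨c, d⟩, -, hab, rfl⟩ := hX
    obtain ⟨q1, q2⟩ := q
    obtain ⟨r1, r2⟩ := r
    obtain ⟨p1, p2⟩ := p
    simp only [Set.mem_Icc, Prod.mk_le_mk, ne_eq, Prod.mk.injEq, dirCode, Prod.mk_inf_mk,
      Prod.mk_sup_mk, inf_le_iff, le_sup_iff] at hpX hq hr hp hqp hrp hab ⊢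
    intro h
    split_ifs at h <;> omega
  have a01 := h1 0 1 (by decide)
  have a02 := h1 0 2 (by decide)
  have a12 := h1 1 2 (by decide)
  have q0 := h2 q hq hqC hqp 0
  have q1 := h2 q hq hqC hqp 1
  have q2 := h2 q hq hqC hqp 2
  have r0 := h2 r hr hrC hrp 0
  have r1 := h2 r hr hrC hrp 1
  have r2 := h2 r hr hrC hrp 2
  have b0 := dirCode_lt p (t 0)
  have b1 := dirCode_lt p (t 1)
  have b2 := dirCode_lt p (t 2)
  have b3 := dirCode_lt p q
  have b4 := dirCode_lt p r
  omega

/-- The five clique vertices of the spider would need five directions at their common point. -/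
lemma not_isB0VPG_thinSpider : ¬ IsB0VPG (thinSpider 5) := by
  rw [isB0VPG_iff]
  rintro ⟨P, hP, hadj⟩
  obtain ⟨q, hq⟩ := exists_common_point hP (S := Set.range Sum.inl) ⟨_, 0, rfl⟩ (by
    rintro _ ⟨i, rfl⟩ _ ⟨j, rfl⟩
    by_cases hij : i = j
    · subst hij
      obtain ⟨lo, hi, hle, -, h⟩ := hP (.inl i)
      rw [h, Set.inter_self]
      exact Set.nonempty_Icc.2 hle
    · exact (hadj _ _ fun h => hij (Sum.inl_injective h)).1 hij)
  have hq : ∀ i, q ∈ P (.inl i) := fun i => hq _ ⟨i, rfl⟩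
  have hex : ∀ i : Fin 5, ∃ t, t ∈ P (.inl i) ∧ ∀ j, j ≠ i → t ∉ P (.inl j) := by
    intro i
    obtain ⟨t, ht, ht'⟩ := (hadj (.inl i) (.inr i) (by simp)).1 rfl
    refine ⟨t, ht, fun j hj htj => hj ?_⟩
    exact (hadj (.inl j) (.inr i) (by simp)).2 ⟨t, htj, ht'⟩
  choose t ht ht' using hex
  have htq : ∀ i, t i ≠ q := by
    intro i h
    obtain ⟨j, hj⟩ := exists_ne i
    exact ht' i j hj (h ▸ hq j)
  have hinj : Function.Injective fun i => (⟨dirCode q (t i), dirCode_lt _ _⟩ : Fin 4) := by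
    intro i j h
    by_contra hij
    rcases mem_or_mem_of_dirCode_eq (hP (.inl i)) (hP (.inl j)) (hq i) (hq j) (ht i) (ht j)
      (htq i) (htq j) (congrArg Fin.val h) with h | h
    exacts [ht' i j (Ne.symm hij) h, ht' j i hij h]
  simpa using Fintype.card_le_of_injective _ hinj

lemma between_of_mem {X : Set (ℤ × ℤ)} (hX : IsGridPath X) {p q r : ℤ × ℤ} (hp : p ∈ X)
    (hq : q ∈ X) (hr : r ∈ X) : p ∈ Set.Icc (q ⊓ r) (q ⊔ r) ∨ r ∈ Set.Icc (q ⊓ p) (q ⊔ p) ∨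
      q ∈ Set.Icc (p ⊓ r) (p ⊔ r) := by
  obtain ⟨⟨a, b⟩, ⟨c, d⟩, -, hab, rfl⟩ := hX
  obtain ⟨q1, q2⟩ := q
  obtain ⟨r1, r2⟩ := r
  obtain ⟨p1, p2⟩ := p
  simp only [Set.mem_Icc, Prod.mk_le_mk, Prod.mk_inf_mk,
      Prod.mk_sup_mk, inf_le_iff, le_sup_iff] at *
  omega

lemma IsGridPath.subpath {X : Set (ℤ × ℤ)} (hX : IsGridPath X) {p q : ℤ × ℤ} (hp : p ∈ X)
    (hq : q ∈ X) : IsGridPath (Set.Icc (p ⊓ q) (p ⊔ q)) ∧ Set.Icc (p ⊓ q) (p ⊔ q) ⊆ X := by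
  obtain ⟨lo, hi, -, hab, rfl⟩ := hX
  refine ⟨⟨_, _, inf_le_sup, ?_, rfl⟩, Set.Icc_subset_Icc (le_inf hp.1 hq.1) (sup_le hp.2 hq.2)⟩
  obtain ⟨⟨hp1, hp2⟩, hp3, hp4⟩ := hp
  obtain ⟨⟨hq1, hq2⟩, hq3, hq4⟩ := hq
  rcases hab with h | h
  · left
    rw [Prod.fst_inf, Prod.fst_sup]
    have : p.1 = q.1 := by omega
    rw [this, inf_idem, sup_idem]
  · right
    rw [Prod.snd_inf, Prod.snd_sup]
    have : p.2 = q.2 := by omega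
    rw [this, inf_idem, sup_idem]

lemma isGridPath_singleton (p : ℤ × ℤ) : IsGridPath {p} :=
  ⟨p, p, le_rfl, .inl rfl, (Set.Icc_self p).symm⟩

/-- From a representation after the replacement one obtains a representation before it. The
common point `q` of the old clique lies on the path of `x` between the common points of the two
spiders, since each of these points needs an end of the path; cutting the path at `q` gives
the paths of `v₁` and `v₂`. -/
lemma SpiderSite.isB0VPG_of_spiderReplace {V : Type*} [Finite V] {G : SimpleGraph V} {v₁ v₂ : V}
    {B₁ B₂ : Set V} (h : SpiderSite G v₁ v₂ B₁ B₂)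
    (hG : IsB0VPG (spiderReplace G v₁ v₂ B₁ B₂)) : IsB0VPG G := by
  classical
  rw [isB0VPG_iff] at hG ⊢
  obtain ⟨P, hP, hadj⟩ := hG
  set G' := spiderReplace G v₁ v₂ B₁ B₂ with hG'
  have hself : ∀ a, (P a ∩ P a).Nonempty := by
    intro a
    obtain ⟨lo, hi, hle, -, h⟩ := hP a
    rw [h, Set.inter_self]
    exact Set.nonempty_Icc.2 hle
  have hmeet : ∀ a b, (a ≠ b → G'.Adj a b) → (P a ∩ P b).Nonempty := by
    intro a b hab
    by_cases h : a = b
    · exact h ▸ hself a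
    · exact (hadj a b h).1 (hab h)
  have hnot : ∀ a b p, a ≠ b → ¬ G'.Adj a b → p ∈ P a → p ∉ P b := fun a b p hab hn ha hb =>
    hn ((hadj a b hab).2 ⟨p, ha, hb⟩)
  -- the common point of the old clique
  obtain ⟨q, hq⟩ := exists_common_point hP (S := {a | a = .x ∨ ∃ u hu, a = .old u hu ∧ G.Adj v₁ u})
    ⟨.x, .inl rfl⟩ (by
      rintro _ (rfl | ⟨u, hu, rfl, hvu⟩) _ (rfl | ⟨w, hw, rfl, hvw⟩) <;> apply hmeet <;> intro hne
      · exact (hne rfl).elim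
      · exact (h.adj_x_old hw).2 hvw
      · exact (h.adj_old_x hu).2 hvu
      · exact h.old_clique u hu w hw hvu hvw (by rintro rfl; exact hne rfl))
  have hqx : q ∈ P .x := hq _ (.inl rfl)
  have hqo : ∀ u hu, G.Adj v₁ u → q ∈ P (.old u hu) := fun u hu hvu => hq _ (.inr ⟨u, hu, rfl, hvu⟩)
  -- the common points of the spiders
  have hsp : ∀ i : Fin 2, ∃ p, p ∈ P .x ∧ ∀ k, p ∈ P (.spider i (.inl k)) := by
    intro i
    obtain ⟨p, hp⟩ := exists_common_point hP (S := {a | a = .x ∨ ∃ k, a = .spider i (.inl k)})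
      ⟨.x, .inl rfl⟩ (by
        rintro _ (rfl | ⟨k, rfl⟩) _ (rfl | ⟨l, rfl⟩) <;> apply hmeet <;> intro hne
        · exact (hne rfl).elim
        · rfl
        · rfl
        · exact ⟨rfl, fun hkl => hne (by rw [hkl])⟩)
    exact ⟨p, hp _ (.inl rfl), fun k => hp _ (.inr ⟨k, rfl⟩)⟩
  choose p hpx hps using hsp
  have htex : ∀ i k, ∃ t, t ∈ P (.spider i (.inl k)) ∧ t ∈ P (.spider i (.inr k)) :=
    fun i k => (hadj (.spider i (.inl k)) (.spider i (.inr k)) (by simp)).1 ⟨rfl, rfl⟩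
  choose t ht ht' using htex
  have hps' : ∀ i j k, i ≠ j → p i ∉ P (.spider j (.inl k)) := fun i j k hij =>
    hnot (.spider i (.inl 0)) _ _ (by simpa using fun h => absurd h hij)
      (fun h => hij h.1) (hps i 0)
  have hqs : ∀ i k, q ∉ P (.spider i (.inl k)) := by
    intro i k
    obtain ⟨u, hu, hvu⟩ := h.exists_old
    exact hnot (.old u hu) _ _ (by simp) (fun h => h) (hqo u hu hvu)
  have hnb : ∀ i j, i ≠ j → p i ∉ Set.Icc (q ⊓ p j) (q ⊔ p j) := by
    intro i j hij
    refine not_between (hP .x) (fun k => hP (.spider i (.inl k))) (hpx i) (hps i) (ht i)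
      (fun k => ?_) (fun k l hkl => ?_) hqx (hpx j) (hqs i) (fun k => hps' j i k hij.symm)
    · exact hnot (.spider i (.inr k)) _ _ (by simp) (fun h => Bool.noConfusion h) (ht' i k)
    · exact hnot (.spider i (.inr k)) _ _ (by simp) (fun h => hkl h.2) (ht' i k)
  have hbet : q ∈ Set.Icc (p 0 ⊓ p 1) (p 0 ⊔ p 1) := by
    rcases between_of_mem (hP .x) (hpx 0) hqx (hpx 1) with h | h | h
    exacts [(hnb 0 1 (by decide) h).elim, (hnb 1 0 (by decide) h).elim, h]
  have hpold : ∀ i u hu, p i ∉ P (.old u hu) := fun i u hu =>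
    hnot (.spider i (.inl 0)) _ _ (by simp) (fun h => h) (hps i 0)
  have hp01 : p 0 ≠ p 1 := fun h => hps' 0 1 0 (by decide) (h ▸ hps 1 0)
  have hqp : ∀ i, q ≠ p i := fun i h => hqs i 0 (h ▸ hps i 0)
  -- the half of the path of `x` towards the `i`th spider
  let X : Fin 2 → Set (ℤ × ℤ) := fun i => Set.Icc (p i ⊓ q) (p i ⊔ q)
  have hX : ∀ i, IsGridPath (X i) ∧ X i ⊆ P .x := fun i => (hP .x).subpath (hpx i) hqx
  have hpX : ∀ i, p i ∈ X i := fun i => ⟨inf_le_left, le_sup_left⟩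
  have hqX : ∀ i, q ∈ X i := fun i => ⟨inf_le_right, le_sup_right⟩
  have hpX' : ∀ i j, i ≠ j → p i ∉ X j := fun i j hij => by
    have := hnb i j hij
    rwa [inf_comm, sup_comm] at this
  let R : V → Set (ℤ × ℤ) := fun u =>
    if hu : u ∈ B₁ ∪ B₂ then
      if u = v₁ then X 0 else if u = v₂ then X 1 else if u ∈ B₁ then {p 0} else {p 1}
    else P (.old u hu)
  have hv12 := h.adj.ne
  have hd := Set.disjoint_left.1 h.disj
  have R1 : R v₁ = X 0 := by simp [R, h.mem₁]
  have R2 : R v₂ = X 1 := by simp [R, h.mem₂, hv12.symm]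
  have RB1 : ∀ u ∈ B₁, u ≠ v₁ → R u = {p 0} := by
    intro u hu huv
    have : u ≠ v₂ := by rintro rfl; exact hd hu h.mem₂
    simp [R, hu, huv, this]
  have RB2 : ∀ u ∈ B₂, u ≠ v₂ → R u = {p 1} := by
    intro u hu huv
    have h1 : u ≠ v₁ := by rintro rfl; exact hd h.mem₁ hu
    have h2 : u ∉ B₁ := fun h' => hd h' hu
    simp [R, hu, huv, h1, h2]
  have Ro : ∀ u (hu : u ∉ B₁ ∪ B₂), R u = P (.old u hu) := fun u hu => dif_neg hu
  -- intersections with the paths of old vertices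
  have old_half : ∀ u (hu : u ∉ B₁ ∪ B₂) i, (X i ∩ P (.old u hu)).Nonempty ↔ G.Adj v₁ u := by
    intro u hu i
    constructor
    · rintro ⟨z, hz, hz'⟩
      by_contra hn
      exact hnot .x (.old u hu) z (by simp) (fun h' => hn ((h.adj_x_old hu).1 h')) ((hX i).2 hz) hz'
    · exact fun h' => ⟨q, hqX i, hqo u hu h'⟩
  -- the cases of an adjacency, in one of the two orders
  have key : ∀ u v, u ≠ v →
      (u ∈ B₁ ∪ B₂ ∧ v ∉ B₁ ∪ B₂) ∨ (u ∈ B₁ ∧ v ∈ B₂) ∨ (u = v₁ ∧ v ∈ B₁) ∨ (u = v₂ ∧ v ∈ B₂) ∨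
        (u ∈ B₁ ∧ u ≠ v₁ ∧ v ∈ B₁ ∧ v ≠ v₁) ∨ (u ∈ B₂ ∧ u ≠ v₂ ∧ v ∈ B₂ ∧ v ≠ v₂) ∨
        (u ∉ B₁ ∪ B₂ ∧ v ∉ B₁ ∪ B₂) → (G.Adj u v ↔ (R u ∩ R v).Nonempty) := by
    intro u v huv hc
    rcases hc with ⟨hu | hu, hv⟩ | ⟨hu, hv⟩ | ⟨rfl, hv⟩ | ⟨rfl, hv⟩ | ⟨hu, huv', hv, hv'⟩ |
      ⟨hu, huv', hv, hv'⟩ | ⟨hu, hv⟩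
    · by_cases hu1 : u = v₁
      · subst hu1; rw [R1, Ro v hv, old_half]
      · rw [RB1 u hu hu1, Ro v hv, Set.singleton_inter_nonempty]
        exact ⟨fun h' => absurd (.inl (h.closed₁ u hu hu1 v h')) hv,
          fun h' => (hpold _ _ _ h').elim⟩
    · by_cases hu1 : u = v₂
      · subst hu1; rw [R2, Ro v hv, old_half, h.twin v hv]
      · rw [RB2 u hu hu1, Ro v hv, Set.singleton_inter_nonempty]
        exact ⟨fun h' => absurd (.inr (h.closed₂ u hu hu1 v h')) hv,
          fun h' => (hpold _ _ _ h').elim⟩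
    · by_cases hu1 : u = v₁
      · by_cases hv2 : v = v₂
        · rw [hu1, hv2, R1, R2]
          exact ⟨fun _ => ⟨q, hqX 0, hqX 1⟩, fun _ => h.adj⟩
        · rw [hu1, R1, RB2 v hv hv2, Set.inter_singleton_nonempty]
          exact ⟨fun h' => (hd h.mem₁ (h.closed₂ v hv hv2 _ h'.symm)).elim,
            fun h' => (hpX' 1 0 (by decide) h').elim⟩
      · by_cases hv2 : v = v₂
        · rw [hv2, R2, RB1 u hu hu1, Set.singleton_inter_nonempty]
          exact ⟨fun h' => (hd (h.closed₁ u hu hu1 _ h') h.mem₂).elim,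
            fun h' => (hpX' 0 1 (by decide) h').elim⟩
        · rw [RB1 u hu hu1, RB2 v hv hv2, Set.singleton_inter_nonempty, Set.mem_singleton_iff]
          exact ⟨fun h' => (hd (h.closed₁ u hu hu1 _ h') hv).elim, fun h' => (hp01 h').elim⟩
    · rw [R1, RB1 v hv huv.symm, Set.inter_singleton_nonempty]
      exact ⟨fun _ => hpX 0, fun _ => h.clique₁ h.mem₁ hv huv⟩
    · rw [R2, RB2 v hv huv.symm, Set.inter_singleton_nonempty]
      exact ⟨fun _ => hpX 1, fun _ => h.clique₂ h.mem₂ hv huv⟩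
    · rw [RB1 u hu huv', RB1 v hv hv', Set.inter_self]
      exact ⟨fun _ => Set.singleton_nonempty _, fun _ => h.clique₁ hu hv huv⟩
    · rw [RB2 u hu huv', RB2 v hv hv', Set.inter_self]
      exact ⟨fun _ => Set.singleton_nonempty _, fun _ => h.clique₂ hu hv huv⟩
    · rw [Ro u hu, Ro v hv, ← hadj _ _ (by simpa using huv)]
      rfl
  refine ⟨R, fun u => ?_, fun u v huv => ?_⟩
  · by_cases hu : u ∈ B₁ ∪ B₂
    · simp only [R, dif_pos hu]
      split_ifs
      exacts [(hX 0).1, (hX 1).1, isGridPath_singleton _, isGridPath_singleton _]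
    · rw [Ro u hu]; exact hP _
  · have hk := key u v huv
    have hk' := key v u huv.symm
    rw [SimpleGraph.adj_comm, Set.inter_comm] at hk'
    by_cases hu : u ∈ B₁ ∪ B₂
    · by_cases hv : v ∈ B₁ ∪ B₂
      · rcases hu with hu | hu <;> rcases hv with hv | hv
        · by_cases e1 : u = v₁
          · exact hk (.inr (.inr (.inl ⟨e1, hv⟩)))
          by_cases e2 : v = v₁
          · exact hk' (.inr (.inr (.inl ⟨e2, hu⟩)))
          exact hk (.inr (.inr (.inr (.inr (.inl ⟨hu, e1, hv, e2⟩)))))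
        · exact hk (.inr (.inl ⟨hu, hv⟩))
        · exact hk' (.inr (.inl ⟨hv, hu⟩))
        · by_cases e1 : u = v₂
          · exact hk (.inr (.inr (.inr (.inl ⟨e1, hv⟩))))
          by_cases e2 : v = v₂
          · exact hk' (.inr (.inr (.inr (.inl ⟨e2, hu⟩))))
          exact hk (.inr (.inr (.inr (.inr (.inr (.inl ⟨hu, e1, hv, e2⟩))))))
      · exact hk (.inl ⟨hu, hv⟩)
    · by_cases hv : v ∈ B₁ ∪ B₂
      · exact hk' (.inl ⟨hv, hu⟩)
      · exact hk (.inr (.inr (.inr (.inr (.inr (.inr ⟨hu, hv⟩))))))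

lemma FamilyF.not_isB0VPG {W : Type} {F : SimpleGraph W} (hF : FamilyF F) : ¬ IsB0VPG F := by
  refine (hF.site_induction (P := fun {W} F => Finite W ∧ ¬ IsB0VPG F) ?_ ?_ ?_).2
  · rintro V W G F ⟨f⟩ ⟨hW, hF⟩
    exact ⟨Finite.of_equiv _ f.symm.toEquiv, fun hG => hF (hG.of_embedding f.symm.toEmbedding)⟩
  · exact ⟨inferInstance, not_isB0VPG_thinSpider⟩
  · rintro V G v₁ v₂ B₁ B₂ h ⟨hV, hG⟩
    exact ⟨inferInstance, fun h' => hG (h.isB0VPG_of_spiderReplace h')⟩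

/-! ### Ends of paths in a representation -/

/-- A combinatorial description of a representation of a block graph: `e v a` means that the block
of the edge `va` lies at an end of the path of `v`. At most two blocks lie at the ends of a path.
At the common point of a block, a branching vertex leaves the block in one direction if the block
lies at the end of its path, and in two directions otherwise, while there are four directions;
this accounts for the conditions on cliques of three, four and five branching vertices. -/
structure Admissible {V : Type*} (G : SimpleGraph V) (e : V → V → Prop) : Prop where
  block : ∀ v a b, G.Adj v a → G.Adj v b → G.Adj a b → e v a → e v b
  two : ∀ v a b c, G.Adj v a → G.Adj v b → G.Adj v c → e v a → e v b → e v c →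
    a ≠ b → a ≠ c → b ≠ c → G.Adj a b ∨ G.Adj a c ∨ G.Adj b c
  three : ∀ a b c, G.Adj a b → G.Adj a c → G.Adj b c →
    Branching G a → Branching G b → Branching G c → e a b ∨ e b a
  four : ∀ k : Fin 4 → V, (∀ i j, i ≠ j → G.Adj (k i) (k j)) → (∀ i, Branching G (k i)) →
    e (k 0) (k 1)
  five : ∀ k : Fin 5 → V, (∀ i j, i ≠ j → G.Adj (k i) (k j)) → ¬ ∀ i, Branching G (k i)

lemma Branching.map {V W : Type*} {G : SimpleGraph V} {F : SimpleGraph W} (f : F ↪g G) {v : W}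
    (h : Branching F v) : Branching G (f v) := by
  obtain ⟨a, b, ha, hb, hab, hn⟩ := h
  exact ⟨f a, f b, f.map_adj_iff.2 ha, f.map_adj_iff.2 hb, f.injective.ne hab,
    fun h => hn (f.map_adj_iff.1 h)⟩

lemma Admissible.of_embedding {V W : Type*} {G : SimpleGraph V} {F : SimpleGraph W} (f : F ↪g G)
    {e : V → V → Prop} (h : Admissible G e) : Admissible F fun a b => e (f a) (f b) where
  block v a b ha hb hab := h.block _ _ _ (f.map_adj_iff.2 ha) (f.map_adj_iff.2 hb)
    (f.map_adj_iff.2 hab)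
  two v a b c ha hb hc ea eb ec hab hac hbc := by
    simpa only [f.map_adj_iff] using h.two _ _ _ _ (f.map_adj_iff.2 ha) (f.map_adj_iff.2 hb)
      (f.map_adj_iff.2 hc) ea eb ec (f.injective.ne hab) (f.injective.ne hac) (f.injective.ne hbc)
  three a b c hab hac hbc ha hb hc := h.three _ _ _ (f.map_adj_iff.2 hab) (f.map_adj_iff.2 hac)
    (f.map_adj_iff.2 hbc) (ha.map f) (hb.map f) (hc.map f)
  four k hk hb := h.four (fun i => f (k i)) (fun i j hij => f.map_adj_iff.2 (hk i j hij))
    fun i => (hb i).map f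
  five k hk hb := h.five (fun i => f (k i)) (fun i j hij => f.map_adj_iff.2 (hk i j hij))
    fun i => (hb i).map f

/-- Isolating corresponding vertices of isomorphic graphs. -/
lemma Admissible.of_iso_deleteIncidenceSet {V W : Type*} {G : SimpleGraph V} {F : SimpleGraph W}
    (f : G ≃g F) {w : V} {e : W → W → Prop} (h : Admissible (F.deleteIncidenceSet (f w)) e) :
    Admissible (G.deleteIncidenceSet w) fun a b => e (f a) (f b) :=
  h.of_embedding (F := G.deleteIncidenceSet w) ⟨f.toEquiv.toEmbedding, by
    intro a b
    simp [SimpleGraph.deleteIncidenceSet_adj, f.map_adj_iff]⟩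

/-- A deleted vertex leaves only four branching vertices of the spider. -/
lemma thinSpider_admissible (w : Fin 5 ⊕ Fin 5) :
    Admissible ((thinSpider 5).deleteIncidenceSet w) fun _ _ => True := by
  have hbr : ∀ v, Branching ((thinSpider 5).deleteIncidenceSet w) v →
      ∃ i, v = .inl i ∧ w ≠ .inl i ∧ w ≠ .inr i := by
    rintro (i | i) ⟨a, b, ha, hb, hab, hn⟩
    · rw [SimpleGraph.deleteIncidenceSet_adj] at ha hb hn
      refine ⟨i, rfl, ha.2.1.symm, ?_⟩
      rintro rfl
      rcases a with a | a
      · rcases b with b | b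
        · exact hn ⟨fun h => hab (by rw [h]), ha.2.2, hb.2.2⟩
        · obtain rfl : i = b := hb.1
          exact hb.2.2 rfl
      · obtain rfl : i = a := ha.1
        exact ha.2.2 rfl
    · rw [SimpleGraph.deleteIncidenceSet_adj] at ha hb
      rcases a with a | a
      · rcases b with b | b
        · obtain rfl : i = a := ha.1
          obtain rfl : i = b := hb.1
          exact (hab rfl).elim
        · exact hb.1.elim
      · exact ha.1.elim
  refine ⟨fun _ _ _ _ _ _ _ => trivial, ?_, fun _ _ _ _ _ _ _ _ _ => .inl trivial,
    fun _ _ _ => trivial, ?_⟩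
  · intro v a b c ha hb hc _ _ _ hab hac hbc
    by_contra! hn
    simp only [SimpleGraph.deleteIncidenceSet_adj] at ha hb hc hn
    have key : ∀ a b, (thinSpider 5).Adj v a ∧ v ≠ w ∧ a ≠ w →
        (thinSpider 5).Adj v b ∧ v ≠ w ∧ b ≠ w → a ≠ b →
        ¬ ((thinSpider 5).Adj a b ∧ a ≠ w ∧ b ≠ w) →
        ∃ i, v = .inl i ∧ (a = .inr i ∧ (∃ j, b = .inl j) ∨ b = .inr i ∧ ∃ j, a = .inl j) := by
      intro a b ha hb hab hn
      obtain ⟨i, rfl, -⟩ := hbr v ⟨a, b, by rwa [SimpleGraph.deleteIncidenceSet_adj],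
        by rwa [SimpleGraph.deleteIncidenceSet_adj], hab,
        by rwa [SimpleGraph.deleteIncidenceSet_adj]⟩
      refine ⟨i, rfl, ?_⟩
      rcases a with a | a
      · rcases b with b | b
        · exact (hn ⟨fun h => hab (by rw [h]), ha.2.2, hb.2.2⟩).elim
        · obtain rfl : i = b := hb.1
          exact .inr ⟨rfl, a, rfl⟩
      · obtain rfl : i = a := ha.1
        rcases b with b | b
        · exact .inl ⟨rfl, b, rfl⟩
        · obtain rfl : i = b := hb.1
          exact (hab rfl).elim
    have k1 := key a b ha hb hab fun h => hn.1 h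
    have k2 := key a c ha hc hac fun h => hn.2.1 h
    have k3 := key b c hb hc hbc fun h => hn.2.2 h
    obtain ⟨i, rfl, ⟨rfl, j, rfl⟩ | ⟨rfl, j, rfl⟩⟩ := k1 <;>
    obtain ⟨i', -, ⟨h, j', h'⟩ | ⟨h, j', h'⟩⟩ := k2 <;>
    obtain ⟨i'', -, ⟨k, l, k'⟩ | ⟨k, l, k'⟩⟩ := k3 <;> simp_all
  · intro k hk hb
    choose i hi hi' hi'' using fun j => hbr (k j) (hb j)
    have hinj : Function.Injective i := by
      intro j l hjl
      by_contra hne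
      have := (hk j l hne).ne
      rw [hi, hi, hjl] at this
      exact this rfl
    have hsurj := Finite.surjective_of_injective hinj
    rcases w with w | w
    · obtain ⟨j, rfl⟩ := hsurj w
      exact hi' j rfl
    · obtain ⟨j, rfl⟩ := hsurj w
      exact hi'' j rfl

section Replace

variable {V : Type*} {G : SimpleGraph V} {v₁ v₂ : V} {B₁ B₂ : Set V}

/-- The vertices after the replacement that do not belong to the new spiders. -/
def ReplaceVertex.IsCore {B : Set V} : ReplaceVertex B → Prop
  | .spider _ _ => False
  | _ => True

/-- The vertices outside the new spiders as vertices of the graph before the replacement, where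
`x` corresponds to `v` (the value on the spiders is irrelevant). -/
def ReplaceVertex.core {B : Set V} (v : V) : ReplaceVertex B → V
  | .old u _ => u
  | _ => v

/-- The ends of the paths after the replacement when the vertex `w` is deleted: the block of `x`
and the old vertices is not at an end of the path of `x` if `w` is an old vertex; otherwise it is,
and the spider that has lost `w` need not be. -/
def replaceEnds (v₂ : V) {B : Set V} (w : ReplaceVertex B) (e : V → V → Prop) :
    ReplaceVertex B → ReplaceVertex B → Prop
  | .old a _, .old b _ => e a b
  | .old a _, _ => e a v₂
  | .x, .spider i _ => ∀ b, w ≠ .spider i b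
  | .x, _ => ∀ u hu, w ≠ .old u hu
  | .spider _ _, _ => True

/-- The vertex of the old graph whose deletion corresponds to the deletion of `w`. -/
def ReplaceVertex.deleted (v₁ v₂ : V) {B : Set V} : ReplaceVertex B → V
  | .old u _ => u
  | .x => v₂
  | .spider _ _ => v₁

/-- Ends before the replacement, for the graph in which a suitable vertex is isolated, give ends
after it. If an old vertex is isolated, then the two spiders take both ends of the path of `x`, and
the path counts twice at the point of the old clique; there it replaces the two branching vertices
`v₁` and `v₂`. If `w` belongs to a spider, then this spider is short of a branching vertex and needs
no end of the path of `x`, which is left to the old clique. -/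
lemma SpiderSite.admissible (h : SpiderSite G v₁ v₂ B₁ B₂) (w : ReplaceVertex (B₁ ∪ B₂))
    {e : V → V → Prop} (he : Admissible (G.deleteIncidenceSet (w.deleted v₁ v₂)) e) :
    Admissible ((spiderReplace G v₁ v₂ B₁ B₂).deleteIncidenceSet w) (replaceEnds v₂ w e) := by
  set H := G.deleteIncidenceSet (w.deleted v₁ v₂) with hH
  set H' := (spiderReplace G v₁ v₂ B₁ B₂).deleteIncidenceSet w with hH'
  have hv12 := h.adj.ne
  have hadj : ∀ a b, H'.Adj a b ↔ (spiderReplace G v₁ v₂ B₁ B₂).Adj a b ∧ a ≠ w ∧ b ≠ w :=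
    fun a b => SimpleGraph.deleteIncidenceSet_adj
  have hadjG : ∀ a b, H.Adj a b ↔ G.Adj a b ∧ a ≠ w.deleted v₁ v₂ ∧ b ≠ w.deleted v₁ v₂ :=
    fun a b => SimpleGraph.deleteIncidenceSet_adj
  have hxo : ∀ u (hu : u ∉ B₁ ∪ B₂), (spiderReplace G v₁ v₂ B₁ B₂).Adj .x (.old u hu) ↔
      G.Adj v₂ u := fun u hu => (h.adj_x_old hu).trans (h.twin u hu)
  have hox : ∀ u (hu : u ∉ B₁ ∪ B₂), (spiderReplace G v₁ v₂ B₁ B₂).Adj (.old u hu) .x ↔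
      G.Adj u v₂ := fun u hu => by rw [SimpleGraph.adj_comm, hxo, SimpleGraph.adj_comm]
  -- outside the spiders, the two graphs agree
  have hne : ∀ a : ReplaceVertex (B₁ ∪ B₂), a.IsCore → (a ≠ w ↔ a.core v₂ ≠ w.deleted v₁ v₂) := by
    rintro (⟨u, hu⟩ | _ | ⟨i, a⟩) ha
    · rcases w with ⟨u', hu'⟩ | _ | ⟨j, b⟩
      · simp [ReplaceVertex.core, ReplaceVertex.deleted]
      · simpa [ReplaceVertex.core, ReplaceVertex.deleted] using h.old_ne₂ hu
      · simpa [ReplaceVertex.core, ReplaceVertex.deleted] using h.old_ne₁ hu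
    · rcases w with ⟨u', hu'⟩ | _ | ⟨j, b⟩
      · simpa [ReplaceVertex.core, ReplaceVertex.deleted] using (h.old_ne₂ hu').symm
      · simp [ReplaceVertex.core, ReplaceVertex.deleted]
      · simpa [ReplaceVertex.core, ReplaceVertex.deleted] using hv12.symm
    · exact ha.elim
  have hcadj : ∀ a b : ReplaceVertex (B₁ ∪ B₂), a.IsCore → b.IsCore →
      (H'.Adj a b ↔ H.Adj (a.core v₂) (b.core v₂)) := by
    intro a b ha hb
    rw [hadj, hadjG, ← hne a ha, ← hne b hb]
    refine and_congr_left fun _ => ?_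
    rcases a with ⟨u, hu⟩ | _ | ⟨i, a⟩ <;> rcases b with ⟨u', hu'⟩ | _ | ⟨j, b⟩
    · rfl
    · exact hox u hu
    · exact hb.elim
    · exact hxo u' hu'
    · exact iff_of_false (SimpleGraph.irrefl _) (SimpleGraph.irrefl _)
    · exact hb.elim
    all_goals exact ha.elim
  have hcne : ∀ a b : ReplaceVertex (B₁ ∪ B₂), a.IsCore → b.IsCore → a ≠ b →
      a.core v₂ ≠ b.core v₂ := by
    rintro (⟨u, hu⟩ | _ | ⟨i, a⟩) (⟨u', hu'⟩ | _ | ⟨j, b⟩) ha hb hab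
    · simpa [ReplaceVertex.core] using hab
    · exact h.old_ne₂ hu
    · exact hb.elim
    · exact (h.old_ne₂ hu').symm
    · exact (hab rfl).elim
    · exact hb.elim
    all_goals exact ha.elim
  have hocore : ∀ a (ha : a ∉ B₁ ∪ B₂) b, H'.Adj (.old a ha) b → b.IsCore := by
    rintro a ha (⟨u', hu'⟩ | _ | ⟨j, b⟩) hab
    · trivial
    · trivial
    · exact ((hadj _ _).1 hab).1.elim
  obtain ⟨s₁, hs₁, hs₁'⟩ := h.exists₁
  obtain ⟨s₂, hs₂, hs₂'⟩ := h.exists₂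
  have hd := Set.disjoint_left.1 h.disj
  -- `v₁` and `v₂` have pendant neighbours
  have hbr1 : ∀ u ∉ B₁ ∪ B₂, H.Adj v₁ u → (∃ u hu, w = .old u hu) → Branching H v₁ := by
    rintro u hu hvu ⟨u', hu', rfl⟩
    rw [hadjG] at hvu
    refine ⟨u, s₁, (hadjG _ _).2 hvu, (hadjG _ _).2 ⟨h.clique₁ h.mem₁ hs₁ hs₁'.symm, hvu.2.1, ?_⟩,
      ?_, ?_⟩
    · rintro rfl; exact hu' (.inl hs₁)
    · rintro rfl; exact hu (.inl hs₁)
    · intro hn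
      exact hu (.inl (h.closed₁ s₁ hs₁ hs₁' u ((hadjG _ _).1 hn).1.symm))
  have hbr2 : ∀ u ∉ B₁ ∪ B₂, H.Adj v₂ u → Branching H v₂ := by
    intro u hu hvu
    rw [hadjG] at hvu
    refine ⟨u, s₂, (hadjG _ _).2 hvu, (hadjG _ _).2 ⟨h.clique₂ h.mem₂ hs₂ hs₂'.symm, hvu.2.1, ?_⟩,
      ?_, ?_⟩
    · rcases w with ⟨u', hu'⟩ | _ | ⟨j, b⟩
      · rintro rfl; exact hu' (.inr hs₂)
      · exact hs₂'
      · rintro rfl; exact hd h.mem₁ hs₂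
    · rintro rfl; exact hu (.inr hs₂)
    · intro hn
      exact hu (.inr (h.closed₂ s₂ hs₂ hs₂' u ((hadjG _ _).1 hn).1.symm))
  have hbro : ∀ a : ReplaceVertex (B₁ ∪ B₂), a.IsCore → ∀ b, b.IsCore → H'.Adj a b →
      Branching H' a → Branching H (a.core v₂) := by
    rintro (⟨u, hu⟩ | _ | ⟨i, a⟩) ha b hb hab hbr
    · obtain ⟨p, q, hp, hq, hpq, hn⟩ := hbr
      have hpc := hocore _ _ _ hp
      have hqc := hocore _ _ _ hq
      exact ⟨p.core v₂, q.core v₂, (hcadj _ _ ha hpc).1 hp, (hcadj _ _ ha hqc).1 hq,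
        hcne _ _ hpc hqc hpq, fun h' => hn ((hcadj _ _ hpc hqc).2 h')⟩
    · rcases b with ⟨u', hu'⟩ | _ | ⟨j, b⟩
      · exact hbr2 u' hu' ((hcadj _ _ ha hb).1 hab)
      · exact (SimpleGraph.irrefl _ hab).elim
      · exact hb.elim
    · exact ha.elim
  -- the neighbours of the spider vertices
  have hsinl : ∀ i c b, H'.Adj (.spider i (.inl c)) b → b ≠ .spider i (.inr c) →
      b = .x ∨ ∃ d, b = .spider i (.inl d) := by
    rintro i c (⟨u', hu'⟩ | _ | ⟨j, b | b⟩) hab hb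
    · exact ((hadj _ _).1 hab).1.elim
    · exact .inl rfl
    · obtain ⟨rfl, -⟩ := ((hadj _ _).1 hab).1
      exact .inr ⟨b, rfl⟩
    · obtain ⟨rfl, h'⟩ := ((hadj _ _).1 hab).1
      obtain rfl : c = b := h'
      exact (hb rfl).elim
  have hsinr : ∀ i c b, H'.Adj (.spider i (.inr c)) b → b = .spider i (.inl c) := by
    rintro i c (⟨u', hu'⟩ | _ | ⟨j, b | b⟩) hab
    · exact ((hadj _ _).1 hab).1.elim
    · exact Bool.noConfusion ((hadj _ _).1 hab).1
    · obtain ⟨rfl, h'⟩ := ((hadj _ _).1 hab).1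
      obtain rfl : c = b := h'
      rfl
    · exact ((hadj _ _).1 hab).1.2.elim
  have hxs : ∀ i b, H'.Adj .x (.spider i b) → ∃ c, b = .inl c := by
    rintro i (b | b) hab
    · exact ⟨b, rfl⟩
    · exact Bool.noConfusion ((hadj _ _).1 hab).1
  have hspc : ∀ i c d a b, H'.Adj a (.spider i (.inl c)) → H'.Adj b (.spider i (.inl d)) → c ≠ d →
      H'.Adj (.spider i (.inl c)) (.spider i (.inl d)) := fun i c d a b ha hb hcd =>
    (hadj _ _).2 ⟨⟨rfl, hcd⟩, ((hadj _ _).1 ha).2.2, ((hadj _ _).1 hb).2.2⟩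
  have hxspc : ∀ i c d, H'.Adj .x (.spider i (.inl c)) → H'.Adj .x (.spider i (.inl d)) →
      ReplaceVertex.spider (B := B₁ ∪ B₂) i (.inl c) ≠ .spider i (.inl d) →
      H'.Adj (.spider i (.inl c)) (.spider i (.inl d)) := fun i c d hc hd hne =>
    hspc i c d _ _ hc hd fun h => hne (by rw [h])
  have hbinr : ∀ i c, ¬ Branching H' (.spider i (.inr c)) := by
    rintro i c ⟨p, q, hp, hq, hpq, -⟩
    exact hpq ((hsinr _ _ _ hp).trans (hsinr _ _ _ hq).symm)
  have hbinl : ∀ i c, Branching H' (.spider i (.inl c)) →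
      w ≠ .spider i (.inl c) ∧ w ≠ .spider i (.inr c) := by
    rintro i c ⟨p, q, hp, hq, hpq, hn⟩
    refine ⟨((hadj _ _).1 hp).2.1.symm, fun hw => ?_⟩
    have hp' := hsinl i c p hp fun h => ((hadj _ _).1 hp).2.2 (h.trans hw.symm)
    have hq' := hsinl i c q hq fun h => ((hadj _ _).1 hq).2.2 (h.trans hw.symm)
    have hpw := ((hadj _ _).1 hp).2.2
    have hqw := ((hadj _ _).1 hq).2.2
    rcases hp' with rfl | ⟨d, rfl⟩ <;> rcases hq' with rfl | ⟨d', rfl⟩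
    · exact hpq rfl
    · exact hn ((hadj _ _).2 ⟨rfl, hpw, hqw⟩)
    · exact hn ((hadj _ _).2 ⟨rfl, hpw, hqw⟩)
    · exact hn (hspc _ _ _ _ _ hp hq fun h => hpq (by rw [h]))
  have hoclique : ∀ u hu u' hu', H'.Adj .x (.old u hu) → H'.Adj .x (.old u' hu') →
      ReplaceVertex.old u hu ≠ .old u' hu' → H'.Adj (.old u hu) (.old u' hu') := by
    intro u hu u' hu' ha hb hne
    rw [hadj] at ha hb ⊢
    exact ⟨h.old_clique u hu u' hu' ((h.adj_x_old hu).1 ha.1) ((h.adj_x_old hu').1 hb.1)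
      (by rintro rfl; exact hne rfl), ha.2.2, hb.2.2⟩
  -- the ends outside the spiders, except at `x`
  have hends : ∀ u hu b, b.IsCore → (replaceEnds v₂ w e (.old u hu) b ↔ e u (b.core v₂)) := by
    rintro u hu (⟨u', hu'⟩ | _ | ⟨j, b⟩) hb
    · rfl
    · rfl
    · exact hb.elim
  refine ⟨?_, ?_, ?_, ?_, ?_⟩
  · rintro (⟨u, hu⟩ | _ | ⟨i, v⟩) a b ha hb hab hea
    · have hac := hocore _ _ _ ha
      have hbc := hocore _ _ _ hb
      rw [hends u hu _ hac] at hea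
      rw [hends u hu _ hbc]
      exact he.block u _ _ ((hcadj _ _ (by trivial) hac).1 ha) ((hcadj _ _ (by trivial) hbc).1 hb)
        ((hcadj _ _ hac hbc).1 hab) hea
    · rcases a with ⟨a, ha'⟩ | _ | ⟨i, a⟩
      · rcases b with ⟨b, hb'⟩ | _ | ⟨j, b⟩
        · exact hea
        · exact (SimpleGraph.irrefl _ hb).elim
        · exact ((hadj _ _).1 hab).1.elim
      · exact (SimpleGraph.irrefl _ ha).elim
      · rcases b with ⟨b, hb'⟩ | _ | ⟨j, b⟩
        · exact ((hadj _ _).1 hab).1.elim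
        · exact (SimpleGraph.irrefl _ hb).elim
        · obtain ⟨rfl, -⟩ := ((hadj _ _).1 hab).1
          exact hea
    · trivial
  · rintro (⟨u, hu⟩ | _ | ⟨i, v | v⟩) a b c ha hb hc ea eb ec hab hac hbc
    · have hca := hocore _ _ _ ha
      have hcb := hocore _ _ _ hb
      have hcc := hocore _ _ _ hc
      rw [hends u hu _ hca] at ea
      rw [hends u hu _ hcb] at eb
      rw [hends u hu _ hcc] at ec
      rw [hcadj _ _ hca hcb, hcadj _ _ hca hcc, hcadj _ _ hcb hcc]
      exact he.two u _ _ _ ((hcadj _ _ (by trivial) hca).1 ha) ((hcadj _ _ (by trivial) hcb).1 hb)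
        ((hcadj _ _ (by trivial) hcc).1 hc) ea eb ec (hcne _ _ hca hcb hab) (hcne _ _ hca hcc hac)
        (hcne _ _ hcb hcc hbc)
    · -- only two of the three blocks of `x` are marked as ends
      have hcol : ∃ col : ReplaceVertex (B₁ ∪ B₂) → Fin 2, ∀ p q, H'.Adj .x p → H'.Adj .x q →
          replaceEnds v₂ w e .x p → replaceEnds v₂ w e .x q → col p = col q → p ≠ q →
          H'.Adj p q := by
        by_cases hw : ∃ i b, w = .spider i b
        · obtain ⟨i, b, rfl⟩ := hw
          refine ⟨fun a => match a with | .spider _ _ => 1 | _ => 0, ?_⟩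
          rintro (⟨p, hp⟩ | _ | ⟨j, p⟩) (⟨q, hq⟩ | _ | ⟨k, q⟩) hxp hxq ep eq hcol hpq
          · exact hoclique _ _ _ _ hxp hxq hpq
          · exact (SimpleGraph.irrefl _ hxq).elim
          · simp at hcol
          · exact (SimpleGraph.irrefl _ hxp).elim
          · exact (hpq rfl).elim
          · simp at hcol
          · simp at hcol
          · simp at hcol
          · obtain ⟨p, rfl⟩ := hxs _ _ hxp
            obtain ⟨q, rfl⟩ := hxs _ _ hxq
            have hj : i ≠ j := fun h' => ep b (by rw [h'])
            have hk : i ≠ k := fun h' => eq b (by rw [h'])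
            obtain rfl : j = k := by omega
            exact hxspc _ _ _ hxp hxq hpq
        · by_cases hw' : ∃ u hu, w = .old u hu
          · obtain ⟨u, hu, rfl⟩ := hw'
            refine ⟨fun a => match a with | .spider i _ => i | _ => 0, ?_⟩
            rintro (⟨p, hp⟩ | _ | ⟨j, p⟩) (⟨q, hq⟩ | _ | ⟨k, q⟩) hxp hxq ep eq hcol hpq
            · exact hoclique _ _ _ _ hxp hxq hpq
            · exact (SimpleGraph.irrefl _ hxq).elim
            · exact (ep u hu rfl).elim
            · exact (SimpleGraph.irrefl _ hxp).elim
            · exact (hpq rfl).elim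
            · exact (SimpleGraph.irrefl _ hxp).elim
            · exact (eq u hu rfl).elim
            · exact (SimpleGraph.irrefl _ hxq).elim
            · obtain ⟨p, rfl⟩ := hxs _ _ hxp
              obtain ⟨q, rfl⟩ := hxs _ _ hxq
              obtain rfl : j = k := hcol
              exact hxspc _ _ _ hxp hxq hpq
          · have : w = .x := by
              rcases w with ⟨u, hu⟩ | _ | ⟨i, b⟩
              · exact (hw' ⟨u, hu, rfl⟩).elim
              · rfl
              · exact (hw ⟨i, b, rfl⟩).elim
            exact ⟨fun _ => 0, fun p q hxp => ((((hadj _ _).1 hxp).2.1) this.symm).elim⟩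
      obtain ⟨col, hcol⟩ := hcol
      by_cases h1 : col a = col b
      · exact .inl (hcol _ _ ha hb ea eb h1 hab)
      by_cases h2 : col a = col c
      · exact .inr (.inl (hcol _ _ ha hc ea ec h2 hac))
      have h3 : col b = col c := by omega
      exact .inr (.inr (hcol _ _ hb hc eb ec h3 hbc))
    · have key : ∀ p q, H'.Adj (.spider i (.inl v)) p → H'.Adj (.spider i (.inl v)) q → p ≠ q →
          p ≠ .spider i (.inr v) → q ≠ .spider i (.inr v) → H'.Adj p q := by
        intro p q hp hq hpq hp' hq'
        have hpw := ((hadj _ _).1 hp).2.2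
        have hqw := ((hadj _ _).1 hq).2.2
        rcases hsinl _ _ _ hp hp' with rfl | ⟨d, rfl⟩ <;>
          rcases hsinl _ _ _ hq hq' with rfl | ⟨d', rfl⟩
        · exact (hpq rfl).elim
        · exact (hadj _ _).2 ⟨rfl, hpw, hqw⟩
        · exact (hadj _ _).2 ⟨rfl, hpw, hqw⟩
        · exact hspc _ _ _ _ _ hp hq fun h => hpq (by rw [h])
      by_cases h1 : a = .spider i (.inr v)
      · exact .inr (.inr (key b c hb hc hbc (fun h' => hab (h1.trans h'.symm))
          fun h' => hac (h1.trans h'.symm)))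
      by_cases h2 : b = .spider i (.inr v)
      · exact .inr (.inl (key a c ha hc hac h1 fun h' => hbc (h2.trans h'.symm)))
      exact .inl (key a b ha hb hab h1 h2)
    · exact (hab ((hsinr _ _ _ ha).trans (hsinr _ _ _ hb).symm)).elim
  · -- `x` is not at an end of its path, so that in the old graph `v₁` and `v₂` both count
    have hx : ∀ b hb c hc, H'.Adj .x (.old b hb) → H'.Adj .x (.old c hc) →
        H'.Adj (.old b hb) (.old c hc) → Branching H' (.old b hb) → Branching H' (.old c hc) →
        ¬ (∀ u hu, w ≠ .old u hu) → e b v₂ := by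
      intro b hb c hc hxb hxc hbc hBb hBc hw
      push Not at hw
      have c0 := (hcadj _ _ (by trivial) (by trivial)).1 hxb
      have c1 := (hcadj _ _ (by trivial) (by trivial)).1 hxc
      have c2 := (hcadj _ _ (by trivial) (by trivial)).1 hbc
      have a1 : H.Adj v₁ v₂ := by
        obtain ⟨u, hu, rfl⟩ := hw
        exact (hadjG _ _).2 ⟨h.adj, (h.old_ne₁ hu).symm, (h.old_ne₂ hu).symm⟩
      have tw : ∀ u, u ∉ B₁ ∪ B₂ → H.Adj v₂ u → H.Adj v₁ u := fun u hu hvu =>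
        (hadjG _ _).2 ⟨(h.twin u hu).2 ((hadjG _ _).1 hvu).1, ((hadjG _ _).1 a1).2.1,
          ((hadjG _ _).1 hvu).2.2⟩
      have d0 := tw b hb c0
      have d1 := tw c hc c1
      have := he.four ![b, v₂, v₁, c] (by
        intro i j hij
        fin_cases i <;> fin_cases j <;>
          first | exact (hij rfl).elim | exact c0 | exact c0.symm | exact c1 | exact c1.symm
                | exact c2 | exact c2.symm | exact a1 | exact a1.symm | exact d0 | exact d0.symm
                | exact d1 | exact d1.symm) (by
        intro i
        fin_cases i
        · exact hbro _ (by trivial) _ (by trivial) hbc hBb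
        · exact hbr2 b hb c0
        · exact hbr1 b hb d0 hw
        · exact hbro _ (by trivial) _ (by trivial) hbc.symm hBc)
      exact this
    rintro (⟨a, ha⟩ | _ | ⟨i, a⟩) (⟨b, hb⟩ | _ | ⟨j, b⟩) c hab hac hbc hBa hBb hBc
    · have hcc := hocore _ _ _ hac
      exact he.three a b _ ((hcadj _ _ (by trivial) (by trivial)).1 hab)
        ((hcadj _ _ (by trivial) hcc).1 hac)
        ((hcadj _ _ (by trivial) hcc).1 hbc) (hbro _ (by trivial) _ (by trivial) hab hBa)
        (hbro _ (by trivial) _ (by trivial) hab.symm hBb) (hbro _ hcc _ (by trivial) hac.symm hBc)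
    · have hcc := hocore _ _ _ hac
      rcases c with ⟨c, hc⟩ | _ | ⟨k, c⟩
      · by_cases hw : ∀ u hu, w ≠ .old u hu
        · exact .inr hw
        · exact .inl (hx a ha c hc hab.symm hbc hac hBa hBc hw)
      · exact (SimpleGraph.irrefl _ hbc).elim
      · exact hcc.elim
    · exact .inr trivial
    · have hcc := hocore _ _ _ hbc
      rcases c with ⟨c, hc⟩ | _ | ⟨k, c⟩
      · by_cases hw : ∀ u hu, w ≠ .old u hu
        · exact .inl hw
        · exact .inr (hx b hb c hc hab hac hbc hBb hBc hw)
      · exact (SimpleGraph.irrefl _ hac).elim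
      · exact hcc.elim
    · exact (SimpleGraph.irrefl _ hab).elim
    · exact .inr trivial
    all_goals exact .inl trivial
  · intro k hk hB
    have hcase : (∀ i, (k i).IsCore) ∨ ∃ i, ∀ j, k j = .x ∨ ∃ c, k j = .spider i (.inl c) := by
      by_cases hc : ∃ i l c, k i = .spider l c
      · obtain ⟨i, l, c, hi⟩ := hc
        refine .inr ⟨l, fun j => ?_⟩
        rcases c with c | c
        · by_cases hij : i = j
          · exact .inr ⟨c, hij ▸ hi⟩
          · refine hsinl l c _ (hi ▸ hk i j hij) fun h' => hbinr l c (h' ▸ hB j)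
        · exact (hbinr l c (hi ▸ hB i)).elim
      · left
        intro i
        rcases hi : k i with ⟨a, ha⟩ | _ | ⟨l, a⟩
        · trivial
        · trivial
        · exact hc ⟨i, l, a, hi⟩
    rcases hcase with hc | ⟨l, hl⟩
    · have hk' : ∀ i j, i ≠ j → H.Adj ((k i).core v₂) ((k j).core v₂) := fun i j hij =>
        (hcadj _ _ (hc i) (hc j)).1 (hk i j hij)
      have hB' : ∀ i, Branching H ((k i).core v₂) := by
        intro i
        obtain ⟨j, hj⟩ := exists_ne i
        exact hbro _ (hc i) _ (hc j) (hk i j hj.symm) (hB i)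
      rcases h0 : k 0 with ⟨a, ha⟩ | _ | ⟨l, a⟩
      · rw [hends a ha _ (hc 1)]
        have := he.four (fun i => (k i).core v₂) hk' hB'
        simp only [h0] at this
        exact this
      · rcases h1 : k 1 with ⟨a, ha⟩ | _ | ⟨l, a⟩
        · by_contra hw
          have hw : ∃ u hu, w = .old u hu := by
            by_contra! hw'
            exact hw hw'
          have hold : ∀ i, i ≠ 0 → ∃ u, ∃ (hu : u ∉ B₁ ∪ B₂), k i = .old u hu := by
            intro i hi
            rcases h2 : k i with ⟨u, hu⟩ | _ | ⟨l, c⟩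
            · exact ⟨u, hu, rfl⟩
            · have := hk i 0 hi
              rw [h0, h2] at this
              exact (SimpleGraph.irrefl _ this).elim
            · exact (h2 ▸ hc i : (ReplaceVertex.spider l c).IsCore).elim
          have a1 : H.Adj v₁ v₂ := by
            obtain ⟨u, hu, rfl⟩ := hw
            exact (hadjG _ _).2 ⟨h.adj, (h.old_ne₁ hu).symm, (h.old_ne₂ hu).symm⟩
          have tw : ∀ i, H.Adj v₁ ((k i).core v₂) := by
            intro i
            by_cases hi : i = 0
            · rw [hi, h0]; exact a1
            · have h2 := hk' 0 i (Ne.symm hi)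
              obtain ⟨u, hu, hki⟩ := hold i hi
              rw [h0, hki] at h2
              rw [hki]
              exact (hadjG _ _).2 ⟨(h.twin u hu).2 ((hadjG _ _).1 h2).1, ((hadjG _ _).1 a1).2.1,
                ((hadjG _ _).1 h2).2.2⟩
          refine he.five (Fin.cons v₁ fun i => (k i).core v₂) ?_ ?_
          · intro i j
            refine Fin.cases ?_ (fun i => ?_) i <;> refine Fin.cases ?_ (fun j => ?_) j
            · exact fun h' => (h' rfl).elim
            · exact fun _ => tw j
            · exact fun _ => (tw i).symm
            · exact fun h' => hk' i j fun h'' => h' (by rw [h''])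
          · refine Fin.cases ?_ hB'
            have h2 := tw 1
            rw [h1] at h2
            exact hbr1 a ha h2 hw
        · have := hk 0 1 (by decide)
          rw [h0, h1] at this
          exact (SimpleGraph.irrefl _ this).elim
        · exact (h1 ▸ hc 1 : (ReplaceVertex.spider l a).IsCore).elim
      · trivial
    · rcases hl 0 with h0 | ⟨c, h0⟩
      · have hs : ∀ j, j ≠ 0 → ∃ c, k j = .spider l (.inl c) := by
          intro j hj
          refine (hl j).resolve_left fun h' => ?_
          have := hk 0 j hj.symm
          rw [h0, h'] at this
          exact SimpleGraph.irrefl _ this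
        obtain ⟨c1, h1⟩ := hs 1 (by decide)
        rw [h0, h1]
        intro b hwb
        -- the three other vertices of the clique are all clique vertices of the spider
        choose c hc using fun j : Fin 3 => hs j.succ (Fin.succ_ne_zero j)
        have hinj : Function.Injective c := by
          intro i j hij
          by_contra hne
          have := (hk i.succ j.succ fun h' => hne (Fin.succ_injective _ h')).ne
          rw [hc, hc, hij] at this
          exact this rfl
        have hsurj := Finite.surjective_of_injective hinj
        rcases b with b | b
        · obtain ⟨j, rfl⟩ := hsurj b
          exact (hbinl _ _ (hc j ▸ hB j.succ)).1 hwb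
        · obtain ⟨j, rfl⟩ := hsurj b
          exact (hbinl _ _ (hc j ▸ hB j.succ)).2 hwb
      · rw [h0]
        trivial
  · intro k hk hB
    by_cases hc : ∃ i l c, k i = .spider l c
    · obtain ⟨i, l, c, hi⟩ := hc
      have hl : ∀ j, k j = .x ∨ ∃ c, k j = .spider l (.inl c) := by
        intro j
        rcases c with c | c
        · by_cases hij : i = j
          · exact .inr ⟨c, hij ▸ hi⟩
          · exact hsinl l c _ (hi ▸ hk i j hij) fun h' => hbinr l c (h' ▸ hB j)
        · exact (hbinr l c (hi ▸ hB i)).elim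
      have : ∀ j, ∃ c : Option (Fin 3), k j = c.elim .x fun c => .spider l (.inl c) := by
        intro j
        rcases hl j with h' | ⟨c, h'⟩
        exacts [⟨none, h'⟩, ⟨some c, h'⟩]
      choose c hc using this
      have hinj : Function.Injective c := by
        intro i j hij
        by_contra hne
        have := (hk i j hne).ne
        rw [hc, hc, hij] at this
        exact this rfl
      simpa using Fintype.card_le_of_injective _ hinj
    · have hcore : ∀ i, (k i).IsCore := by
        intro i
        rcases hi : k i with ⟨a, ha⟩ | _ | ⟨l, a⟩
        · trivial
        · trivial
        · exact hc ⟨i, l, a, hi⟩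
      refine he.five (fun i => (k i).core v₂)
        (fun i j hij => (hcadj _ _ (hcore i) (hcore j)).1 (hk i j hij)) fun i => ?_
      obtain ⟨j, hj⟩ := exists_ne i
      exact hbro _ (hcore i) _ (hcore j) (hk i j hj.symm) (hB i)

end Replace

/-- The vertex `w` is isolated rather than removed, which keeps the vertex type and does not change
the representability of the rest. -/
lemma FamilyF.exists_admissible {W : Type} {F : SimpleGraph W} (hF : FamilyF F) :
    ∀ w, ∃ e, Admissible (F.deleteIncidenceSet w) e := by
  refine hF.site_induction (P := fun {W} F => ∀ w, ∃ e, Admissible (F.deleteIncidenceSet w) e)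
    ?_ ?_ ?_
  · rintro V W G F ⟨f⟩ hF w
    obtain ⟨e, he⟩ := hF (f w)
    exact ⟨_, he.of_iso_deleteIncidenceSet f⟩
  · exact fun w => ⟨_, thinSpider_admissible w⟩
  · intro V G v₁ v₂ B₁ B₂ h hG w
    obtain ⟨e, he⟩ := hG (w.deleted v₁ v₂)
    exact ⟨_, h.admissible w he⟩

/-! ### Segments in the plane -/

/-- The unit vectors to the right, up, left and down, so that `d + 2` is opposite to `d`. -/
noncomputable def dirVec : Fin 4 → ℝ × ℝ := ![(1, 0), (0, 1), (-1, 0), (0, -1)]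

lemma dirVec_add_two (d : Fin 4) : dirVec (d + 2) = -dirVec d := by
  fin_cases d <;> simp [dirVec]

lemma norm_dirVec (d : Fin 4) : ‖dirVec d‖ = 1 := by
  fin_cases d <;> simp [dirVec, Prod.norm_def]

lemma eq_of_smul_dirVec {d d' : Fin 4} {r r' : ℝ} (hr : 0 < r) (hr' : 0 ≤ r')
    (h : r • dirVec d = r' • dirVec d') : d = d' := by
  fin_cases d <;> fin_cases d' <;> 
    first
      | rfl
      | (simp [dirVec] at h; exfalso; linarith [h.1, h.2])
      | (simp [dirVec] at h; exfalso; linarith)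

lemma smul_dirVec_injective (d : Fin 4) {r r' : ℝ} (h : r • dirVec d = r' • dirVec d) : r = r' := by
  have h' : (r - r') • dirVec d = 0 := by rw [sub_smul, h, sub_self]
  rcases smul_eq_zero.1 h' with h' | h'
  · linarith
  · have := norm_dirVec d
    rw [h'] at this
    simp at this

/-- A family of horizontal and vertical segments: the segment of `v` starts at `base v` and has
length `len v` in the direction `dir v`. -/
structure Layout (V : Type*) where
  base : V → ℝ × ℝ
  dir : V → Fin 4
  len : V → ℝ

namespace Layout

variable {V : Type*} (L : Layout V)

/-- The point at distance `r` from the base of the segment of `v`. -/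
noncomputable def pt (v : V) (r : ℝ) : ℝ × ℝ := L.base v + r • dirVec (L.dir v)

/-- The segment of `v`. -/
def path (v : V) : Set (ℝ × ℝ) := L.pt v '' Set.Icc 0 (L.len v)

/-- No segment of `U`, apart from that of `v`, contains the point at distance `r`. -/
def Free (U : Set V) (v : V) (r : ℝ) : Prop := ∀ w ∈ U, w ≠ v → L.pt v r ∉ L.path w

variable {L}

lemma pt_mem_path {v : V} {r : ℝ} (h0 : 0 ≤ r) (h1 : r ≤ L.len v) : L.pt v r ∈ L.path v :=
  ⟨r, ⟨h0, h1⟩, rfl⟩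

lemma pt_injective {v : V} {r r' : ℝ} (h : L.pt v r = L.pt v r') : r = r' :=
  smul_dirVec_injective _ (add_left_cancel h)

lemma isCompact_path (v : V) : IsCompact (L.path v) := by
  refine isCompact_Icc.image ?_
  unfold pt
  fun_prop

lemma dist_pt (v : V) (r r' : ℝ) : dist (L.pt v r) (L.pt v r') = |r - r'| := by
  rw [pt, pt, dist_add_left, dist_eq_norm, ← sub_smul, norm_smul, norm_dirVec, mul_one,
    Real.norm_eq_abs]

end Layout

/-- A layout of the vertices in `U` that can be extended: a branching vertex has a free point
inside its segment, where a block that is not an end can be attached, and free ends for those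
blocks of ends that are not yet present. The same is required of a vertex without neighbours in
`U`, from which the layout of a further component starts. -/
structure Layout.Valid {V : Type*} (G : SimpleGraph V) (e : V → V → Prop) (U : Set V)
    (L : Layout V) : Prop where
  len_nonneg : ∀ v ∈ U, 0 ≤ L.len v
  adj_iff : ∀ u ∈ U, ∀ v ∈ U, u ≠ v → (G.Adj u v ↔ (L.path u ∩ L.path v).Nonempty)
  rich : ∀ v ∈ U, (Branching G v ∨ ∀ a ∈ U, ¬ G.Adj v a) →
    0 < L.len v ∧ (∃ r ∈ Set.Ioo 0 (L.len v), L.Free U v r) ∧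
    ((∀ a ∈ U, G.Adj v a → ¬ e v a) → L.Free U v 0 ∧ L.Free U v (L.len v)) ∧
    ((∀ a ∈ U, ∀ b ∈ U, G.Adj v a → G.Adj v b → e v a → e v b → a ≠ b → G.Adj a b) →
      L.Free U v 0 ∨ L.Free U v (L.len v))

section Extend

variable {V : Type*} [Finite V] {G : SimpleGraph V} {e : V → V → Prop} {U : Set V} {L : Layout V}

/-- A vertex without neighbours in `U` gets a segment far away. -/
lemma Layout.Valid.insert_isolated (hL : L.Valid G e U) {y : V} (hy : y ∉ U)
    (hn : ∀ a ∈ U, ¬ G.Adj y a) : ∃ L' : Layout V, L'.Valid G e (insert y U) := by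
  classical
  have hc : IsCompact (⋃ v ∈ U, L.path v) :=
    U.toFinite.isCompact_biUnion fun v _ => Layout.isCompact_path v
  obtain ⟨M, hM⟩ := hc.isBounded.subset_closedBall (0 : ℝ × ℝ)
  let L' : Layout V := ⟨Function.update L.base y (M + 1, 0), Function.update L.dir y 1,
    Function.update L.len y 1⟩
  have hpt : ∀ v, v ≠ y → ∀ r, L'.pt v r = L.pt v r := by
    intro v hv r
    simp [Layout.pt, L', hv]
  have hlen : ∀ v, v ≠ y → L'.len v = L.len v := fun v hv => by simp [L', hv]
  have hleny : L'.len y = 1 := by simp [L']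
  have hpath : ∀ v, v ≠ y → L'.path v = L.path v := by
    intro v hv
    rw [Layout.path, Layout.path, hlen v hv]
    exact Set.image_congr fun r _ => hpt v hv r
  have hne : ∀ v ∈ U, v ≠ y := fun v hv h => hy (h ▸ hv)
  have hyfst : ∀ r, (L'.pt y r).1 = M + 1 := by
    intro r
    simp [Layout.pt, L', dirVec]
  have hfst : ∀ v ∈ U, ∀ p ∈ L.path v, p.1 ≤ M := by
    intro v hv p hp
    have := hM (Set.mem_biUnion hv hp)
    rw [mem_closedBall_zero_iff] at this
    exact (le_abs_self _).trans ((norm_fst_le p).trans this)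
  have hdisj : ∀ v ∈ U, ∀ r, L'.pt y r ∉ L'.path v := by
    intro v hv r h
    rw [hpath v (hne v hv)] at h
    have := hfst v hv _ h
    rw [hyfst] at this
    linarith
  have hfree : ∀ r, L'.Free (insert y U) y r := by
    intro r w hw hwy
    exact hdisj w (hw.resolve_left hwy) r
  have hfree' : ∀ v ∈ U, ∀ r, 0 ≤ r → r ≤ L.len v → L.Free U v r → L'.Free (insert y U) v r := by
    intro v hv r hr hr' hf w hw hwv
    rw [hpt v (hne v hv)]
    rcases hw with rfl | hw
    · rintro ⟨s, hs, h⟩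
      have := hfst v hv _ (Layout.pt_mem_path hr hr')
      rw [← h, hyfst] at this
      linarith
    · rw [hpath w (hne w hw)]
      exact hf w hw hwv
  have hempty : ∀ v ∈ U, ¬ (L'.path y ∩ L'.path v).Nonempty := by
    rintro v hv ⟨_, ⟨r, hr, rfl⟩, h⟩
    exact hdisj v hv r h
  refine ⟨L', ?_, ?_, ?_⟩
  · rintro v (rfl | hv)
    · rw [hleny]; exact zero_le_one
    · rw [hlen v (hne v hv)]; exact hL.len_nonneg v hv
  · rintro u (rfl | hu) v (rfl | hv) huv
    · exact (huv rfl).elim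
    · exact iff_of_false (hn v hv) (hempty v hv)
    · rw [Set.inter_comm]
      exact iff_of_false (fun h => hn u hu h.symm) (hempty u hu)
    · rw [hpath u (hne u hu), hpath v (hne v hv)]
      exact hL.adj_iff u hu v hv huv
  · rintro v (rfl | hv) hb
    · rw [hleny]
      exact ⟨zero_lt_one, ⟨1 / 2, ⟨by norm_num, by norm_num⟩, hfree _⟩,
        fun _ => ⟨hfree _, hfree _⟩, fun _ => .inl (hfree _)⟩
    · obtain ⟨h1, ⟨r, hr, hf⟩, h3, h4⟩ := hL.rich v hv (hb.imp id fun h a ha => h a (.inr ha))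
      rw [hlen v (hne v hv)]
      refine ⟨h1, ⟨r, hr, hfree' v hv r hr.1.le hr.2.le hf⟩, fun h => ?_, fun h => ?_⟩
      · obtain ⟨f1, f2⟩ := h3 fun a ha => h a (.inr ha)
        exact ⟨hfree' v hv _ le_rfl h1.le f1, hfree' v hv _ h1.le le_rfl f2⟩
      · exact (h4 fun a ha b hb => h a (.inr ha) b (.inr hb)).imp (hfree' v hv _ le_rfl h1.le)
          (hfree' v hv _ h1.le le_rfl)

/-- A distribution of directions over the vertices of `T`: `s` uses the direction `D s` and, if
`dbl s` holds, also the opposite one. The directions of distinct vertices are distinct and avoid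
`X`. A vertex may use just one direction if `E s` holds. -/
structure IsAllocation {V : Type*} (X : Set (Fin 4)) (E : V → Prop) (T : Set V)
    (D : V → Fin 4) (dbl : V → Prop) : Prop where
  not_mem : ∀ s ∈ T, D s ∉ X
  not_mem_opp : ∀ s ∈ T, dbl s → D s + 2 ∉ X
  ne : ∀ s ∈ T, ∀ s' ∈ T, s ≠ s' → D s ≠ D s'
  ne_opp : ∀ s ∈ T, ∀ s' ∈ T, s ≠ s' → dbl s → D s + 2 ≠ D s'
  single : ∀ s ∈ T, ¬ dbl s → E s

/-- Attaching the vertices `S` of a block at the point `L.pt x r₀` of the segment of `x`, where `X`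
contains the directions in which this segment leaves the point. -/
lemma Layout.Valid.attach (hL : L.Valid G e U) {x : V} (hx : x ∈ U)
    {S : Set V} (hSU : ∀ s ∈ S, s ∉ U) (hSx : ∀ s ∈ S, G.Adj s x)
    (hSc : G.IsClique S) (hSn : ∀ s ∈ S, ∀ u ∈ U, G.Adj s u → u = x) {r₀ : ℝ}
    (hr₀ : r₀ ∈ Set.Icc 0 (L.len x)) (hlen : 0 < L.len x) (hfr : L.Free U x r₀) {X : Set (Fin 4)}
    (hX : ∀ p ∈ L.path x, ∃ d ∈ X, ∃ r : ℝ, 0 ≤ r ∧ p = L.pt x r₀ + r • dirVec d)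
    {D : V → Fin 4} {dbl : V → Prop}
    (hA : IsAllocation X (fun s => e s x) {s | s ∈ S ∧ Branching G s} D dbl)
    (hx3 : (∀ a ∈ U ∪ S, G.Adj x a → ¬ e x a) →
      r₀ ≠ 0 ∧ r₀ ≠ L.len x ∧ L.Free U x 0 ∧ L.Free U x (L.len x))
    (hx4 : (∀ a ∈ U ∪ S, ∀ b ∈ U ∪ S, G.Adj x a → G.Adj x b → e x a → e x b → a ≠ b → G.Adj a b) →
      r₀ ≠ 0 ∧ L.Free U x 0 ∨ r₀ ≠ L.len x ∧ L.Free U x (L.len x)) :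
    ∃ L' : Layout V, L'.Valid G e (U ∪ S) := by
  classical
  set z := L.pt x r₀ with hz
  -- a ball around `z` that meets no other segment
  obtain ⟨ε, hε, hball⟩ : ∃ ε > 0, ∀ w ∈ U, w ≠ x → ∀ p ∈ L.path w, ε ≤ dist p z := by
    have hc : IsClosed (⋃ w ∈ U \ {x}, L.path w) :=
      ((U \ {x}).toFinite.isCompact_biUnion fun v _ => Layout.isCompact_path v).isClosed
    have hzn : z ∉ ⋃ w ∈ U \ {x}, L.path w := by
      simp only [Set.mem_iUnion, not_exists]
      exact fun w hw => hfr w hw.1 hw.2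
    obtain ⟨ε, hε, h⟩ := Metric.isOpen_iff.1 hc.isOpen_compl z hzn
    refine ⟨ε, hε, fun w hw hwx p hp => ?_⟩
    by_contra hlt
    exact h (Metric.mem_ball.2 (not_le.1 hlt)) (Set.mem_biUnion ⟨hw, hwx⟩ hp)
  set δ := ε / 2 with hδ
  have hδ0 : 0 < δ := by positivity
  let L' : Layout V :=
    ⟨fun v => if v ∈ S then (if Branching G v ∧ dbl v then z - δ • dirVec (D v) else z)
        else L.base v,
      fun v => if v ∈ S then D v else L.dir v,
      fun v => if v ∈ S then (if Branching G v then (if dbl v then 2 * δ else δ) else 0)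
        else L.len v⟩
  have hUS : ∀ u ∈ U, u ∉ S := fun u hu hs => hSU u hs hu
  have hpt : ∀ v ∈ U, ∀ r, L'.pt v r = L.pt v r := by
    intro v hv r
    simp [Layout.pt, L', hUS v hv]
  have hlen' : ∀ v ∈ U, L'.len v = L.len v := fun v hv => by simp [L', hUS v hv]
  have hpath : ∀ v ∈ U, L'.path v = L.path v := by
    intro v hv
    rw [Layout.path, Layout.path, hlen' v hv]
    exact Set.image_congr fun r _ => hpt v hv r
  -- the new segments as unions of arms starting at `z`
  have hpt0 : ∀ s ∈ S, ¬ Branching G s → ∀ r, L'.pt s r = z + r • dirVec (D s) := by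
    intro s hs hb r
    simp [Layout.pt, L', hs, hb]
  have hpt1 : ∀ s ∈ S, ¬ dbl s → ∀ r, L'.pt s r = z + r • dirVec (D s) := by
    intro s hs hb r
    simp [Layout.pt, L', hs, hb]
  have hpt2 : ∀ s ∈ S, Branching G s → dbl s → ∀ r, L'.pt s r = z + (r - δ) • dirVec (D s) := by
    intro s hs hb hd r
    simp only [Layout.pt, L', hs, hb, hd, and_self, if_true, sub_smul]
    abel
  have hl0 : ∀ s ∈ S, ¬ Branching G s → L'.len s = 0 := fun s hs hb => by simp [L', hs, hb]
  have hl1 : ∀ s ∈ S, Branching G s → ¬ dbl s → L'.len s = δ := fun s hs hb hd => by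
    simp [L', hs, hb, hd]
  have hl2 : ∀ s ∈ S, Branching G s → dbl s → L'.len s = 2 * δ := fun s hs hb hd => by
    simp [L', hs, hb, hd]
  let A : V → Set (Fin 4) := fun s => {d | Branching G s ∧ (d = D s ∨ dbl s ∧ d = D s + 2)}
  have harm : ∀ s ∈ S, ∀ p ∈ L'.path s, p = z ∨
      ∃ d ∈ A s, ∃ r : ℝ, 0 < r ∧ r ≤ δ ∧ p = z + r • dirVec d := by
    rintro s hs _ ⟨r, hr, rfl⟩
    by_cases hb : Branching G s
    · by_cases hd : dbl s
      · rw [hl2 s hs hb hd] at hr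
        rw [hpt2 s hs hb hd]
        rcases lt_trichotomy r δ with h | h | h
        · refine .inr ⟨D s + 2, ⟨hb, .inr ⟨hd, rfl⟩⟩, δ - r, by linarith, by linarith [hr.1], ?_⟩
          rw [dirVec_add_two, smul_neg, ← neg_smul, neg_sub]
        · left; rw [h]; simp
        · exact .inr ⟨D s, ⟨hb, .inl rfl⟩, r - δ, by linarith, by linarith [hr.2], rfl⟩
      · rw [hl1 s hs hb hd] at hr
        rw [hpt1 s hs hd]
        rcases hr.1.eq_or_lt with h | h
        · left; rw [← h]; simp
        · exact .inr ⟨D s, ⟨hb, .inl rfl⟩, r, h, hr.2, rfl⟩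
    · rw [hl0 s hs hb] at hr
      left
      rw [hpt0 s hs hb, le_antisymm hr.2 hr.1]
      simp
  have hzS : ∀ s ∈ S, z ∈ L'.path s := by
    intro s hs
    by_cases hb : Branching G s
    · by_cases hd : dbl s
      · refine ⟨δ, ?_, by rw [hpt2 s hs hb hd]; simp⟩
        rw [hl2 s hs hb hd]
        exact ⟨hδ0.le, by linarith⟩
      · refine ⟨0, ?_, by rw [hpt1 s hs hd]; simp⟩
        rw [hl1 s hs hb hd]
        exact ⟨le_rfl, hδ0.le⟩
    · refine ⟨0, ?_, by rw [hpt0 s hs hb]; simp⟩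
      rw [hl0 s hs hb]
      exact ⟨le_rfl, le_rfl⟩
  have hAX : ∀ s ∈ S, ∀ d ∈ A s, d ∉ X := by
    rintro s hs d ⟨hb, rfl | ⟨hd, rfl⟩⟩
    exacts [hA.not_mem s ⟨hs, hb⟩, hA.not_mem_opp s ⟨hs, hb⟩ hd]
  have hAA : ∀ s ∈ S, ∀ s' ∈ S, s ≠ s' → ∀ d ∈ A s, d ∉ A s' := by
    rintro s hs s' hs' hne d ⟨hb, h⟩ ⟨hb', h'⟩
    rcases h with rfl | ⟨hd, rfl⟩ <;> rcases h' with h' | ⟨hd', h'⟩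
    · exact hA.ne s ⟨hs, hb⟩ s' ⟨hs', hb'⟩ hne h'
    · exact hA.ne_opp s' ⟨hs', hb'⟩ s ⟨hs, hb⟩ hne.symm hd' h'.symm
    · exact hA.ne_opp s ⟨hs, hb⟩ s' ⟨hs', hb'⟩ hne hd h'
    · exact hA.ne s ⟨hs, hb⟩ s' ⟨hs', hb'⟩ hne (add_right_cancel h')
  have hdz : ∀ (r : ℝ) d, 0 ≤ r → dist (z + r • dirVec d) z = r := by
    intro r d hr
    rw [dist_self_add_left, norm_smul, norm_dirVec, mul_one, Real.norm_eq_abs, abs_of_nonneg hr]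
  have hSball : ∀ s ∈ S, ∀ p ∈ L'.path s, dist p z < ε := by
    intro s hs p hp
    rcases harm s hs p hp with rfl | ⟨d, -, r, hr, hrδ, rfl⟩
    · simpa using hε
    · rw [hdz r d hr.le]
      linarith
  have hSold : ∀ s ∈ S, ∀ w ∈ U, w ≠ x → ∀ p ∈ L'.path s, p ∉ L.path w :=
    fun s hs w hw hwx p hp hp' => absurd (hSball s hs p hp) (not_lt.2 (hball w hw hwx p hp'))
  have hSX : ∀ s ∈ S, ∀ p ∈ L'.path s, p ∈ L.path x → p = z := by
    intro s hs p hp hpx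
    rcases harm s hs p hp with rfl | ⟨d, hd, r, hr, hrδ, rfl⟩
    · rfl
    · obtain ⟨d', hd', r', hr', h⟩ := hX _ hpx
      obtain rfl := eq_of_smul_dirVec hr hr' (add_left_cancel h)
      exact (hAX s hs d hd hd').elim
  -- the points of the arms are free
  have hfreeS : ∀ s ∈ S, ∀ r, 0 ≤ r → r ≤ L'.len s → L'.pt s r ≠ z → L'.Free (U ∪ S) s r := by
    intro s hs r hr hr' hne w hw hws hp
    have hps : L'.pt s r ∈ L'.path s := Layout.pt_mem_path hr hr'
    rcases hw with hw | hw
    · rw [hpath w hw] at hp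
      by_cases hwx : w = x
      · exact hne (hSX s hs _ hps (hwx ▸ hp))
      · exact hSold s hs w hw hwx _ hps hp
    · obtain ⟨d, hd, t, ht, htδ, h⟩ := (harm s hs _ hps).resolve_left hne
      obtain ⟨d', hd', t', ht', -, h'⟩ := (harm w hw _ hp).resolve_left hne
      rw [h] at h'
      obtain rfl := eq_of_smul_dirVec ht ht'.le (add_left_cancel h')
      exact hAA s hs w hw hws.symm d hd hd'
  have hfreeU : ∀ v ∈ U, v ≠ x → ∀ r, 0 ≤ r → r ≤ L.len v → L.Free U v r →
      L'.Free (U ∪ S) v r := by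
    intro v hv hvx r hr hr' hf w hw hwv
    rw [hpt v hv]
    rcases hw with hw | hw
    · rw [hpath w hw]; exact hf w hw hwv
    · exact fun h => hSold w hw v hv hvx _ h (Layout.pt_mem_path hr hr')
  have hfreex : ∀ r, 0 ≤ r → r ≤ L.len x → r ≠ r₀ → L.Free U x r → L'.Free (U ∪ S) x r := by
    intro r hr hr' hne hf w hw hwv
    rw [hpt x hx]
    rcases hw with hw | hw
    · rw [hpath w hw]; exact hf w hw hwv
    · exact fun h => hne (Layout.pt_injective (hSX w hw _ h (Layout.pt_mem_path hr hr')))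
  have hxp : z ∈ L.path x := Layout.pt_mem_path hr₀.1 hr₀.2
  have hSUadj : ∀ s ∈ S, ∀ u ∈ U, G.Adj s u ↔ (L'.path s ∩ L'.path u).Nonempty := by
    intro s hs u hu
    rw [hpath u hu]
    by_cases hux : u = x
    · subst hux
      exact iff_of_true (hSx s hs) ⟨z, hzS s hs, hxp⟩
    · refine iff_of_false (fun h => hux (hSn s hs u hu h)) ?_
      rintro ⟨p, hp, hp'⟩
      exact hSold s hs u hu hux p hp hp'
  refine ⟨L', ?_, ?_, ?_⟩
  · rintro v (hv | hv)
    · rw [hlen' v hv]; exact hL.len_nonneg v hv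
    · by_cases hb : Branching G v
      · by_cases hd : dbl v
        · rw [hl2 v hv hb hd]; linarith
        · rw [hl1 v hv hb hd]; exact hδ0.le
      · rw [hl0 v hv hb]
  · rintro u (hu | hu) v (hv | hv) huv
    · rw [hpath u hu, hpath v hv]
      exact hL.adj_iff u hu v hv huv
    · rw [SimpleGraph.adj_comm, Set.inter_comm]
      exact hSUadj v hv u hu
    · exact hSUadj u hu v hv
    · exact iff_of_true (hSc hu hv huv) ⟨z, hzS u hu, hzS v hv⟩
  · rintro v (hv | hv) hb
    · have hb' : Branching G v ∨ ∀ a ∈ U, ¬ G.Adj v a := hb.imp id fun h a ha => h a (.inl ha)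
      obtain ⟨h1, ⟨r, hr, hf⟩, h3, h4⟩ := hL.rich v hv hb'
      rw [hlen' v hv]
      by_cases hvx : v = x
      · subst hvx
        refine ⟨h1, ?_, fun h => ?_, fun h => ?_⟩
        · -- a point of the segment close to `z` is free
          obtain ⟨r₁, hr₁, hne, hlt⟩ : ∃ r₁ ∈ Set.Ioo 0 (L.len v), r₁ ≠ r₀ ∧ |r₁ - r₀| < ε := by
            rcases hr₀.2.eq_or_lt with h | h
            · refine ⟨r₀ - min ε (L.len v) / 2, ?_, ?_, ?_⟩
              · rw [h]
                have := lt_min hε hlen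
                exact ⟨by linarith [min_le_right ε (L.len v)], by linarith⟩
              · have := lt_min hε hlen
                intro h'; linarith
              · have := lt_min hε hlen
                rw [sub_sub_cancel_left, abs_neg, abs_of_pos (by linarith)]
                linarith [min_le_left ε (L.len v)]
            · have hm : 0 < min ε (L.len v - r₀) := lt_min hε (by linarith)
              refine ⟨r₀ + min ε (L.len v - r₀) / 2, ⟨by linarith [hr₀.1], ?_⟩, ?_, ?_⟩
              · linarith [min_le_right ε (L.len v - r₀)]
              · intro h'; linarith
              · rw [add_sub_cancel_left, abs_of_pos (by linarith)]
                linarith [min_le_left ε (L.len v - r₀)]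
          refine ⟨r₁, hr₁, hfreex r₁ hr₁.1.le hr₁.2.le hne fun w hw hwv hp => ?_⟩
          have := hball w hw hwv _ hp
          rw [hz, Layout.dist_pt] at this
          linarith
        · obtain ⟨n0, n1, f0, f1⟩ := hx3 h
          exact ⟨hfreex _ le_rfl hlen.le n0.symm f0, hfreex _ hlen.le le_rfl n1.symm f1⟩
        · rcases hx4 h with ⟨n, f⟩ | ⟨n, f⟩
          exacts [.inl (hfreex _ le_rfl hlen.le n.symm f), .inr (hfreex _ hlen.le le_rfl n.symm f)]
      · refine ⟨h1, ⟨r, hr, hfreeU v hv hvx r hr.1.le hr.2.le hf⟩, fun h => ?_, fun h => ?_⟩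
        · obtain ⟨f1, f2⟩ := h3 fun a ha => h a (.inl ha)
          exact ⟨hfreeU v hv hvx _ le_rfl h1.le f1, hfreeU v hv hvx _ h1.le le_rfl f2⟩
        · exact (h4 fun a ha b hb => h a (.inl ha) b (.inl hb)).imp
            (hfreeU v hv hvx _ le_rfl h1.le) (hfreeU v hv hvx _ h1.le le_rfl)
    · have hb : Branching G v := hb.resolve_right fun h => h x (.inl hx) (hSx v hv)
      have hne : ∀ r : ℝ, r ≠ 0 → z + r • dirVec (D v) ≠ z := by
        intro r hr h
        have h : z + r • dirVec (D v) = z + (0 : ℝ) • dirVec (D v) := by rw [h]; simp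
        exact hr (smul_dirVec_injective _ (add_left_cancel h))
      by_cases hd : dbl v
      · have hl := hl2 v hv hb hd
        have hf : ∀ r, 0 ≤ r → r ≤ 2 * δ → r ≠ δ → L'.Free (U ∪ S) v r := by
          intro r hr hr' hrδ
          refine hfreeS v hv r hr (hl ▸ hr') ?_
          rw [hpt2 v hv hb hd]
          exact hne _ (sub_ne_zero.2 hrδ)
        have f0 := hf 0 le_rfl (by linarith) hδ0.ne
        have f1 := hf (2 * δ) (by linarith) le_rfl (by linarith)
        rw [hl]
        exact ⟨by linarith, ⟨δ / 2, ⟨by linarith, by linarith⟩,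
          hf _ (by linarith) (by linarith) (by linarith)⟩, fun _ => ⟨f0, f1⟩, fun _ => .inl f0⟩
      · have hl := hl1 v hv hb hd
        have hf : ∀ r, 0 < r → r ≤ δ → L'.Free (U ∪ S) v r := by
          intro r hr hr'
          refine hfreeS v hv r hr.le (hl ▸ hr') ?_
          rw [hpt1 v hv hd]
          exact hne _ hr.ne'
        have f1 := hf δ hδ0 le_rfl
        rw [hl]
        exact ⟨hδ0, ⟨δ / 2, ⟨by linarith, by linarith⟩, hf _ (by linarith) (by linarith)⟩,
          fun h => (h x (.inl hx) (hSx v hv) (hA.single v ⟨hv, hb⟩ hd)).elim, fun _ => .inr f1⟩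

/-- At an end of the segment of `x` the three directions other than `c + 2` are available. -/
lemma exists_isAllocation_end {V : Type*} (c : Fin 4) {E : V → Prop} {T : Set V}
    (h2 : ∀ s ∈ T, ∀ s' ∈ T, s ≠ s' → E s ∨ E s')
    (h3 : ∀ s ∈ T, ∀ s' ∈ T, ∀ s'' ∈ T, s ≠ s' → s ≠ s'' → s' ≠ s'' → E s)
    (h4 : ∀ s ∈ T, ∀ s' ∈ T, ∀ s'' ∈ T, ∀ t ∈ T, s ≠ s' → s ≠ s'' → s' ≠ s'' → t ≠ s → t ≠ s' →
      t = s'') : ∃ D dbl, IsAllocation {c + 2} E T D dbl := by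
  classical
  have c1 : ∀ c : Fin 4, c ≠ c + 2 := by decide
  have c2 : ∀ c : Fin 4, c + 1 ≠ c + 2 := by decide
  have c3 : ∀ c : Fin 4, c + 3 ≠ c + 2 := by decide
  have c4 : ∀ c : Fin 4, c ≠ c + 1 := by decide
  have c5 : ∀ c : Fin 4, c ≠ c + 3 := by decide
  have c6 : ∀ c : Fin 4, c + 1 ≠ c + 3 := by decide
  have c7 : ∀ c : Fin 4, c + 1 + 2 ≠ c + 2 := by decide
  have c8 : ∀ c : Fin 4, c + 1 + 2 ≠ c := by decide
  by_cases e1 : ∃ s, s ∈ T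
  swap
  · push Not at e1
    exact ⟨fun _ => c, fun _ => False, fun s hs => (e1 s hs).elim, fun s hs => (e1 s hs).elim,
      fun s hs => (e1 s hs).elim, fun s hs => (e1 s hs).elim, fun s hs => (e1 s hs).elim⟩
  obtain ⟨s, hs⟩ := e1
  by_cases e2 : ∃ s' ∈ T, s' ≠ s
  swap
  · push Not at e2
    refine ⟨fun _ => c + 1, fun _ => True, fun _ _ => c2 c, fun _ _ _ => c7 c, ?_, ?_,
      fun _ _ h => (h trivial).elim⟩
    · intro a ha b hb hab
      exact (hab ((e2 a ha).trans (e2 b hb).symm)).elim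
    · intro a ha b hb hab
      exact (hab ((e2 a ha).trans (e2 b hb).symm)).elim
  obtain ⟨s', hs', hne⟩ := e2
  by_cases e3 : ∃ s'' ∈ T, s'' ≠ s ∧ s'' ≠ s'
  · obtain ⟨s'', hs'', n1, n2⟩ := e3
    have hall : ∀ t ∈ T, t = s ∨ t = s' ∨ t = s'' := by
      intro t ht
      by_contra! hn
      exact hn.2.2 (h4 s hs s' hs' s'' hs'' t ht hne.symm n1.symm n2.symm hn.1 hn.2.1)
    refine ⟨fun v => if v = s then c else if v = s' then c + 1 else c + 3, fun _ => False,
      ?_, fun _ _ h => h.elim, ?_, fun _ _ _ _ _ h => h.elim, ?_⟩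
    · intro t ht
      rcases hall t ht with rfl | rfl | rfl <;> simp [hne, n1, n2, c1, c2, c3]
    · intro t ht t' ht' htt'
      rcases hall t ht with rfl | rfl | rfl <;> rcases hall t' ht' with rfl | rfl | rfl <;>
        simp [hne, n1, n2, c4, c5, c6, (c4 c).symm, (c5 c).symm, (c6 c).symm] at htt' ⊢
    · intro t ht _
      rcases hall t ht with rfl | rfl | rfl
      · exact h3 _ hs _ hs' _ hs'' hne.symm n1.symm n2.symm
      · exact h3 _ hs' _ hs _ hs'' hne n2.symm n1.symm
      · exact h3 _ hs'' _ hs _ hs' n1 n2 hne.symm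
  · push Not at e3
    obtain ⟨a, ha, b, hb, hab, hEa, hall⟩ : ∃ a ∈ T, ∃ b ∈ T, a ≠ b ∧ E a ∧
        ∀ t ∈ T, t = a ∨ t = b := by
      rcases h2 s hs s' hs' hne.symm with h | h
      · exact ⟨s, hs, s', hs', hne.symm, h, fun t ht => or_iff_not_imp_left.2 (e3 t ht)⟩
      · exact ⟨s', hs', s, hs, hne, h, fun t ht => (or_iff_not_imp_left.2 (e3 t ht)).symm⟩
    refine ⟨fun v => if v = a then c else c + 1, fun v => v = b, ?_, ?_, ?_, ?_, ?_⟩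
    · intro t ht
      rcases hall t ht with rfl | rfl <;> simp [hab.symm, c1, c2]
    · rintro t ht rfl
      simp [hab.symm, c7]
    · intro t ht t' ht' htt'
      rcases hall t ht with rfl | rfl <;> rcases hall t' ht' with rfl | rfl <;>
        simp [hab.symm, c4, (c4 c).symm] at htt' ⊢
    · rintro t ht t' ht' htt' rfl
      rcases hall t' ht' with rfl | rfl
      · simp [hab.symm, c8]
      · exact (htt' rfl).elim
    · intro t ht htb
      exact (hall t ht).resolve_right htb ▸ hEa

/-- Inside the segment of `x` the two directions perpendicular to it are available. -/
lemma exists_isAllocation_inner {V : Type*} (c : Fin 4) {E : V → Prop} {T : Set V}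
    (h2 : ∀ s ∈ T, ∀ s' ∈ T, s ≠ s' → E s)
    (h3 : ∀ s ∈ T, ∀ s' ∈ T, ∀ s'' ∈ T, s ≠ s' → s'' ≠ s → s'' = s') :
    ∃ D dbl, IsAllocation {c, c + 2} E T D dbl := by
  classical
  have c1 : ∀ c : Fin 4, c + 1 ∉ ({c, c + 2} : Set (Fin 4)) := by
    simp only [Set.mem_insert_iff, Set.mem_singleton_iff]; decide
  have c2 : ∀ c : Fin 4, c + 3 ∉ ({c, c + 2} : Set (Fin 4)) := by
    simp only [Set.mem_insert_iff, Set.mem_singleton_iff]; decide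
  have c3 : ∀ c : Fin 4, c + 1 + 2 ∉ ({c, c + 2} : Set (Fin 4)) := by
    simp only [Set.mem_insert_iff, Set.mem_singleton_iff]; decide
  have c4 : ∀ c : Fin 4, c + 1 ≠ c + 3 := by decide
  by_cases e1 : ∃ s ∈ T, ∃ s' ∈ T, s ≠ s'
  · obtain ⟨s, hs, s', hs', hne⟩ := e1
    have hall : ∀ t ∈ T, t = s ∨ t = s' := fun t ht =>
      or_iff_not_imp_left.2 (h3 s hs s' hs' t ht hne)
    refine ⟨fun v => if v = s then c + 1 else c + 3, fun _ => False,
      ?_, fun _ _ h => h.elim, ?_, fun _ _ _ _ _ h => h.elim, ?_⟩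
    · intro t ht
      rcases hall t ht with rfl | rfl
      · rw [if_pos rfl]; exact c1 c
      · rw [if_neg hne.symm]; exact c2 c
    · intro t ht t' ht' htt'
      rcases hall t ht with rfl | rfl <;> rcases hall t' ht' with rfl | rfl <;>
        simp [hne.symm, c4, (c4 c).symm] at htt' ⊢
    · intro t ht _
      rcases hall t ht with rfl | rfl
      · exact h2 _ hs _ hs' hne
      · exact h2 _ hs' _ hs hne.symm
  · push Not at e1
    exact ⟨fun _ => c + 1, fun _ => True, fun _ _ => c1 c, fun _ _ _ => c3 c,
      fun a ha b hb hab => (hab (e1 a ha b hb)).elim,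
      fun a ha b hb hab => (hab (e1 a ha b hb)).elim, fun _ _ h => (h trivial).elim⟩

end Extend

/-! ### Representations of tree-like graphs -/

section Grow

variable {V : Type*} {G : SimpleGraph V} {e : V → V → Prop} {U : Set V}

/-- The vertex sets of the partial layouts: unions of blocks that are connected within each
component of the graph. A component is entered at a branching vertex whenever possible, as an
isolated nonbranching vertex uses up a direction that its block may need. -/
structure IsGrown (G : SimpleGraph V) (U : Set V) : Prop where
  conn : ∀ a ∈ U, ∀ b ∈ U, G.Reachable a b → ∃ p : G.Walk a b, ∀ u ∈ p.support, u ∈ U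
  closed : ∀ a ∈ U, ∀ b ∈ U, G.Adj a b → ∀ c, G.Adj c a → G.Adj c b → c ∈ U
  isolated : ∀ v ∈ U, (∀ a ∈ U, ¬ G.Adj v a) → ¬ Branching G v → ∀ b, G.Adj v b → ¬ Branching G b

lemma IsGrown.eq_of_adj (hU : IsGrown G U) (hT : TreeLike G) {s a b : V} (hs : s ∉ U) (ha : a ∈ U)
    (hb : b ∈ U) (hsa : G.Adj s a) (hsb : G.Adj s b) : a = b := by
  by_contra hab
  obtain ⟨p, hp⟩ := hU.conn a ha b hb (hsa.symm.reachable.trans hsb.reachable)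
  exact hs (hU.closed a ha b hb (hT.adj_of_mem_side hsa hsb hab ⟨p, fun h => hs (hp s h)⟩) s
    hsa hsb)

lemma Layout.pt_eq_add {L : Layout V} {v : V} {r r₀ : ℝ} :
    L.pt v r = L.pt v r₀ + (r - r₀) • dirVec (L.dir v) ∧
      L.pt v r = L.pt v r₀ + (r₀ - r) • dirVec (L.dir v + 2) := by
  rw [dirVec_add_two, smul_neg, ← neg_smul, neg_sub]
  simp only [Layout.pt, sub_smul]
  constructor <;> abel

lemma IsGrown.insert_isolated (hU : IsGrown G U) {y : V} (hn : ∀ a ∈ U, ∀ b ∉ U, ¬ G.Adj a b)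
    (hy : y ∉ U) (hyb : ¬ Branching G y → ∀ b, G.Adj y b → ¬ Branching G b) :
    IsGrown G (insert y U) := by
  have hr : ∀ a ∈ U, ∀ b ∉ U, ¬ G.Reachable a b := by
    rintro a ha b hb ⟨p⟩
    induction p with
    | nil => exact hb ha
    | @cons u v w h p ih =>
      by_cases hv : v ∈ U
      · exact ih hv hb
      · exact hn u ha v hv h
  refine ⟨?_, ?_, ?_⟩
  · rintro a (rfl | ha) b (rfl | hb) hab
    · exact ⟨.nil, by simp⟩
    · exact (hr b hb a hy hab.symm).elim
    · exact (hr a ha b hy hab).elim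
    · obtain ⟨p, hp⟩ := hU.conn a ha b hb hab
      exact ⟨p, fun u hu => .inr (hp u hu)⟩
  · rintro a (rfl | ha) b (rfl | hb) hab c hca hcb
    · exact (G.irrefl hab).elim
    · exact (hn b hb a hy hab.symm).elim
    · exact (hn a ha b hy hab).elim
    · exact .inr (hU.closed a ha b hb hab c hca hcb)
  · rintro v (rfl | hv) hiso hbr
    · exact hyb hbr
    · exact hU.isolated v hv (fun a ha => hiso a (.inr ha)) hbr

lemma IsGrown.union_block (hU : IsGrown G U) (hT : TreeLike G) {x y : V} (hx : x ∈ U) (hy : y ∉ U)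
    (hxy : G.Adj x y) : IsGrown G (U ∪ {s | G.Adj s x ∧ (s = y ∨ G.Adj s y)}) := by
  set S := {s | G.Adj s x ∧ (s = y ∨ G.Adj s y)} with hS
  have hSU : ∀ s ∈ S, s ∉ U := by
    rintro s ⟨hsx, rfl | hsy⟩ hsU
    · exact hy hsU
    · exact hy (hU.closed s hsU x hx hsx y hsy.symm hxy.symm)
  have hSn : ∀ s ∈ S, ∀ u ∈ U, G.Adj s u → u = x := fun s hs u hu hsu =>
    hU.eq_of_adj hT (hSU s hs) hu hx hsu hs.1
  -- a common neighbour of `x` and a vertex of `S` belongs to `S`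
  have hxS : ∀ b ∈ S, ∀ c, G.Adj c x → G.Adj c b → c ∈ S := by
    rintro b ⟨hbx, hb⟩ c hcx hcb
    refine ⟨hcx, ?_⟩
    rcases hb with rfl | hby
    · exact .inr hcb
    · by_cases hcy : c = y
      · exact .inl hcy
      · exact .inr (hT.adj_of_adj_edge hcy hcx.symm hxy hcb.symm hby hbx.symm.ne)
  refine ⟨?_, ?_, ?_⟩
  · have hto : ∀ a ∈ U ∪ S, ∃ a' ∈ U, ∃ p : G.Walk a a', ∀ u ∈ p.support, u ∈ U ∪ S := by
      rintro a (ha | ha)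
      · exact ⟨a, ha, .nil, by simp [ha]⟩
      · refine ⟨x, hx, .cons ha.1 .nil, ?_⟩
        intro u hu
        simp only [SimpleGraph.Walk.support_cons, SimpleGraph.Walk.support_nil, List.mem_cons,
          List.not_mem_nil, or_false] at hu
        rcases hu with rfl | rfl
        exacts [.inr ha, .inl hx]
    intro a ha b hb hab
    obtain ⟨a', ha', p, hp⟩ := hto a ha
    obtain ⟨b', hb', q, hq⟩ := hto b hb
    obtain ⟨m, hm⟩ := hU.conn a' ha' b' hb' (p.reachable.symm.trans (hab.trans q.reachable))
    refine ⟨(p.append m).append q.reverse, fun u hu => ?_⟩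
    simp only [SimpleGraph.Walk.mem_support_append_iff, SimpleGraph.Walk.support_reverse,
      List.mem_reverse] at hu
    rcases hu with (hu | hu) | hu
    exacts [hp u hu, .inl (hm u hu), hq u hu]
  · rintro a (ha | ha) b (hb | hb) hab c hca hcb
    · exact .inl (hU.closed a ha b hb hab c hca hcb)
    · obtain rfl := hSn b hb a ha hab.symm
      exact .inr (hxS b hb c hca hcb)
    · obtain rfl := hSn a ha b hb hab
      exact .inr (hxS a ha c hcb hca)
    · by_cases hcx : c = x
      · exact .inl (hcx ▸ hx)
      · exact .inr (hxS a ha c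
          (hT.adj_of_adj_edge hcx hca.symm ha.1 hcb.symm hb.1 hab.ne) hca)
  · rintro v (hv | hv) hiso hbr
    · exact hU.isolated v hv (fun a ha => hiso a (.inl ha)) hbr
    · exact (hiso x (.inl hx) hv.1).elim

/-- The directions needed by the vertices of a new block are available at the point of `x` where
the block is attached: at an end of the path of `x` if `e x y` holds, and inside it otherwise. -/
lemma Layout.Valid.union_block [Finite V] (hT : TreeLike G) (he : Admissible G e)
    (hU : IsGrown G U) {L : Layout V} (hL : L.Valid G e U) {x y : V} (hx : x ∈ U) (hy : y ∉ U)
    (hxy : G.Adj x y) :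
    ∃ L' : Layout V, L'.Valid G e (U ∪ {s | G.Adj s x ∧ (s = y ∨ G.Adj s y)}) := by
  set S := {s | G.Adj s x ∧ (s = y ∨ G.Adj s y)} with hS
  have hyS : y ∈ S := ⟨hxy.symm, .inl rfl⟩
  have hSx : ∀ s ∈ S, G.Adj s x := fun s hs => hs.1
  have hSU : ∀ s ∈ S, s ∉ U := by
    rintro s ⟨hsx, rfl | hsy⟩ hsU
    · exact hy hsU
    · exact hy (hU.closed s hsU x hx hsx y hsy.symm hxy.symm)
  have hSn : ∀ s ∈ S, ∀ u ∈ U, G.Adj s u → u = x := fun s hs u hu hsu =>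
    hU.eq_of_adj hT (hSU s hs) hu hx hsu hs.1
  have hSc : G.IsClique S := by
    rintro s ⟨hsx, hs⟩ s' ⟨hsx', hs'⟩ hne
    rcases hs with rfl | hs
    · rcases hs' with rfl | hs'
      · exact (hne rfl).elim
      · exact hs'.symm
    · rcases hs' with rfl | hs'
      · exact hs
      · exact hT.adj_of_adj_edge hne hsx.symm hsx'.symm hs.symm hs'.symm hxy.ne
  have hSe : ∀ s ∈ S, e x s → e x y := by
    intro s hs hes
    by_cases hsy : s = y
    · exact hsy ▸ hes
    · exact he.block x s y hs.1.symm hxy (hSc hs hyS hsy) hes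
  have hSe' : ∀ s ∈ S, e x y → e x s := by
    intro s hs hey
    by_cases hsy : s = y
    · exact hsy ▸ hey
    · exact he.block x y s hxy hs.1.symm (hSc hyS hs (Ne.symm hsy)) hey
  have hxr : Branching G x ∨ ∀ a ∈ U, ¬ G.Adj x a := by
    by_cases h : ∀ a ∈ U, ¬ G.Adj x a
    · exact .inr h
    · push Not at h
      obtain ⟨a, ha, hxa⟩ := h
      refine .inl ⟨a, y, hxa, hxy, fun h => hy (h ▸ ha), fun h => ?_⟩
      exact hxa.ne (hU.eq_of_adj hT hy hx ha hxy.symm h.symm)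
  have hTx : ∀ s ∈ {s | s ∈ S ∧ Branching G s}, Branching G x := by
    rintro s ⟨hs, hb⟩
    by_contra hxb
    exact hU.isolated x hx (hxr.resolve_left hxb) hxb s hs.1.symm hb
  obtain ⟨hlen, ⟨r, hr, hfr⟩, hnone, hone⟩ := hL.rich x hx hxr
  -- the conditions on cliques of branching vertices
  have t2 : ∀ s ∈ {s | s ∈ S ∧ Branching G s}, ∀ s' ∈ {s | s ∈ S ∧ Branching G s}, s ≠ s' →
      e s x ∨ e s' x := by
    rintro s hs s' hs' hne
    have hss := hSc hs.1 hs'.1 hne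
    refine (he.three s s' x hss hs.1.1 hs'.1.1 hs.2 hs'.2 (hTx s hs)).imp ?_ ?_
    · exact he.block s s' x hss hs.1.1 hs'.1.1
    · exact he.block s' s x hss.symm hs'.1.1 hs.1.1
  have t2' : ∀ s ∈ {s | s ∈ S ∧ Branching G s}, ∀ s' ∈ {s | s ∈ S ∧ Branching G s}, s ≠ s' →
      e x s ∨ e s x := fun s hs s' hs' hne =>
    he.three x s s' hs.1.1.symm hs'.1.1.symm (hSc hs.1 hs'.1 hne) (hTx s hs) hs.2 hs'.2
  have t3 : ∀ s ∈ {s | s ∈ S ∧ Branching G s}, ∀ s' ∈ {s | s ∈ S ∧ Branching G s},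
      ∀ s'' ∈ {s | s ∈ S ∧ Branching G s}, s ≠ s' → s ≠ s'' → s' ≠ s'' → e s x ∧ e x s := by
    intro s hs s' hs' s'' hs'' n1 n2 n3
    have a1 := hSc hs.1 hs'.1 n1
    have a2 := hSc hs.1 hs''.1 n2
    have a3 := hSc hs'.1 hs''.1 n3
    have b1 := hs.1.1
    have b2 := hs'.1.1
    have b3 := hs''.1.1
    have hbx := hTx s hs
    constructor
    · refine he.four ![s, x, s', s''] ?_ ?_
      · intro i j hij
        fin_cases i <;> fin_cases j <;>
          first | exact (hij rfl).elim | exact a1 | exact a1.symm | exact a2 | exact a2.symm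
                | exact a3 | exact a3.symm | exact b1 | exact b1.symm | exact b2 | exact b2.symm
                | exact b3 | exact b3.symm
      · intro i
        fin_cases i
        exacts [hs.2, hbx, hs'.2, hs''.2]
    · refine he.four ![x, s, s', s''] ?_ ?_
      · intro i j hij
        fin_cases i <;> fin_cases j <;>
          first | exact (hij rfl).elim | exact a1 | exact a1.symm | exact a2 | exact a2.symm
                | exact a3 | exact a3.symm | exact b1 | exact b1.symm | exact b2 | exact b2.symm
                | exact b3 | exact b3.symm
      · intro i
        fin_cases i
        exacts [hbx, hs.2, hs'.2, hs''.2]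
  have t4 : ∀ s ∈ {s | s ∈ S ∧ Branching G s}, ∀ s' ∈ {s | s ∈ S ∧ Branching G s},
      ∀ s'' ∈ {s | s ∈ S ∧ Branching G s}, ∀ t ∈ {s | s ∈ S ∧ Branching G s}, s ≠ s' → s ≠ s'' →
      s' ≠ s'' → t ≠ s → t ≠ s' → t = s'' := by
    intro s hs s' hs' s'' hs'' t ht n1 n2 n3 n4 n5
    by_contra n6
    have a1 := hSc hs.1 hs'.1 n1
    have a2 := hSc hs.1 hs''.1 n2
    have a3 := hSc hs'.1 hs''.1 n3
    have a4 := hSc ht.1 hs.1 n4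
    have a5 := hSc ht.1 hs'.1 n5
    have a6 := hSc ht.1 hs''.1 n6
    have b1 := hs.1.1
    have b2 := hs'.1.1
    have b3 := hs''.1.1
    have b4 := ht.1.1
    refine he.five ![x, s, s', s'', t] ?_ ?_
    · intro i j hij
      fin_cases i <;> fin_cases j <;>
        first | exact (hij rfl).elim | exact a1 | exact a1.symm | exact a2 | exact a2.symm
              | exact a3 | exact a3.symm | exact b1 | exact b1.symm | exact b2 | exact b2.symm
              | exact b3 | exact b3.symm | exact b4 | exact b4.symm | exact a4 | exact a4.symm
              | exact a5 | exact a5.symm | exact a6 | exact a6.symm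
    · intro i
      fin_cases i
      exacts [hTx s hs, hs.2, hs'.2, hs''.2, ht.2]
  by_cases hexy : e x y
  · have hUy : ∀ a ∈ U, G.Adj x a → a ≠ y ∧ ¬ G.Adj a y := fun a ha hxa =>
      ⟨fun h => hy (h ▸ ha), fun h => hxa.ne (hU.eq_of_adj hT hy hx ha hxy.symm h.symm)⟩
    have hends := hone fun a ha b hb hxa hxb ea eb hab =>
      (he.two x a b y hxa hxb hxy ea eb hexy hab (hUy a ha hxa).1 (hUy b hb hxb).1).resolve_right
        fun h => h.elim (hUy a ha hxa).2 (hUy b hb hxb).2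
    have hx3 : ¬ ∀ a ∈ U ∪ S, G.Adj x a → ¬ e x a := fun h => h y (.inr hyS) hxy hexy
    have hx4 : (∀ a ∈ U ∪ S, ∀ b ∈ U ∪ S, G.Adj x a → G.Adj x b → e x a → e x b → a ≠ b →
        G.Adj a b) → L.Free U x 0 ∧ L.Free U x (L.len x) := by
      intro h
      refine hnone fun a ha hxa hea => ?_
      exact (hUy a ha hxa).2 (h a (.inl ha) y (.inr hyS) hxa hxy hea hexy (hUy a ha hxa).1)
    have halloc := fun c => exists_isAllocation_end c (E := fun s => e s x)
      (T := {s | s ∈ S ∧ Branching G s}) t2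
      (fun s hs s' hs' s'' hs'' n1 n2 n3 => (t3 s hs s' hs' s'' hs'' n1 n2 n3).1) t4
    rcases hends with hf | hf
    · obtain ⟨D, dbl, hA⟩ := halloc (L.dir x + 2)
      refine hL.attach hx hSU hSx hSc hSn (r₀ := 0) ⟨le_rfl, hlen.le⟩ hlen hf ?_ hA
        (fun h => (hx3 h).elim) (fun h => .inr ⟨hlen.ne, (hx4 h).2⟩)
      rintro _ ⟨r, hr, rfl⟩
      refine ⟨_, rfl, r - 0, by linarith [hr.1], ?_⟩
      have : ∀ d : Fin 4, d + 2 + 2 = d := by decide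
      rw [this]
      exact Layout.pt_eq_add.1
    · obtain ⟨D, dbl, hA⟩ := halloc (L.dir x)
      refine hL.attach hx hSU hSx hSc hSn (r₀ := L.len x) ⟨hlen.le, le_rfl⟩ hlen hf ?_ hA
        (fun h => (hx3 h).elim) (fun h => .inl ⟨hlen.ne', (hx4 h).1⟩)
      rintro _ ⟨r, hr, rfl⟩
      exact ⟨_, rfl, L.len x - r, by linarith [hr.2], Layout.pt_eq_add.2⟩
  · obtain ⟨D, dbl, hA⟩ := exists_isAllocation_inner (L.dir x) (E := fun s => e s x)
      (T := {s | s ∈ S ∧ Branching G s})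
      (fun s hs s' hs' hne => (t2' s hs s' hs' hne).resolve_left fun h => hexy (hSe s hs.1 h))
      (fun s hs s' hs' s'' hs'' hne hne' => by
        by_contra hne''
        exact hexy (hSe s hs.1 (t3 s hs s' hs' s'' hs'' hne hne'.symm (Ne.symm hne'')).2))
    refine hL.attach hx hSU hSx hSc hSn (r₀ := r) ⟨hr.1.le, hr.2.le⟩ hlen hfr ?_ hA
      (fun h => ?_) (fun h => ?_)
    · rintro _ ⟨t, ht, rfl⟩
      rcases le_total r t with h | h
      · exact ⟨L.dir x, by simp, t - r, by linarith, Layout.pt_eq_add.1⟩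
      · exact ⟨L.dir x + 2, by simp, r - t, by linarith, Layout.pt_eq_add.2⟩
    · exact ⟨hr.1.ne', hr.2.ne, hnone fun a ha => h a (.inl ha)⟩
    · exact (hone fun a ha b hb => h a (.inl ha) b (.inl hb)).imp (fun h => ⟨hr.1.ne', h⟩)
        fun h => ⟨hr.2.ne, h⟩

/-- A maximal grown vertex set with a valid layout contains every vertex: it can be extended by the
rest of a block that it meets, or else by a vertex of a new component. -/
lemma exists_valid_layout [Finite V] (hT : TreeLike G) (he : Admissible G e) :
    ∃ L : Layout V, L.Valid G e Set.univ := by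
  obtain ⟨U, hU⟩ := (Set.toFinite {U : Set V | IsGrown G U ∧
    ∃ L : Layout V, L.Valid G e U}).exists_maximal ⟨∅, ⟨by simp, by simp, by simp⟩,
      ⟨fun _ => 0, fun _ => 0, fun _ => 0⟩, by simp, by simp, by simp⟩
  obtain ⟨⟨hg, L, hL⟩, hmax⟩ := hU
  by_cases huniv : U = Set.univ
  · exact ⟨L, huniv ▸ hL⟩
  by_cases h : ∃ x ∈ U, ∃ y ∉ U, G.Adj x y
  · obtain ⟨x, hx, y, hy, hxy⟩ := h
    have := hmax ⟨hg.union_block hT hx hy hxy, hL.union_block hT he hg hx hy hxy⟩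
      Set.subset_union_left
    exact (hy (this (.inr ⟨hxy.symm, .inl rfl⟩))).elim
  · push Not at h
    obtain ⟨y₀, hy₀⟩ := (Set.ne_univ_iff_exists_notMem U).1 huniv
    obtain ⟨y, hy, hyb⟩ : ∃ y ∉ U, ¬ Branching G y → ∀ b, G.Adj y b → ¬ Branching G b := by
      by_cases hb : ∃ b, G.Adj y₀ b ∧ Branching G b
      · obtain ⟨b, hyb, hb⟩ := hb
        exact ⟨b, fun hbU => h b hbU y₀ hy₀ hyb.symm, fun h => (h hb).elim⟩
      · push Not at hb
        exact ⟨y₀, hy₀, fun _ => hb⟩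
    have := hmax ⟨hg.insert_isolated h hy hyb,
      hL.insert_isolated hy fun a ha hya => h a ha y hy hya.symm⟩ (Set.subset_insert y U)
    exact (hy (this (Set.mem_insert _ _))).elim

lemma dirVec_zero : dirVec 0 = (1, 0) := rfl

lemma dirVec_one : dirVec 1 = (0, 1) := rfl

lemma dirVec_two : dirVec 2 = (-1, 0) := rfl

lemma dirVec_three : dirVec 3 = (0, -1) := rfl

/-- A segment as a degenerate box. -/
lemma image_Icc_eq_Icc (b : ℝ × ℝ) (d : Fin 4) {l : ℝ} (h : 0 ≤ l) : ∃ lo hi : ℝ × ℝ, lo ≤ hi ∧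
    (lo.1 = hi.1 ∨ lo.2 = hi.2) ∧
    (fun r : ℝ => b + r • dirVec d) '' Set.Icc 0 l = Set.Icc lo hi := by
  obtain ⟨b1, b2⟩ := b
  have key : ∀ (w : ℝ × ℝ) (p q r : ℝ), (b1, b2) + r • w = (p, q) ↔
      b1 + r * w.1 = p ∧ b2 + r * w.2 = q := by
    intro w p q r
    simp [Prod.ext_iff]
  have hd : ∀ d : Fin 4, d = 0 ∨ d = 1 ∨ d = 2 ∨ d = 3 := by decide
  rcases hd d with hd | hd | hd | hd <;> rw [hd]
  · refine ⟨(b1, b2), (b1 + l, b2), ⟨by linarith, le_rfl⟩, .inr rfl, ?_⟩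
    ext ⟨p, q⟩
    simp only [Set.mem_image, key, Set.mem_Icc, Prod.mk_le_mk, dirVec_zero, mul_one,
      mul_zero, add_zero]
    constructor
    · rintro ⟨r, hr, h1, h2⟩
      refine ⟨⟨?_, ?_⟩, ?_, ?_⟩ <;> linarith
    · rintro ⟨⟨h1, h2⟩, h3, h4⟩
      exact ⟨p - b1, ⟨by linarith, by linarith⟩, by linarith, by linarith⟩
  · refine ⟨(b1, b2), (b1, b2 + l), ⟨le_rfl, by linarith⟩, .inl rfl, ?_⟩
    ext ⟨p, q⟩
    simp only [Set.mem_image, key, Set.mem_Icc, Prod.mk_le_mk, dirVec_one, mul_one,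
      mul_zero, add_zero]
    constructor
    · rintro ⟨r, hr, h1, h2⟩
      refine ⟨⟨?_, ?_⟩, ?_, ?_⟩ <;> linarith
    · rintro ⟨⟨h1, h2⟩, h3, h4⟩
      exact ⟨q - b2, ⟨by linarith, by linarith⟩, by linarith, by linarith⟩
  · refine ⟨(b1 - l, b2), (b1, b2), ⟨by linarith, le_rfl⟩, .inr rfl, ?_⟩
    ext ⟨p, q⟩
    simp only [Set.mem_image, key, Set.mem_Icc, Prod.mk_le_mk,
      dirVec_two, mul_one, mul_zero, add_zero, mul_neg]
    constructor
    · rintro ⟨r, hr, h1, h2⟩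
      refine ⟨⟨?_, ?_⟩, ?_, ?_⟩ <;> linarith
    · rintro ⟨⟨h1, h2⟩, h3, h4⟩
      exact ⟨b1 - p, ⟨by linarith, by linarith⟩, by linarith, by linarith⟩
  · refine ⟨(b1, b2 - l), (b1, b2), ⟨le_rfl, by linarith⟩, .inl rfl, ?_⟩
    ext ⟨p, q⟩
    simp only [Set.mem_image, key, Set.mem_Icc, Prod.mk_le_mk,
      dirVec_three, mul_one, mul_zero, add_zero, mul_neg]
    constructor
    · rintro ⟨r, hr, h1, h2⟩
      refine ⟨⟨?_, ?_⟩, ?_, ?_⟩ <;> linarith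
    · rintro ⟨⟨h1, h2⟩, h3, h4⟩
      exact ⟨b2 - q, ⟨by linarith, by linarith⟩, by linarith, by linarith⟩

lemma Icc_inter_Icc_nonempty_iff {α : Type*} [Lattice α] {a b c d : α} (hab : a ≤ b)
    (hcd : c ≤ d) : (Set.Icc a b ∩ Set.Icc c d).Nonempty ↔ a ≤ d ∧ c ≤ b := by
  rw [Set.Icc_inter_Icc, Set.nonempty_Icc, sup_le_iff, le_inf_iff, le_inf_iff]
  tauto

/-- Whether two degenerate boxes meet depends only on the order of their coordinates, so that the
real coordinates may be replaced by their ranks. -/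
lemma isB0VPG_of_layout [Finite V] {L : Layout V} (hL : L.Valid G e Set.univ) : IsB0VPG G := by
  classical
  have := Fintype.ofFinite V
  rw [isB0VPG_iff]
  choose lo hi hle hax hpath using
    fun v => image_Icc_eq_Icc (L.base v) (L.dir v) (hL.len_nonneg v trivial)
  replace hpath : ∀ v, L.path v = Set.Icc (lo v) (hi v) := hpath
  let C : Finset ℝ := Finset.univ.biUnion fun v =>
    {(lo v).1, (lo v).2, (hi v).1, (hi v).2}
  let ρ : ℝ → ℤ := fun t => (C.filter (· < t)).card
  have hmono : ∀ a b, a ≤ b → ρ a ≤ ρ b := by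
    intro a b hab
    refine Int.ofNat_le.2 (Finset.card_le_card fun c hc => ?_)
    rw [Finset.mem_filter] at hc ⊢
    exact ⟨hc.1, hc.2.trans_le hab⟩
  have hρ : ∀ a, ∀ b ∈ C, ρ a ≤ ρ b ↔ a ≤ b := by
    intro a b hb
    refine ⟨fun h => ?_, hmono a b⟩
    by_contra! hlt
    refine absurd h (not_le.2 (Int.ofNat_lt.2 (Finset.card_lt_card ?_)))
    refine (Finset.ssubset_iff_of_subset fun c hc => ?_).2
      ⟨b, Finset.mem_filter.2 ⟨hb, hlt⟩, by simp⟩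
    rw [Finset.mem_filter] at hc ⊢
    exact ⟨hc.1, hc.2.trans hlt⟩
  have hC1 : ∀ v, (hi v).1 ∈ C := fun v =>
    Finset.mem_biUnion.2 ⟨v, Finset.mem_univ _, by simp⟩
  have hC2 : ∀ v, (hi v).2 ∈ C := fun v =>
    Finset.mem_biUnion.2 ⟨v, Finset.mem_univ _, by simp⟩
  let R : ℝ × ℝ → ℤ × ℤ := fun p => (ρ p.1, ρ p.2)
  have hR : ∀ u v, R (lo u) ≤ R (hi v) ↔ lo u ≤ hi v := by
    intro u v
    rw [Prod.le_def, Prod.le_def]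
    exact and_congr (hρ _ _ (hC1 v)) (hρ _ _ (hC2 v))
  have hRle : ∀ v, R (lo v) ≤ R (hi v) := fun v => (hR v v).2 (hle v)
  refine ⟨fun v => Set.Icc (R (lo v)) (R (hi v)), fun v => ⟨_, _, hRle v, ?_, rfl⟩,
    fun u v huv => ?_⟩
  · exact (hax v).imp (congrArg ρ) (congrArg ρ)
  · rw [hL.adj_iff u trivial v trivial huv, hpath, hpath,
      Icc_inter_Icc_nonempty_iff (hle u) (hle v), Icc_inter_Icc_nonempty_iff (hRle u) (hRle v),
      hR, hR]

lemma TreeLike.isB0VPG [Finite V] (hT : TreeLike G) (he : Admissible G e) : IsB0VPG G := by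
  obtain ⟨L, hL⟩ := exists_valid_layout hT he
  exact isB0VPG_of_layout hL

end Grow

lemma FamilyF.isMinimalNonB0VPG {W : Type} {F : SimpleGraph W} (hF : FamilyF F) :
    IsMinimalNonB0VPG F := by
  obtain ⟨hfin, hT, -⟩ := hF.finite_treeLike_connected
  refine ⟨hF.not_isB0VPG, fun S hS => ?_⟩
  obtain ⟨w, hw⟩ := (Set.ne_univ_iff_exists_notMem S).1 hS
  obtain ⟨e, he⟩ := hF.exists_admissible w
  have hT' : TreeLike (F.deleteIncidenceSet w) := by
    intro v a b ha hb hab hn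
    rw [SimpleGraph.deleteIncidenceSet_adj] at ha hb hn
    obtain ⟨X, haX, hbX, hvX, hX⟩ := hT v a b ha.1 hb.1 hab fun h => hn ⟨h, ha.2.2, hb.2.2⟩
    exact ⟨X, haX, hbX, hvX, fun p hp q hpq =>
      hX p hp q (SimpleGraph.deleteIncidenceSet_adj.1 hpq).1⟩
  refine (hT'.isB0VPG he).of_embedding (F := F.induce S) ⟨Function.Embedding.subtype _, ?_⟩
  intro a b
  have ha : (a : W) ≠ w := fun h => hw (h ▸ a.2)
  have hb : (b : W) ≠ w := fun h => hw (h ▸ b.2)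
  simp [SimpleGraph.deleteIncidenceSet_adj, ha, hb]

/-! ### Members of the family from binary trees -/

/-- The disjoint union of `K` and `A` with all edges between `C` and `D` added. -/
def plug {W U : Type*} (K : SimpleGraph W) (C : Set W) (A : SimpleGraph U) (D : Set U) :
    SimpleGraph (W ⊕ U) where
  Adj a b := match a, b with
    | .inl a, .inl b => K.Adj a b
    | .inr a, .inr b => A.Adj a b
    | .inl a, .inr b => a ∈ C ∧ b ∈ D
    | .inr a, .inl b => b ∈ C ∧ a ∈ D
  symm := ⟨by
    rintro (a | a) (b | b) h
    exacts [h.symm, h, h, h.symm]⟩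
  loopless := ⟨by
    rintro (a | a) h
    exacts [K.irrefl h, A.irrefl h]⟩

section Plug

variable {W U P X Y : Type*} {K : SimpleGraph W} {C : Set W} {A : SimpleGraph U} {D : Set U}

@[simp] lemma plug_adj_inl_inl {a b : W} : (plug K C A D).Adj (.inl a) (.inl b) ↔ K.Adj a b :=
  .rfl

@[simp] lemma plug_adj_inr_inr {a b : U} : (plug K C A D).Adj (.inr a) (.inr b) ↔ A.Adj a b :=
  .rfl

@[simp] lemma plug_adj_inl_inr {a : W} {b : U} :
    (plug K C A D).Adj (.inl a) (.inr b) ↔ a ∈ C ∧ b ∈ D := .rfl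

@[simp] lemma plug_adj_inr_inl {a : W} {b : U} :
    (plug K C A D).Adj (.inr b) (.inl a) ↔ a ∈ C ∧ b ∈ D := .rfl

/-- Plugging is associative. -/
def plugAssoc (K : SimpleGraph W) (C : Set W) (Q : SimpleGraph P) (E : Set P) (C' : Set P)
    (A : SimpleGraph U) (D : Set U) :
    plug K C (plug Q C' A D) (Sum.inl '' E) ≃g plug (plug K C Q E) (Sum.inr '' C') A D where
  toEquiv := (Equiv.sumAssoc W P U).symm
  map_rel_iff' := by
    rintro (a | a | a) (b | b | b) <;> simp

/-- Two graphs plugged into the same graph may be exchanged. -/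
def plugComm (Q : SimpleGraph X) (C C' : Set X) (A : SimpleGraph U) (D : Set U)
    (A' : SimpleGraph Y) (D' : Set Y) :
    plug (plug Q C A D) (Sum.inl '' C') A' D' ≃g plug (plug Q C' A' D') (Sum.inl '' C) A D where
  toFun a := match a with
    | .inl (.inl x) => .inl (.inl x)
    | .inl (.inr u) => .inr u
    | .inr y => .inl (.inr y)
  invFun a := match a with
    | .inl (.inl x) => .inl (.inl x)
    | .inl (.inr u) => .inr u
    | .inr y => .inl (.inr y)
  left_inv := by rintro ((a | a) | a) <;> rfl
  right_inv := by rintro ((a | a) | a) <;> rfl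
  map_rel_iff' := by
    rintro ((a | a) | a) ((b | b) | b) <;> simp

/-- Plugging into isomorphic graphs. -/
def plugCongr {K' : SimpleGraph X} {C' : Set X} (f : K ≃g K') (hf : ∀ a, f a ∈ C' ↔ a ∈ C)
    (A : SimpleGraph U) (D : Set U) : plug K C A D ≃g plug K' C' A D where
  toEquiv := f.toEquiv.sumCongr (Equiv.refl U)
  map_rel_iff' := by
    rintro (a | a) (b | b) <;> simp [hf, f.map_adj_iff]

end Plug

/-- The path on three vertices whose end `0` is attached to the two subtrees of a node, whose
middle vertex `1` completes a triangle, and whose end `2` is pendant. -/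
def stem : SimpleGraph (Fin 3) where
  Adj i j := (i = 0 ∧ j = 1) ∨ (i = 1 ∧ j = 0) ∨ (i = 1 ∧ j = 2) ∨ (i = 2 ∧ j = 1)
  symm := ⟨by decide⟩
  loopless := ⟨by decide⟩

/-- Binary trees. A node stands for a vertex `x` that results from a contraction, a leaf for a thin
spider of size 3. -/
inductive SpiderTree where
  | leaf
  | node (l r : SpiderTree)

namespace SpiderTree

/-- The vertices of the graph of a tree. -/
def Vert : SpiderTree → Type
  | leaf => Fin 3 ⊕ Fin 3
  | node l r => (Fin 3 ⊕ l.Vert) ⊕ r.Vert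

/-- The vertices by which the graph of a tree is attached to the rest of a graph. -/
def top : (T : SpiderTree) → Set T.Vert
  | leaf => Set.range (Sum.inl : Fin 3 → Fin 3 ⊕ Fin 3)
  | node l r => (Sum.inl '' (Sum.inl '' {0, 1}) : Set ((Fin 3 ⊕ l.Vert) ⊕ r.Vert))

/-- The graph of a tree: a leaf is a thin spider, and in a node the graphs of the two subtrees are
attached to the same vertex of a stem. -/
def graph : (T : SpiderTree) → SimpleGraph T.Vert
  | leaf => thinSpider 3
  | node l r => plug (plug stem {0} l.graph l.top) (Sum.inl '' {0}) r.graph r.top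

instance finite_vert : (T : SpiderTree) → Finite T.Vert
  | leaf => inferInstanceAs (Finite (Fin 3 ⊕ Fin 3))
  | node l r =>
    have := finite_vert l
    have := finite_vert r
    inferInstanceAs (Finite ((Fin 3 ⊕ l.Vert) ⊕ r.Vert))

lemma exists_card (n : ℕ) : ∃ T : SpiderTree, n < Nat.card T.Vert := by
  induction n with
  | zero => exact ⟨leaf, by simp [Vert]⟩
  | succ n ih =>
    obtain ⟨T, hT⟩ := ih
    refine ⟨node T leaf, ?_⟩
    have h : Nat.card (node T leaf).Vert = 3 + Nat.card T.Vert + Nat.card leaf.Vert := by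
      simp only [Vert, Nat.card_sum, Nat.card_fin]
    omega

end SpiderTree

lemma FamilyF.of_iso {V W : Type} {F : SimpleGraph V} {F' : SimpleGraph W} (hF : FamilyF F)
    (f : F' ≃g F) : FamilyF F' := by
  cases hF with
  | base h =>
    obtain ⟨g⟩ := h
    exact .base ⟨f.trans g⟩
  | step hG h =>
    obtain ⟨H, v₁, v₂, B₁, B₂, hH, hcard, h1, h2, h12, ht1, ht2, hB1, hm1, hB2, hm2, ⟨g⟩⟩ := h
    exact .step hG ⟨H, v₁, v₂, B₁, B₂, hH, hcard, h1, h2, h12, ht1, ht2, hB1, hm1, hB2, hm2,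
      ⟨f.trans g⟩⟩

section Step

variable {W : Type} {K : SimpleGraph W} {C : Set W}

/-- The effect of a contraction of two clique vertices of a plugged spider. -/
lemma nonempty_iso_spiderReplace (K : SimpleGraph W) (C : Set W) :
    Nonempty (plug (plug (plug K C stem {0, 1}) (Sum.inr '' {0}) (thinSpider 3) (Set.range Sum.inl))
      (Sum.inl '' (Sum.inr '' {0})) (thinSpider 3) (Set.range Sum.inl) ≃g
      spiderReplace (plug K C (thinSpider 3) (Set.range Sum.inl)) (.inr (.inl 1)) (.inr (.inl 2))
        {.inr (.inl 1), .inr (.inr 1)} {.inr (.inl 2), .inr (.inr 2)}) := by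
  set B : Set (W ⊕ (Fin 3 ⊕ Fin 3)) :=
    {.inr (.inl 1), .inr (.inr 1)} ∪ {.inr (.inl 2), .inr (.inr 2)} with hB
  have hw : ∀ w, Sum.inl w ∉ B := by simp [hB]
  have h0 : Sum.inr (Sum.inl 0) ∉ B := by simp [hB]
  have h0' : Sum.inr (Sum.inr 0) ∉ B := by simp [hB]
  let f : ((W ⊕ Fin 3) ⊕ (Fin 3 ⊕ Fin 3)) ⊕ (Fin 3 ⊕ Fin 3) ≃ ReplaceVertex B :=
    { toFun := fun a => match a with
        | .inl (.inl (.inl w)) => .old (.inl w) (hw w)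
        | .inl (.inl (.inr 0)) => .x
        | .inl (.inl (.inr 1)) => .old (.inr (.inl 0)) h0
        | .inl (.inl (.inr 2)) => .old (.inr (.inr 0)) h0'
        | .inl (.inr a) => .spider 0 a
        | .inr a => .spider 1 a
      invFun := fun a => match a with
        | .old (.inl w) _ => .inl (.inl (.inl w))
        | .old (.inr (.inl _)) _ => .inl (.inl (.inr 1))
        | .old (.inr (.inr _)) _ => .inl (.inl (.inr 2))
        | .x => .inl (.inl (.inr 0))
        | .spider 0 a => .inl (.inr a)
        | .spider 1 a => .inr a
      left_inv := by
        rintro (((a | a) | a) | a)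
        · rfl
        · fin_cases a <;> rfl
        · rfl
        · rfl
      right_inv := by
        rintro (⟨w | a | a, hu⟩ | _ | ⟨i, a⟩)
        · rfl
        · fin_cases a
          · rfl
          · exact (hu (by simp [hB])).elim
          · exact (hu (by simp [hB])).elim
        · fin_cases a
          · rfl
          · exact (hu (by simp [hB])).elim
          · exact (hu (by simp [hB])).elim
        · rfl
        · fin_cases i <;> rfl }
  refine ⟨⟨f, ?_⟩⟩
  have h3 : ∀ i : Fin 3, i = 0 ∨ i = 1 ∨ i = 2 := by decide
  rintro (((a | a) | a) | a) (((b | b) | b) | b)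
  · exact .rfl
  · rcases h3 b with rfl | rfl | rfl <;> simp [f, spiderReplace, stem, thinSpider]
  · simp [f, spiderReplace]
  · simp [f, spiderReplace]
  · rcases h3 a with rfl | rfl | rfl <;> simp [f, spiderReplace, stem, thinSpider]
  · rcases h3 a with rfl | rfl | rfl <;> rcases h3 b with rfl | rfl | rfl <;>
      simp [f, spiderReplace, stem, thinSpider]
  · rcases h3 a with rfl | rfl | rfl <;> rcases b with b | b <;>
      simp [f, spiderReplace, stem, thinSpider]
  · rcases h3 a with rfl | rfl | rfl <;> rcases b with b | b <;>
      simp [f, spiderReplace, stem, thinSpider]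
  · simp [f, spiderReplace]
  · rcases h3 b with rfl | rfl | rfl <;> rcases a with a | a <;>
      simp [f, spiderReplace, stem, thinSpider]
  · simp [f, spiderReplace]
  · simp [f, spiderReplace]
  · simp [f, spiderReplace]
  · rcases h3 b with rfl | rfl | rfl <;> rcases a with a | a <;>
      simp [f, spiderReplace, stem, thinSpider]
  · simp [f, spiderReplace]
  · simp [f, spiderReplace]

/-- Contracting two clique vertices of a plugged spider. -/
lemma isSpiderReplacement_plug (hF : FamilyF (plug K C (thinSpider 3) (Set.range Sum.inl)))
    (hC : K.IsClique C) (hne : C.Nonempty) :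
    IsSpiderReplacement (plug K C (thinSpider 3) (Set.range Sum.inl))
      (plug (plug (plug K C stem {0, 1}) (Sum.inr '' {0}) (thinSpider 3) (Set.range Sum.inl))
      (Sum.inl '' (Sum.inr '' {0})) (thinSpider 3) (Set.range Sum.inl)) := by
  obtain ⟨hfin, hT, hc⟩ := hF.finite_treeLike_connected
  set G := plug K C (thinSpider 3) (Set.range Sum.inl) with hG
  obtain ⟨k, hk⟩ := hne
  -- the old clique and the pendant edges
  let Q : Set (W ⊕ (Fin 3 ⊕ Fin 3)) := {a | match a with
    | .inl w => w ∈ C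
    | .inr (.inl _) => True
    | .inr (.inr _) => False}
  let B : Fin 3 → Set (W ⊕ (Fin 3 ⊕ Fin 3)) := fun i => {.inr (.inl i), .inr (.inr i)}
  have hQ : G.IsClique Q := by
    rintro (a | a | a) ha (b | b | b) hb hab
    · exact hC ha hb fun h => hab (by rw [h])
    · exact ⟨ha, b, rfl⟩
    · exact hb.elim
    · exact ⟨hb, a, rfl⟩
    · exact fun h => hab (by rw [h])
    · exact hb.elim
    all_goals exact ha.elim
  have hB : ∀ i, G.IsClique (B i) := fun i => by
    rw [SimpleGraph.isClique_pair]
    exact fun _ => rfl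
  have hnbr : ∀ i a, G.Adj (.inr (.inl i)) a → a ∈ Q ∨ a = .inr (.inr i) := by
    rintro i (a | a | a) h
    · exact .inl h.1
    · exact .inl trivial
    · obtain rfl : i = a := h
      exact .inr rfl
  have hnbr' : ∀ i a, G.Adj (.inr (.inr i)) a → a = .inr (.inl i) := by
    rintro i (a | a | a) h
    · obtain ⟨-, b, hb⟩ := h
      simp at hb
    · obtain rfl : i = a := h
      rfl
    · exact h.elim
  have hsub : ∀ i S, G.IsClique S → .inr (.inr i) ∈ S → S ⊆ B i := by
    intro i S hS hi a ha
    by_cases h : .inr (.inr i) = a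
    · exact .inr h.symm
    · exact .inl (hnbr' i a (hS hi ha h))
  have hsub' : ∀ i S, G.IsClique S → .inr (.inl i) ∈ S → .inr (.inr i) ∉ S → S ⊆ Q := by
    intro i S hS hi hi' a ha
    by_cases h : .inr (.inl i) = a
    · rw [← h]; trivial
    · exact (hnbr i a (hS hi ha h)).resolve_right fun h' => hi' (h' ▸ ha)
  have hBm : ∀ i, Maximal (fun S => G.IsClique S) (B i) := fun i =>
    ⟨hB i, fun S hS h => hsub i S hS (h (by simp [B]))⟩
  have hQm : Maximal (fun S => G.IsClique S) Q := by
    refine ⟨hQ, fun S hS h => hsub' 0 S hS (h trivial) fun h' => ?_⟩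
    have := hsub 0 S hS h' (h (a := .inl k) hk)
    simp [B] at this
  have hbl := fun B => isBlock_iff_maximal_isClique hT hc (B := B)
  have hcut : ∀ i, IsCutpoint G (.inr (.inl i)) := by
    intro i
    rw [isCutpoint_iff_branching hT hc]
    refine ⟨.inl k, .inr (.inr i), ⟨hk, i, rfl⟩, rfl, by simp, ?_⟩
    rintro ⟨-, j, hj⟩
    simp at hj
  have hcut' : ∀ i, ¬ IsCutpoint G (.inr (.inr i)) := by
    intro i h
    rw [isCutpoint_iff_branching hT hc] at h
    obtain ⟨a, b, ha, hb, hab, -⟩ := h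
    exact hab ((hnbr' i a ha).trans (hnbr' i b hb).symm)
  have hend : ∀ i, IsEndblock G (B i) := by
    intro i
    refine ⟨(hbl _).2 (hBm i), Set.ncard_eq_one.2 ⟨.inr (.inl i), ?_⟩⟩
    ext a
    constructor
    · rintro ⟨rfl | rfl, h⟩
      · rfl
      · exact (hcut' i h).elim
    · rintro rfl
      exact ⟨.inl rfl, hcut i⟩
  have htwo : ∀ i, IsTwoCutpoint G (.inr (.inl i)) := by
    intro i
    refine ⟨hcut i, ?_, B i, hend i, .inl rfl⟩
    have : {S | IsBlock G S ∧ .inr (.inl i) ∈ S} = {B i, Q} := by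
      ext S
      constructor
      · rintro ⟨hS, hi⟩
        rw [hbl] at hS
        by_cases h : .inr (.inr i) ∈ S
        · exact .inl (hS.eq_of_le (hB i) (hsub i S hS.prop h))
        · exact .inr (hS.eq_of_le hQ (hsub' i S hS.prop hi h))
      · rintro (rfl | rfl)
        · exact ⟨(hbl _).2 (hBm i), .inl rfl⟩
        · exact ⟨(hbl _).2 hQm, trivial⟩
    rw [this, Set.ncard_pair]
    intro h
    have : (.inl k : W ⊕ (Fin 3 ⊕ Fin 3)) ∈ B i := h ▸ hk
    simp [B] at this
  refine ⟨{.inl k, .inr (.inl 0), .inr (.inl 1), .inr (.inl 2)}, .inr (.inl 1), .inr (.inl 2), B 1,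
    B 2, hQ.subset ?_, ?_, by simp, by simp, by simp, htwo 1, htwo 2, hend 1, .inl rfl, hend 2,
    .inl rfl, nonempty_iso_spiderReplace K C⟩
  · rintro _ (rfl | rfl | rfl | rfl)
    exacts [hk, trivial, trivial, trivial]
  · rw [Set.ncard_insert_of_notMem (by simp), Set.ncard_insert_of_notMem (by simp),
      Set.ncard_pair (by simp)]

/-- A node plugged into a graph, with the subtrees plugged in one after the other. -/
def plugNode (K : SimpleGraph W) (C : Set W) (l r : SpiderTree) :
    plug K C (SpiderTree.node l r).graph (SpiderTree.node l r).top ≃g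
      plug (plug (plug K C stem {0, 1}) (Sum.inr '' {0}) l.graph l.top)
        (Sum.inl '' (Sum.inr '' {0})) r.graph r.top :=
  (plugAssoc K C (plug stem {0} l.graph l.top) (Sum.inl '' {0, 1}) (Sum.inl '' {0}) r.graph
    r.top).trans (plugCongr (plugAssoc K C stem {0, 1} {0} l.graph l.top) (by
      rintro (a | a | a) <;> simp [plugAssoc]) r.graph r.top)

/-- The family contains, with a graph into which a thin spider of size 3 is plugged, all graphs in
which this spider is replaced by the graph of a tree. -/
lemma FamilyF.plug_tree (T : SpiderTree) {W : Type} {K : SimpleGraph W} {C : Set W}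
    (hC : K.IsClique C) (hne : C.Nonempty)
    (hF : FamilyF (plug K C (thinSpider 3) (Set.range Sum.inl))) :
    FamilyF (plug K C T.graph T.top) := by
  induction T generalizing W with
  | leaf => exact hF
  | node l r ihl ihr =>
    have h1 : FamilyF (plug (plug (plug K C stem {0, 1}) (Sum.inr '' {0}) (thinSpider 3)
        (Set.range Sum.inl)) (Sum.inl '' (Sum.inr '' {0})) (thinSpider 3) (Set.range Sum.inl)) :=
      .step hF (isSpiderReplacement_plug hF hC hne)
    have h2 := ihr (by simp) (by simp) h1
    have h3 := ihl (by simp) (by simp) (h2.of_iso (plugComm _ _ _ _ _ _ _))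
    exact (h3.of_iso (plugComm _ _ _ _ _ _ _)).of_iso (plugNode K C l r)

end Step

/-- The five clique vertices of the spider of size 5 are split into two and three. -/
lemma familyF_plug_thinSpider :
    FamilyF (plug (thinSpider 2) (Set.range Sum.inl) (thinSpider 3) (Set.range Sum.inl)) := by
  let f : (Fin 2 ⊕ Fin 2) ⊕ (Fin 3 ⊕ Fin 3) ≃ Fin 5 ⊕ Fin 5 :=
    (Equiv.sumSumSumComm _ _ _ _).trans (finSumFinEquiv.sumCongr finSumFinEquiv)
  refine .base ⟨f, ?_⟩
  rintro ((a | a) | (a | a)) ((b | b) | (b | b)) <;>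
    simp [f, thinSpider, Equiv.sumSumSumComm]

lemma isClique_range_inl (n : ℕ) : (thinSpider n).IsClique (Set.range Sum.inl) := by
  rintro _ ⟨i, rfl⟩ _ ⟨j, rfl⟩ h
  exact fun h' => h (by rw [h'])

/-- Three trees attached to one vertex. -/
def tripod (T₁ T₂ T₃ : SpiderTree) : SimpleGraph (((Unit ⊕ T₁.Vert) ⊕ T₂.Vert) ⊕ T₃.Vert) :=
  plug (plug (plug (⊥ : SimpleGraph Unit) {()} T₁.graph T₁.top) (Sum.inl '' {()}) T₂.graph T₂.top)
    (Sum.inl '' (Sum.inl '' {()})) T₃.graph T₃.top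

lemma familyF_tripod (T₁ T₂ T₃ : SpiderTree) : FamilyF (tripod T₁ T₂ T₃) := by
  have h1 : FamilyF (plug (plug (plug (thinSpider 2) (Set.range Sum.inl) stem {0, 1})
      (Sum.inr '' {0}) (thinSpider 3) (Set.range Sum.inl)) (Sum.inl '' (Sum.inr '' {0}))
      (thinSpider 3) (Set.range Sum.inl)) :=
    .step familyF_plug_thinSpider
      (isSpiderReplacement_plug familyF_plug_thinSpider (isClique_range_inl 2) ⟨_, 0, rfl⟩)
  -- the contracted vertex with the rest of the spider of size 5
  let f : Unit ⊕ (Fin 3 ⊕ Fin 3) ≃ (Fin 2 ⊕ Fin 2) ⊕ Fin 3 :=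
    { toFun := fun a => match a with
        | .inl _ => .inr 0
        | .inr (.inl 0) => .inl (.inl 0)
        | .inr (.inl 1) => .inl (.inl 1)
        | .inr (.inl 2) => .inr 1
        | .inr (.inr 0) => .inl (.inr 0)
        | .inr (.inr 1) => .inl (.inr 1)
        | .inr (.inr 2) => .inr 2
      invFun := fun a => match a with
        | .inr 0 => .inl ()
        | .inl (.inl 0) => .inr (.inl 0)
        | .inl (.inl 1) => .inr (.inl 1)
        | .inr 1 => .inr (.inl 2)
        | .inl (.inr 0) => .inr (.inr 0)
        | .inl (.inr 1) => .inr (.inr 1)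
        | .inr 2 => .inr (.inr 2)
      left_inv := by decide
      right_inv := by decide }
  have h3 : ∀ i : Fin 3, i = 0 ∨ i = 1 ∨ i = 2 := by decide
  let g : plug (⊥ : SimpleGraph Unit) {()} (thinSpider 3) (Set.range Sum.inl) ≃g
      plug (thinSpider 2) (Set.range Sum.inl) stem {0, 1} :=
    { toEquiv := f
      map_rel_iff' := by
        rintro (a | a | a) (b | b | b) <;> (try rcases h3 a with rfl | rfl | rfl) <;>
          (try rcases h3 b with rfl | rfl | rfl) <;> simp [f, stem, thinSpider] }
  let g2 := plugCongr g (C := Sum.inl '' {()}) (C' := Sum.inr '' {0}) (by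
    rintro (a | a | a) <;> (try rcases h3 a with rfl | rfl | rfl) <;> simp [g, f])
    (thinSpider 3) (Set.range Sum.inl)
  let g3 := plugCongr g2 (C := Sum.inl '' (Sum.inl '' {()})) (C' := Sum.inl '' (Sum.inr '' {0})) (by
    rintro ((a | a | a) | a) <;> (try rcases h3 a with rfl | rfl | rfl) <;>
      simp [g2, g, f, plugCongr]) (thinSpider 3) (Set.range Sum.inl)
  have h4 : FamilyF (tripod .leaf .leaf .leaf) := h1.of_iso g3
  have h5 : FamilyF (tripod .leaf .leaf T₁) := h4.plug_tree T₁ (by simp) (by simp)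
  have h6 : FamilyF (tripod .leaf T₁ T₂) :=
    (h5.of_iso (plugComm _ _ _ _ _ _ _)).plug_tree T₂ (by simp) (by simp)
  -- the first slot is moved to the end
  let g4 := plugCongr (plugComm (⊥ : SimpleGraph Unit) {()} {()} T₁.graph T₁.top (thinSpider 3)
    (Set.range Sum.inl)) (C := Sum.inl '' (Sum.inl '' {()})) (C' := Sum.inl '' (Sum.inl '' {()}))
    (by rintro ((a | a) | a) <;> simp [plugComm]) T₂.graph T₂.top
  have h7 : FamilyF (tripod T₁ T₂ .leaf) :=
    (h6.of_iso g4).of_iso (plugComm _ _ _ _ _ _ _)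
  exact h7.plug_tree T₃ (by simp) (by simp)

lemma exists_familyF_card (n : ℕ) :
    ∃ (W : Type) (F : SimpleGraph W), FamilyF F ∧ n < Nat.card W := by
  obtain ⟨T, hT⟩ := SpiderTree.exists_card n
  refine ⟨_, _, familyF_plug_thinSpider.plug_tree T (isClique_range_inl 2) ⟨_, 0, rfl⟩, ?_⟩
  rw [Nat.card_sum]
  omega

/-! ### Forced ends -/

section Hang

variable {V : Type*} {G : SimpleGraph V}

/-- The graph of a tree hangs at `v` on the side of `a`: it is an induced subgraph on this side of
`v`, and the neighbours of `v` in it are its top vertices. Then every representation has the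
block of the edge `va` at an end of the path of `v`. -/
def Hangs (G : SimpleGraph V) (v a : V) : Prop :=
  ∃ (T : SpiderTree) (f : T.graph ↪g G), ∀ u, (G.Adj v (f u) ↔ u ∈ T.top) ∧ f u ∈ side G v a

lemma Hangs.congr {v a b : V} (h : Hangs G v a) (hva : G.Adj v a) (hvb : G.Adj v b)
    (hab : G.Adj a b) : Hangs G v b := by
  obtain ⟨T, f, hf⟩ := h
  exact ⟨T, f, fun u =>
    ⟨(hf u).1, side_trans (mem_side_of_adj hab.symm hvb.ne hva.ne) (hf u).2⟩⟩

/-- Embeddings of two graphs on different sides of a vertex combine to an embedding. -/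
lemma exists_plug_embedding {X U : Type*} {K : SimpleGraph X} {A : SimpleGraph U} {C : Set X}
    {D : Set U} {v a : V} (g : K ↪g G) {k : X} (hk : g k = v) (hC : ∀ w, w ∈ C ↔ w = k)
    (f : A ↪g G) (hf : ∀ u, (G.Adj v (f u) ↔ u ∈ D) ∧ f u ∈ side G v a)
    (hg : ∀ w, w ≠ k → g w ∉ side G v a) :
    ∃ h : plug K C A D ↪g G, (∀ w, h (.inl w) = g w) ∧ ∀ u, h (.inr u) = f u := by
  subst hk
  have hg' : ∀ w, g w ∉ side G (g k) a := by
    intro w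
    by_cases hw : w = k
    · rw [hw]; exact not_mem_side
    · exact hg w hw
  have hadj : ∀ w u, G.Adj (g w) (f u) ↔ w ∈ C ∧ u ∈ D := by
    intro w u
    rw [hC]
    by_cases hw : w = k
    · rw [hw, (hf u).1]
      simp
    · refine iff_of_false (fun h => ?_) fun h => hw h.1
      rcases side_closed (hf u).2 h.symm with h' | h'
      exacts [hg w hw h', hw (g.injective h')]
  refine ⟨⟨⟨Sum.elim g f, ?_⟩, ?_⟩, fun _ => rfl, fun _ => rfl⟩
  · rintro (w | u) (w' | u') h
    · exact congrArg _ (g.injective h)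
    · exact (hg' w ((show g w = f u' from h) ▸ (hf u').2)).elim
    · exact (hg' w' ((show f u = g w' from h) ▸ (hf u).2)).elim
    · exact congrArg _ (f.injective h)
  · rintro (w | u) (w' | u')
    · exact g.map_adj_iff
    · exact hadj w u'
    · exact (G.adj_comm _ _).trans (hadj w' u)
    · exact f.map_adj_iff

/-- A branching vertex has a neighbour outside each of its blocks. -/
lemma Branching.exists_pendant (hT : TreeLike G) {c w : V} (hc : Branching G c) (hcw : G.Adj c w) :
    ∃ s, G.Adj c s ∧ s ≠ w ∧ ¬ G.Adj s w := by
  obtain ⟨p, q, hp, hq, hpq, hn⟩ := hc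
  by_contra! hcon
  by_cases hpw : p = w
  · subst hpw
    exact hn (hcon q hq hpq.symm).symm
  by_cases hqw : q = w
  · subst hqw
    exact hn (hcon p hp hpq)
  exact hn (hT.adj_of_adj_edge hpq hp hq (hcon p hp hpw).symm (hcon q hq hqw).symm hcw.ne)

lemma TreeLike.not_adj_of_pendant (hT : TreeLike G) {c w s u : V} (hcw : G.Adj c w)
    (hcs : G.Adj c s) (hsw : s ≠ w) (hn : ¬ G.Adj s w) (huc : G.Adj u c) (huw : G.Adj u w) :
    s ≠ u ∧ ¬ G.Adj s u :=
  ⟨fun h => hn (h ▸ huw), fun h => hn (hT.adj_of_adj_edge hsw hcs hcw h.symm huw huc.ne')⟩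

/-- A clique with neighbours of its vertices that see no other vertex of it induces a thin
spider. -/
lemma TreeLike.exists_thinSpider_embedding (hT : TreeLike G) {n : ℕ} {c s : Fin n → V}
    (hc : ∀ i j, i ≠ j → G.Adj (c i) (c j)) (hs : ∀ i, G.Adj (c i) (s i))
    (hn : ∀ i j, i ≠ j → s i ≠ c j ∧ ¬ G.Adj (s i) (c j)) :
    ∃ f : thinSpider n ↪g G, (∀ i, f (.inl i) = c i) ∧ ∀ i, f (.inr i) = s i := by
  have hcs : ∀ i j, G.Adj (c i) (s j) ↔ i = j := by
    intro i j
    constructor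
    · intro h
      by_contra hij
      exact (hn j i (Ne.symm hij)).2 h.symm
    · rintro rfl; exact hs i
  have hcs' : ∀ i j, c i ≠ s j := by
    intro i j h
    by_cases hij : i = j
    · subst hij; exact (hs i).ne h
    · exact (hn j i (Ne.symm hij)).1 h.symm
  refine ⟨⟨⟨Sum.elim c s, ?_⟩, ?_⟩, fun _ => rfl, fun _ => rfl⟩
  · rintro (i | i) (j | j) h
    · by_contra hij
      exact (hc i j fun h' => hij (by rw [h'])).ne h
    · exact (hcs' i j h).elim
    · exact (hcs' j i h.symm).elim
    · have h : s i = s j := h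
      have := (hcs j i).1 (h ▸ hs j)
      rw [this]
  · rintro (i | i) (j | j)
    · exact ⟨fun h h' => h.ne (by rw [h']), hc i j⟩
    · exact hcs i j
    · exact (G.adj_comm _ _).trans ((hcs j i).trans eq_comm)
    · refine iff_of_false (fun h => ?_) id
      have h : G.Adj (s i) (s j) := h
      have hij : i ≠ j := by rintro rfl; exact G.irrefl h
      exact (hn i j hij).2 (hT.adj_of_adj_edge (hn i j hij).1 (hs i) (hc i j hij) h.symm
        (hs j).symm (hcs' i j))

/-- A clique of four branching vertices forces each of them. -/
lemma TreeLike.hangs_of_clique_four (hT : TreeLike G) {k : Fin 4 → V}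
    (hk : ∀ i j, i ≠ j → G.Adj (k i) (k j)) (hb : ∀ i, Branching G (k i)) :
    Hangs G (k 0) (k 1) := by
  have h0 : ∀ i : Fin 3, G.Adj (k i.succ) (k 0) := fun i => hk _ _ (Fin.succ_ne_zero i)
  choose s hs hs0 hsn using fun i : Fin 3 => (hb i.succ).exists_pendant hT (h0 i)
  have hss : ∀ i j : Fin 3, i ≠ j → G.Adj (k i.succ) (k j.succ) := fun i j hij =>
    hk _ _ fun h => hij (Fin.succ_injective _ h)
  obtain ⟨f, hf1, hf2⟩ := hT.exists_thinSpider_embedding hss hs fun i j hij =>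
    hT.not_adj_of_pendant (h0 i) (hs i) (hs0 i) (hsn i) (hss j i hij.symm) (h0 j)
  have hside : ∀ i : Fin 3, k i.succ ∈ side G (k 0) (k 1) := by
    intro i
    by_cases hi : i = 0
    · rw [hi]; exact mem_side_self (h0 0).ne'
    · exact mem_side_of_adj (hss 0 i (Ne.symm hi)) (h0 0).ne' (h0 i).ne'
  have key : ∀ u : Fin 3 ⊕ Fin 3, (G.Adj (k 0) (f u) ↔ u ∈ Set.range Sum.inl) ∧
      f u ∈ side G (k 0) (k 1) := by
    rintro (i | i)
    · rw [hf1]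
      exact ⟨iff_of_true (h0 i).symm ⟨i, rfl⟩, hside i⟩
    · rw [hf2]
      exact ⟨iff_of_false (fun h => hsn i h.symm) (by simp),
        side_trans (hside i) (mem_side_of_adj (hs i) (h0 i).ne' (hs0 i).symm)⟩
  exact ⟨.leaf, f, key⟩

/-- In a triangle of branching vertices `v`, `a`, `b`, the vertex `v` is forced if `a` is forced by
two other blocks. -/
lemma TreeLike.hangs_of_triangle (hT : TreeLike G) {v a b p q : V} (hva : G.Adj v a)
    (hvb : G.Adj v b) (hab : G.Adj a b) (hb : Branching G b) (hap : G.Adj a p) (haq : G.Adj a q)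
    (hpq : p ≠ q) (hnpq : ¬ G.Adj p q) (hpv : p ≠ v) (hnpv : ¬ G.Adj p v) (hqv : q ≠ v)
    (hnqv : ¬ G.Adj q v) (hp : Hangs G a p) (hq : Hangs G a q) : Hangs G v a := by
  obtain ⟨s, hbs, hsa, hnsa⟩ := hb.exists_pendant hT hab.symm
  obtain ⟨hsv, hnsv⟩ := hT.not_adj_of_pendant hab.symm hbs hsa hnsa hvb hva
  -- `b` and `s` lie on the side of `v`
  have hout : ∀ p, G.Adj a p → p ≠ v → ¬ G.Adj p v →
      b ∉ side G a p ∧ s ∉ side G a p ∧ v ∉ side G a p := by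
    intro p hap hpv hnpv
    have hbp : b ∉ side G a p := by
      refine hT.not_mem_side hap hab ?_ ?_
      · rintro rfl; exact hnpv hvb.symm
      · exact fun h => hnpv (hT.adj_of_adj_edge hpv hap hva.symm h.symm hvb.symm hab.ne)
    refine ⟨hbp, fun h => ?_, hT.not_mem_side hap hva.symm hpv hnpv⟩
    exact (side_closed h hbs.symm).elim hbp hab.ne'
  obtain ⟨l, f, hf⟩ := hp
  obtain ⟨r, g, hg⟩ := hq
  obtain ⟨bp, sp, vp⟩ := hout p hap hpv hnpv
  obtain ⟨bq, sq, vq⟩ := hout q haq hqv hnqv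
  have h3 : ∀ i : Fin 3, i = 0 ∨ i = 1 ∨ i = 2 := by decide
  obtain ⟨g₀, e0, e1, e2⟩ : ∃ g₀ : stem ↪g G, g₀ 0 = a ∧ g₀ 1 = b ∧ g₀ 2 = s := by
    refine ⟨⟨⟨![a, b, s], ?_⟩, ?_⟩, rfl, rfl, rfl⟩
    · intro i j h
      rcases h3 i with rfl | rfl | rfl <;> rcases h3 j with rfl | rfl | rfl <;>
        simp [hab.ne, hab.ne', hbs.ne, hbs.ne', hsa, hsa.symm] at h ⊢
    · intro i j
      have hnas : ¬ G.Adj a s := fun h => hnsa h.symm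
      change G.Adj (![a, b, s] i) (![a, b, s] j) ↔ stem.Adj i j
      rcases h3 i with rfl | rfl | rfl <;> rcases h3 j with rfl | rfl | rfl <;>
        simp [stem, hab, hab.symm, hbs, hbs.symm, hnsa, hnas]
  obtain ⟨h₁, h1l, h1r⟩ := exists_plug_embedding (C := {0}) (D := l.top) g₀ e0 (fun w => .rfl) f hf
    (by
      intro w hw
      rcases h3 w with rfl | rfl | rfl
      · exact (hw rfl).elim
      · rwa [e1]
      · rwa [e2])
  obtain ⟨h₂, h2l, h2r⟩ := exists_plug_embedding (C := Sum.inl '' {0}) (D := r.top) (k := .inl 0)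
    (v := a) (a := q) h₁ (by rw [h1l, e0]) (fun w => by simp) g hg (by
      rintro (w | u) hw
      · rw [h1l]
        rcases h3 w with rfl | rfl | rfl
        · exact (hw rfl).elim
        · rwa [e1]
        · rwa [e2]
      · rw [h1r]
        exact side_disjoint (hT.not_mem_side hap haq hpq hnpq) (hf u).2)
  have hsb : b ∈ side G v a := mem_side_of_adj hab hva.ne hvb.ne
  have key : ∀ u : (Fin 3 ⊕ l.Vert) ⊕ r.Vert, (G.Adj v (h₂ u) ↔
      u ∈ (Sum.inl '' (Sum.inl '' {0, 1}) : Set ((Fin 3 ⊕ l.Vert) ⊕ r.Vert))) ∧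
      h₂ u ∈ side G v a := by
    rintro ((i | u) | u)
    · rw [h2l, h1l]
      rcases h3 i with rfl | rfl | rfl
      · rw [e0]
        exact ⟨iff_of_true hva (by simp), mem_side_self hva.ne⟩
      · rw [e1]
        exact ⟨iff_of_true hvb (by simp), hsb⟩
      · rw [e2]
        exact ⟨iff_of_false (fun h => hnsv h.symm) (by simp),
          side_trans hsb (mem_side_of_adj hbs hvb.ne hsv.symm)⟩
    · rw [h2l, h1r]
      exact ⟨iff_of_false (fun h => (side_closed (hf u).2 h.symm).elim vp hva.ne) (by simp),
        side_subset_side vp hva hap hpv.symm (hf u).2⟩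
    · rw [h2r]
      exact ⟨iff_of_false (fun h => (side_closed (hg u).2 h.symm).elim vq hva.ne) (by simp),
        side_subset_side vq hva haq hqv.symm (hg u).2⟩
  exact ⟨.node l r, h₂, key⟩

/-- A vertex is forced by at most two blocks. -/
lemma IsFamilyFFree.not_hangs_three (hT : TreeLike G) (hF : IsFamilyFFree G) {v a b c : V}
    (ha : G.Adj v a) (hb : G.Adj v b) (hc : G.Adj v c) (hab : a ≠ b) (hac : a ≠ c) (hbc : b ≠ c)
    (nab : ¬ G.Adj a b) (nac : ¬ G.Adj a c) (nbc : ¬ G.Adj b c) (h1 : Hangs G v a)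
    (h2 : Hangs G v b) (h3 : Hangs G v c) : False := by
  obtain ⟨T₁, f₁, hf₁⟩ := h1
  obtain ⟨T₂, f₂, hf₂⟩ := h2
  obtain ⟨T₃, f₃, hf₃⟩ := h3
  let g : (⊥ : SimpleGraph Unit) ↪g G := ⟨⟨fun _ => v, fun _ _ _ => rfl⟩, by simp⟩
  obtain ⟨g₁, g1l, g1r⟩ := exists_plug_embedding (C := {()}) (D := T₁.top) (k := ()) g rfl
    (fun w => .rfl) f₁ hf₁ (fun w hw => (hw rfl).elim)
  obtain ⟨g₂, g2l, g2r⟩ := exists_plug_embedding (C := Sum.inl '' {()}) (D := T₂.top)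
    (k := .inl ()) (v := v) (a := b) g₁ (g1l ()) (fun w => by simp) f₂ hf₂ (by
      rintro (w | u) hw
      · exact (hw rfl).elim
      · rw [g1r]
        exact side_disjoint (hT.not_mem_side ha hb hab nab) (hf₁ u).2)
  obtain ⟨g₃, -⟩ := exists_plug_embedding (C := Sum.inl '' (Sum.inl '' {()})) (D := T₃.top)
    (k := .inl (.inl ())) (v := v) (a := c) g₂ ((g2l _).trans (g1l ()))
    (fun w => by simp) f₃ hf₃ (by
      rintro ((w | u) | u) hw
      · exact (hw rfl).elim
      · rw [g2l, g1r]
        exact side_disjoint (hT.not_mem_side ha hc hac nac) (hf₁ u).2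
      · rw [g2r]
        exact side_disjoint (hT.not_mem_side hb hc hbc nbc) (hf₂ u).2)
  exact hF _ _ (familyF_tripod T₁ T₂ T₃) ⟨g₃⟩

lemma IsFamilyFFree.not_clique_five (hT : TreeLike G) (hF : IsFamilyFFree G) {k : Fin 5 → V}
    (hk : ∀ i j, i ≠ j → G.Adj (k i) (k j)) (hb : ∀ i, Branching G (k i)) : False := by
  have hs : ∀ i, ∃ s, G.Adj (k i) s ∧ ∀ j, i ≠ j → s ≠ k j ∧ ¬ G.Adj s (k j) := by
    intro i
    obtain ⟨l, hl⟩ := exists_ne i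
    obtain ⟨s, hs, hsl, hn⟩ := (hb i).exists_pendant hT (hk i l hl.symm)
    refine ⟨s, hs, fun j hij => ?_⟩
    by_cases hlj : l = j
    · subst hlj; exact ⟨hsl, hn⟩
    · exact hT.not_adj_of_pendant (hk i l hl.symm) hs hsl hn (hk j i hij.symm)
        (hk j l (Ne.symm hlj))
  choose s hs hn using hs
  obtain ⟨f, -⟩ := hT.exists_thinSpider_embedding hk hs hn
  exact hF _ _ (.base ⟨.refl⟩) ⟨f⟩

/-- The block of `va` is the block of `v` towards the root `r`. -/
def Upward (G : SimpleGraph V) (r v a : V) : Prop := v ≠ r ∧ r ∈ side G v a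

/-- In an edge, one of the two ends is farther from the root. -/
lemma upward_or_upward (hG : G.Connected) (r : V) {a b : V} (hab : G.Adj a b) :
    Upward G r a b ∨ Upward G r b a := by
  classical
  by_cases har : a = r
  · subst har
    exact .inr ⟨hab.ne', mem_side_self hab.ne'⟩
  obtain ⟨p, hp⟩ := (hG.preconnected a r).exists_isPath
  by_cases hbp : b ∈ p.support
  · refine .inl ⟨har, p.dropUntil b hbp, fun h => ?_⟩
    have hnd := hp.support_nodup
    rw [← p.take_spec hbp, SimpleGraph.Walk.support_append, List.nodup_append] at hnd
    rw [SimpleGraph.Walk.mem_support_iff] at h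
    exact hnd.2.2 a (p.takeUntil b hbp).start_mem_support a (h.resolve_left hab.ne) rfl
  · exact .inr ⟨fun h => hbp (h ▸ p.end_mem_support), p, hbp⟩

/-- In a block graph without members of the family, an admissible choice of ends consists of the
forced ends together with, for each vertex, the block towards a root if this leaves the vertex with
at most two ends. -/
lemma IsFamilyFFree.exists_admissible (hT : TreeLike G) (hG : G.Connected)
    (hF : IsFamilyFFree G) : ∃ e, Admissible G e := by
  obtain ⟨r⟩ := hG.nonempty
  let other : V → V → Prop := fun v a => ∃ p q, G.Adj v p ∧ G.Adj v q ∧ p ≠ q ∧ ¬ G.Adj p q ∧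
    p ≠ a ∧ ¬ G.Adj p a ∧ q ≠ a ∧ ¬ G.Adj q a ∧ Hangs G v p ∧ Hangs G v q
  have hother : ∀ v a b, G.Adj v a → G.Adj v b → G.Adj a b → other v b → other v a := by
    rintro v a b hva hvb hab ⟨p, q, hp, hq, hpq, hn, hpb, hnpb, hqb, hnqb, h⟩
    have key : ∀ p, G.Adj v p → p ≠ b → ¬ G.Adj p b → p ≠ a ∧ ¬ G.Adj p a := fun p hp hpb hn =>
      ⟨fun h => hn (h ▸ hab), fun h => hn (hT.adj_of_adj_edge hpb hp hvb h.symm hab hva.ne)⟩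
    exact ⟨p, q, hp, hq, hpq, hn, (key p hp hpb hnpb).1, (key p hp hpb hnpb).2,
      (key q hq hqb hnqb).1, (key q hq hqb hnqb).2, h⟩
  have hup : ∀ v a b, G.Adj v a → G.Adj v b → a ≠ b → Upward G r v a → Upward G r v b →
      G.Adj a b := fun v a b hva hvb hab ha hb =>
    hT.adj_of_mem_side hva hvb hab (side_trans ha.2 (side_symm hb.2))
  refine ⟨fun v a => Hangs G v a ∨ (Upward G r v a ∧ ¬ other v a), ?_, ?_, ?_, ?_, ?_⟩
  · rintro v a b hva hvb hab (h | ⟨h, ho⟩)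
    · exact .inl (h.congr hva hvb hab)
    · exact .inr ⟨⟨h.1, side_trans (mem_side_of_adj hab.symm hvb.ne hva.ne) h.2⟩,
        fun h' => ho (hother v a b hva hvb hab h')⟩
  · intro v a b c ha hb hc ea eb ec hab hac hbc
    by_contra! hn
    obtain ⟨nab, nac, nbc⟩ := hn
    have sym : ∀ {x y}, ¬ G.Adj x y → ¬ G.Adj y x := fun h h' => h h'.symm
    rcases ea with ha' | ⟨ua, oa⟩
    · rcases eb with hb' | ⟨ub, ob⟩
      · rcases ec with hc' | ⟨uc, oc⟩
        · exact hF.not_hangs_three hT ha hb hc hab hac hbc nab nac nbc ha' hb' hc'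
        · exact oc ⟨a, b, ha, hb, hab, nab, hac, nac, hbc, nbc, ha', hb'⟩
      · rcases ec with hc' | ⟨uc, oc⟩
        · exact ob ⟨a, c, ha, hc, hac, nac, hab, nab, hbc.symm, sym nbc, ha', hc'⟩
        · exact nbc (hup v b c hb hc hbc ub uc)
    · rcases eb with hb' | ⟨ub, ob⟩
      · rcases ec with hc' | ⟨uc, oc⟩
        · exact oa ⟨b, c, hb, hc, hbc, nbc, hab.symm, sym nab, hac.symm, sym nac, hb', hc'⟩
        · exact nac (hup v a c ha hc hac ua uc)
      · exact nab (hup v a b ha hb hab ua ub)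
  · intro a b c hab hac hbc hBa hBb hBc
    by_contra hn
    rw [not_or] at hn
    have key : ∀ a b, G.Adj a b → G.Adj a c → G.Adj b c →
        ¬ (Hangs G b a ∨ (Upward G r b a ∧ ¬ other b a)) → ¬ other a b := by
      rintro a b hab hac hbc hn ⟨p, q, hp, hq, hpq, hnpq, hpb, hnpb, hqb, hnqb, h1, h2⟩
      exact hn (.inl (hT.hangs_of_triangle hab.symm hbc hac hBc hp hq hpq hnpq hpb hnpb hqb hnqb
        h1 h2))
    have o1 := key a b hab hac hbc hn.2
    have o2 := key b a hab.symm hbc hac hn.1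
    rcases upward_or_upward hG r hab with h | h
    · exact hn.1 (.inr ⟨h, o1⟩)
    · exact hn.2 (.inr ⟨h, o2⟩)
  · exact fun k hk hb => .inl (hT.hangs_of_clique_four hk hb)
  · exact fun k hk hb => hF.not_clique_five hT hk hb

end Hang

theorem theorem3 :
    (∀ (V : Type*) [Finite V] (G : SimpleGraph V), IsBlockGraph G →
      (IsB0VPG G ↔ IsFamilyFFree G)) ∧
    (∀ (W : Type) (F : SimpleGraph W), FamilyF F → IsMinimalNonB0VPG F) ∧
    (∀ n : ℕ, ∃ (W : Type) (F : SimpleGraph W), FamilyF F ∧ n < Nat.card W) := by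
  refine ⟨fun V _ G hG => ⟨?_, fun hF => ?_⟩, fun W F hF => hF.isMinimalNonB0VPG,
    exists_familyF_card⟩
  · rintro hB W F hF ⟨f⟩
    exact hF.not_isB0VPG (hB.of_embedding f)
  · obtain ⟨e, he⟩ := hF.exists_admissible hG.treeLike hG.1
    exact hG.treeLike.isB0VPG he
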